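/- **Theorem 3 (Uniform consistency of the inverse of the estimated dynamic matrix).** *Model.* Let $(\boldsymbol Y_i,\boldsymbol U_i)$, $i\le n$, be i.i.d. with $\boldsymbol U_i\sim\mathrm{Unif}([0,1]^d)$ and $\boldsymbol Y_i\in\mathbb R^p$, $p=p_n$; for every $\boldsymbol u\in[0,1]^d$ let $\mathbb E(\cdot\mid\boldsymbol U=\boldsymbol u)$ refer to a regular conditional distribution of $\boldsymbol Y$ given $\boldsymbol U$, and let $\boldsymbol\Sigma(\boldsymbol u)=(\sigma_{jr}(\boldsymbol u))=\mathbb E(\boldsymbol Y\boldsymbol Y^\top|\boldsymbol U=\boldsymbol u)-\mathbb E(\boldsymbol Y|\boldsymbol U=\boldsymbol u)\,\mathbb E(\boldsymbol Y|\boldsymbol U=\boldsymbol u)^\top$. Let $d,k\ge1$ be integers and $0<\omega\le 0.2$, $0<\pi\le1$, $0\le q<1$, $C_L,\sigma_B,m,M_1$, $\epsilon>0$ be constants (not depending on $n$). *Forests.* Each tree is grown on a subsample of size $s=s_n$ drawn without replacement and divided at random into a splitting half $\mathcal J_1$ and an estimation half $\mathcal J_2$ (with $|\mathcal J_2|=\lfloor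 s/2\rfloor$). It is a recursive axis-aligned partition of $[0,1]^d$, determined by the observations in $\mathcal J_1$, the covariates (not the responses) in $\mathcal J_2$, and independent auxiliary randomness (honesty). Its distribution is invariant under permutations of the observations within $\mathcal J_1$ and within $\mathcal J_2$ (symmetry). A node is split if and only if it holds at least $2k$ observations of $\mathcal J_2$; each child receives at least $k$ observations of $\mathcal J_2$ and at least a fraction $\omega$ of those of its parent ($\omega$-regularity), so each leaf holds between $k$ and $2k-1$ observations of $\mathcal J_2$ once $|\mathcal J_2|\ge k$. At every split, conditionally on the observations and on the splits made at the ancestors of the node, each feature is selected with probability at least $\pi/d$ (random-split). (These properties are required when no two observations share a covariate coordinate, which has probability one.) Given $\boldsymbol u$, the $b$-th tree gives weight $1/|\mathcal N|$ to each of the observations $\mathcal N\subset\mathcal J_2$ in the leaf of $\boldsymbol u$ and weight $0$ to the others. Let $\beta_i(\boldsymbol u)$ and $\alpha_i(\boldsymbol u)$ be the weights averaged over the $B=B_n$ trees of two forests; within each forest the trees are grown with independent subsamples and randomness, all independent of the data. Put $\widehat{\boldsymbol\Sigma}(\boldsymbol u)=\sum_i\beta_i(\boldsymbol u)\boldsymbol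 Y_i\boldsymbol Y_i^\top-\{\sum_i\alpha_i(\boldsymbol u)\boldsymbol Y_i\}\{\sum_i\alpha_i(\boldsymbol u)\boldsymbol Y_i\}^\top$. Let $s_\lambda:\mathbb R\to\mathbb R$, $\lambda>0$, satisfy $|s_\lambda(z)|\le|z|$, $s_\lambda(z)=0$ for $|z|\le\lambda$, and $|s_\lambda(z)-z|\le\lambda$; $s_\lambda(\boldsymbol A)$ applies $s_\lambda$ to the off-diagonal entries of $\boldsymbol A$ and keeps the diagonal. *Conditions on the law of $(\boldsymbol Y,\boldsymbol U)$.* Every $X\in\{Y_j,\,Y_jY_r: j,r\in[p]\}$ has $\boldsymbol u\mapsto\mathbb E(X|\boldsymbol U=\boldsymbol u)$ Lipschitz with constant $C_L$ for $\|\cdot\|_\infty$, and, for all $\boldsymbol u$ and all integers $l\ge2$, $|\mathbb E(\{X-\mathbb E(X|\boldsymbol U=\boldsymbol u)\}^l\mid\boldsymbol U=\boldsymbol u)|\le\frac12\,l!\,\sigma_B^2m^{l-2}$ (all these moments being finite). For every tree $b$, with tree weights $\beta_{bi},\alpha_{bi}$, $\mathbb E\sup_{\boldsymbol u}\max_{j,r}|\sum_i\beta_{bi}(\boldsymbol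 u)Y_{ij}Y_{ir}|<\infty$ and $\mathbb E\sup_{\boldsymbol u}\max_j|\sum_i\alpha_{bi}(\boldsymbol u)Y_{ij}|<\infty$. The family $\{\boldsymbol\Sigma(\boldsymbol u)\}$ belongs to $\mathcal U(q,c_0(p),M_1,\epsilon;[0,1]^d)$, that is, for all $j$, $\sup_{\boldsymbol u}\sigma_{jj}(\boldsymbol u)<M_1$ and $\sup_{\boldsymbol u}\sum_{r}|\sigma_{jr}(\boldsymbol u)|^q\le c_0(p)$ (with $0^0=0$), and $\inf_{\boldsymbol u}\mu_{\min}(\boldsymbol\Sigma(\boldsymbol u))\ge\epsilon$. *Claim.* Let $$r_n=\sqrt{s\{\log n+\log p\}/n}+s^{-\frac12\frac{\log(1-\omega)}{\log\omega}\frac{\pi}{d}}.$$ There is $M_0>0$, depending only on $d,k,\omega,\pi,q,C_L,\sigma_B,m,M_1,\epsilon$, such that the following holds. Suppose that, as $n\to\infty$, $s\to\infty$, $s/n\to0$, $s\log(p)/n\to0$ and $c_0(p)\,r_n^{1-q}\to0$, that the numbers of trees $B_n$ are sufficiently large ($B_n\ge B_0(n)$ for some $B_0(n)$ not depending on the law of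 $(\boldsymbol Y,\boldsymbol U)$), and that $\lambda_n(\boldsymbol u)=M(\boldsymbol u)\,r_n$ with $M(\boldsymbol u)\ge M_0$ for all $\boldsymbol u$ and $\sup_{\boldsymbol u}M(\boldsymbol u)<\infty$. Then, uniformly over all laws of $(\boldsymbol Y,\boldsymbol U)$ that satisfy the above conditions, with probability tending to one $s_{\lambda_n(\boldsymbol u)}(\widehat{\boldsymbol\Sigma}(\boldsymbol u))$ is invertible for all $\boldsymbol u\in[0,1]^d$, and $$\sup_{\boldsymbol u\in[0,1]^d}\left\|\left(s_{\lambda_n(\boldsymbol u)}(\widehat{\boldsymbol\Sigma}(\boldsymbol u))\right)^{-1}-\boldsymbol\Sigma^{-1}(\boldsymbol u)\right\|_2=\mathcal O_p\left(c_0(p)\,r_n^{1-q}\right),$$ $$\frac1p\sup_{\boldsymbol u\in[0,1]^d}\left\|\left(s_{\lambda_n(\boldsymbol u)}(\widehat{\boldsymbol\Sigma}(\boldsymbol u))\right)^{-1}-\boldsymbol\Sigma^{-1}(\boldsymbol u)\right\|_F^2=\mathcal O_p\left(c_0(p)\,r_n^{2-q}\right).$$ Here $X_n=\mathcal O_p(a_n)$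 uniformly over the laws means that for every $\delta>0$ there are $K$ and $N$ such that $P(X_n>Ka_n)\le\delta$ for all $n\ge N$ and all these laws (with outer probability, where $X_n$ is infinite if some matrix is not invertible). -/

import Mathlib

open MeasureTheory ProbabilityTheory Filter Topology
open scoped ENNReal Nat

namespace ForestCov

noncomputable section

/-- The covariate space `[0,1]^d`; its distance is the `L_∞` distance and its canonical measure
`volume` is the uniform distribution. -/
abbrev Cube (d : ℕ) : Type := Fin d → unitInterval

/-! ### Axis-aligned binary trees

A node is the list of the turns (`true` = left) that lead to it from the root, the last turn first,
so that its ancestors are the proper suffixes of the list.  A labelling attaches to each node the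
feature and the threshold of the cut made there. -/

abbrev Labels (d : ℕ) : Type := List Bool → Fin d × ℝ

/-- The hyperrectangle of a node. -/
def cell {d : ℕ} (ℓ : Labels d) : List Bool → Set (Cube d)
  | [] => Set.univ
  | b :: v => {u | u ∈ cell ℓ v ∧ (b = true ↔ ((u (ℓ v).1 : unitInterval) : ℝ) ≤ (ℓ v).2)}

open Classical in
/-- The number of points among `x` in the hyperrectangle of the node `v`. -/
def nodeCount {d b : ℕ} (x : Fin b → Cube d) (ℓ : Labels d) (v : List Bool) : ℕ :=
  (Finset.univ.filter fun i => x i ∈ cell ℓ v).card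

/-- A node of the tree is split as long as it holds at least `2k` of the points `x`. -/
def IsInternal {d b : ℕ} (k : ℕ) (x : Fin b → Cube d) (ℓ : Labels d) (v : List Bool) : Prop :=
  2 * k ≤ nodeCount x ℓ v

/-- Terminal nodes: nodes that are not split, and whose parent (if any) is split. -/
def IsLeaf {d b : ℕ} (k : ℕ) (x : Fin b → Cube d) (ℓ : Labels d) (v : List Bool) : Prop :=
  ¬ IsInternal k x ℓ v ∧ ∀ c w, v = c :: w → IsInternal k x ℓ w

/-- `u` and `u'` lie in the same leaf. -/
def SameLeaf {d b : ℕ} (k : ℕ) (x : Fin b → Cube d) (ℓ : Labels d) (u u' : Cube d) : Prop :=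
  ∃ v, IsLeaf k x ℓ v ∧ u ∈ cell ℓ v ∧ u' ∈ cell ℓ v

/-! ### Honest tree-growing procedures -/

/-- A randomized tree-growing procedure.  It sees the covariates and the responses of the `a`
observations of the splitting sample, only the covariates of the `b` observations of the
estimation sample (honesty), and an auxiliary uniform variable. -/
structure TreeRule (d p a b : ℕ) where
  grow : (Fin a → Cube d × (Fin p → ℝ)) → (Fin b → Cube d) → unitInterval → Labels d
  measurable_grow : Measurable
    fun t : (Fin a → Cube d × (Fin p → ℝ)) × (Fin b → Cube d) × unitInterval =>
      grow t.1 t.2.1 t.2.2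

/-- No two of the covariate vectors in the subsample share a coordinate
(this has probability one under the uniform distribution). -/
def GenPos {d p a b : ℕ} (z : Fin a → Cube d × (Fin p → ℝ)) (x : Fin b → Cube d) : Prop :=
  ∀ j : Fin d, Function.Injective fun i : Fin a ⊕ Fin b =>
    Sum.elim (fun i₁ => (z i₁).1 j) (fun i₂ => x i₂ j) i

/-- Symmetric, `ω`-regular, random-split trees, with between `k` and `2k - 1` points of the
estimation sample in each leaf. -/
structure TreeRule.IsRegular {d p a b : ℕ} (R : TreeRule d p a b) (k : ℕ) (ω π : ℝ) : Prop where
  /-- The distribution of the tree does not depend on the order of the observations. -/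
  symmetric : ∀ z x, GenPos z x → ∀ (σ : Equiv.Perm (Fin a)) (τ : Equiv.Perm (Fin b)),
    Measure.map (R.grow (z ∘ σ) (x ∘ τ)) volume = Measure.map (R.grow z x) volume
  /-- Every split leaves at least a fraction `ω` of the observations on either side. -/
  regular : ∀ z x, GenPos z x → ∀ ξ v, IsInternal k x (R.grow z x ξ) v → ∀ c : Bool,
    ω * (nodeCount x (R.grow z x ξ) v : ℝ) ≤ (nodeCount x (R.grow z x ξ) (c :: v) : ℝ)
  /-- Every split leaves at least `k` observations on either side. -/
  min_leaf : ∀ z x, GenPos z x → ∀ ξ v, IsInternal k x (R.grow z x ξ) v → ∀ c : Bool,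
    k ≤ nodeCount x (R.grow z x ξ) (c :: v)
  /-- At every split, given the observations and the splits made at the ancestors of the node,
  each feature is selected with probability at least `π / d`. -/
  random_split : ∀ z x, GenPos z x → ∀ (v : List Bool) (j : Fin d) (A : Set (Labels d)),
    MeasurableSet A →
    (∀ ℓ ℓ' : Labels d, (∀ w, w <:+ v → w ≠ v → ℓ w = ℓ' w) → (ℓ ∈ A ↔ ℓ' ∈ A)) →
    ENNReal.ofReal (π / d) *
        volume {ξ | R.grow z x ξ ∈ A ∧ IsInternal k x (R.grow z x ξ) v} ≤
      volume {ξ | R.grow z x ξ ∈ A ∧ IsInternal k x (R.grow z x ξ) v ∧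
        (R.grow z x ξ v).1 = j}

/-! ### Forests of trees grown on random subsamples -/

/-- The randomness of one tree, apart from the data: the labels of the observations in the
splitting sample (left summand) and in the estimation sample (right summand),
and the auxiliary variable. -/
abbrev TreeSeed (n a b : ℕ) : Type := (Fin a ⊕ Fin b → Fin n) × unitInterval

/-- A subsample of size `a + b` is drawn without replacement and divided at random into samples
of sizes `a` and `b`; the auxiliary variable is independent of it and uniform. -/
def treeSeedLaw (n a b : ℕ) : Measure (TreeSeed n a b) :=
  (uniformOn {f : Fin a ⊕ Fin b → Fin n | Function.Injective f}).prod volume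

/-- Seeds of `B` independent trees. -/
def forestSeedLaw (B n a b : ℕ) : Measure (Fin B → TreeSeed n a b) :=
  Measure.pi fun _ => treeSeedLaw n a b

abbrev Sample (d p n : ℕ) : Type := Fin n → Cube d × (Fin p → ℝ)

open Classical in
/-- The observations of the estimation sample that fall into the same leaf as `u`. -/
def neighbors {d p n a b : ℕ} (R : TreeRule d p a b) (k : ℕ) (D : Sample d p n)
    (t : TreeSeed n a b) (u : Cube d) : Finset (Fin n) :=
  Finset.univ.filter fun i => (∃ i' : Fin b, t.1 (Sum.inr i') = i) ∧
    SameLeaf k (fun i' => (D (t.1 (Sum.inr i'))).1)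
      (R.grow (fun i' => D (t.1 (Sum.inl i'))) (fun i' => (D (t.1 (Sum.inr i'))).1) t.2)
      (D i).1 u

open Classical in
/-- The weights of one tree at the point `u`. -/
def treeWeight {d p n a b : ℕ} (R : TreeRule d p a b) (k : ℕ) (D : Sample d p n)
    (t : TreeSeed n a b) (u : Cube d) (i : Fin n) : ℝ :=
  if i ∈ neighbors R k D t u then 1 / ((neighbors R k D t u).card : ℝ) else 0

/-- The weights of the forest at the point `u`. -/
def forestWeight {d p n a b B : ℕ} (R : TreeRule d p a b) (k : ℕ) (D : Sample d p n)
    (t : Fin B → TreeSeed n a b) (u : Cube d) (i : Fin n) : ℝ :=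
  (1 / (B : ℝ)) * ∑ c : Fin B, treeWeight R k D (t c) u i

/-! ### The estimator -/

/-- `Σ̂(u) = ∑ βᵢ(u) Yᵢ Yᵢᵀ - (∑ αᵢ(u) Yᵢ) (∑ αᵢ(u) Yᵢ)ᵀ`, with `β` from the first forest and
`α` from the second one. -/
def covEstimator {d p n a b B : ℕ} (Rβ Rα : TreeRule d p a b) (k : ℕ) (D : Sample d p n)
    (tβ tα : Fin B → TreeSeed n a b) (u : Cube d) : Matrix (Fin p) (Fin p) ℝ :=
  Matrix.of fun j r =>
    (∑ i, forestWeight Rβ k D tβ u i * ((D i).2 j * (D i).2 r)) -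
      (∑ i, forestWeight Rα k D tα u i * (D i).2 j) *
        (∑ i, forestWeight Rα k D tα u i * (D i).2 r)

/-- Generalized shrinkage operators `s_lam(z)`. -/
structure IsShrinkage (S : ℝ → ℝ → ℝ) : Prop where
  abs_le : ∀ lam, 0 < lam → ∀ z, |S lam z| ≤ |z|
  eq_zero : ∀ lam, 0 < lam → ∀ z, |z| ≤ lam → S lam z = 0
  abs_sub_le : ∀ lam, 0 < lam → ∀ z, |S lam z - z| ≤ lam

/-- Shrinkage of the off-diagonal entries. -/
def shrinkMatrix {p : ℕ} (S : ℝ → ℝ → ℝ) (lam : ℝ) (A : Matrix (Fin p) (Fin p) ℝ) :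
    Matrix (Fin p) (Fin p) ℝ :=
  Matrix.of fun j r => if j = r then A j r else S lam (A j r)

/-- The spectral norm. -/
def specNorm {p : ℕ} (A : Matrix (Fin p) (Fin p) ℝ) : ℝ :=
  ‖Matrix.toEuclideanCLM (n := Fin p) (𝕜 := ℝ) A‖

/-- The square of the Frobenius norm. -/
def frobSq {p : ℕ} (A : Matrix (Fin p) (Fin p) ℝ) : ℝ := ∑ j, ∑ r, A j r ^ 2

/-- `r_n = √(s (log n + log p) / n) + s ^ (-(1/2) (log (1-ω) / log ω) (π / d))`. -/
def rate (d : ℕ) (ω π : ℝ) (n p s : ℕ) : ℝ :=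
  Real.sqrt ((s : ℝ) * (Real.log n + Real.log p) / n) +
    (s : ℝ) ^ (-(1 / 2 : ℝ) * (Real.log (1 - ω) / Real.log ω) * (π / d))

/-! ### The law of the observations

`κ u` is the conditional distribution of the response given that the covariate equals `u`. -/

/-- `E (Y_j | U = u)` -/
def condMean {d p : ℕ} (κ : Kernel (Cube d) (Fin p → ℝ)) (u : Cube d) (j : Fin p) : ℝ :=
  ∫ y, y j ∂(κ u)

/-- `E (Y_j Y_r | U = u)` -/
def condMoment {d p : ℕ} (κ : Kernel (Cube d) (Fin p → ℝ)) (u : Cube d) (j r : Fin p) : ℝ :=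
  ∫ y, y j * y r ∂(κ u)

/-- `Σ(u)` -/
def condCov {d p : ℕ} (κ : Kernel (Cube d) (Fin p → ℝ)) (u : Cube d) :
    Matrix (Fin p) (Fin p) ℝ :=
  Matrix.of fun j r => condMoment κ u j r - condMean κ u j * condMean κ u r

/-- Bernstein's condition for the statistic `f`; the case `l = 2` bounds its variance by `σB²`. -/
def Bernstein {E : Type*} [MeasurableSpace E] (σB m : ℝ) (μ : Measure E) (f : E → ℝ) : Prop :=
  Integrable f μ ∧ ∀ l : ℕ, 2 ≤ l →
    Integrable (fun y => (f y - ∫ y', f y' ∂μ) ^ l) μ ∧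
    |∫ y, (f y - ∫ y', f y' ∂μ) ^ l ∂μ| ≤ 1 / 2 * (l ! : ℝ) * σB ^ 2 * m ^ (l - 2)

/-- Lipschitz conditional moments and Bernstein's condition, uniformly over the covariate. -/
structure RegularLaw {d p : ℕ} (κ : Kernel (Cube d) (Fin p → ℝ)) (CL σB m : ℝ) : Prop where
  lipschitz_moment : ∀ u₁ u₂ j r,
    |condMoment κ u₁ j r - condMoment κ u₂ j r| ≤ CL * dist u₁ u₂
  lipschitz_mean : ∀ u₁ u₂ j, |condMean κ u₁ j - condMean κ u₂ j| ≤ CL * dist u₁ u₂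
  bernstein_moment : ∀ u j r, Bernstein σB m (κ u) fun y => y j * y r
  bernstein_mean : ∀ u j, Bernstein σB m (κ u) fun y => y j

/-- The class of uniformly sparse, uniformly positive definite dynamic covariance matrices;
the summand is `|σ|^q`, read as the indicator of `σ ≠ 0` if `q = 0`. -/
structure SparsePDClass {d p : ℕ} (Sig : Cube d → Matrix (Fin p) (Fin p) ℝ)
    (q c M₁ ε : ℝ) : Prop where
  diag_lt : ∀ j, ∃ M' < M₁, ∀ u, Sig u j j ≤ M'
  sparse : ∀ u j, ∑ r, (if Sig u j r = 0 then 0 else |Sig u j r| ^ q) ≤ c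
  eigenvalues_ge : ∀ u, ∃ h : (Sig u).IsHermitian, ∀ i, ε ≤ h.eigenvalues i

/-- The joint law of `n` independent observations (with uniform covariates) and of the seeds of
the two forests, which are independent of the data and have joint law `ρ`. -/
def jointLaw {d p a b : ℕ} (n B : ℕ) (κ : Kernel (Cube d) (Fin p → ℝ))
    (ρ : Measure ((Fin B → TreeSeed n a b) × (Fin B → TreeSeed n a b))) :
    Measure (Sample d p n × (Fin B → TreeSeed n a b) × (Fin B → TreeSeed n a b)) :=
  (Measure.pi fun _ : Fin n => Measure.compProd (volume : Measure (Cube d)) κ).prod ρ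

/-- The seeds of each of the two forests are those of independent trees. -/
structure SeedsLaw {n a b B : ℕ}
    (ρ : Measure ((Fin B → TreeSeed n a b) × (Fin B → TreeSeed n a b))) : Prop where
  isProb : IsProbabilityMeasure ρ
  fst_law : ρ.map Prod.fst = forestSeedLaw B n a b
  snd_law : ρ.map Prod.snd = forestSeedLaw B n a b

/-- The individual trees have integrable uniform norms
(`‖·‖ₑ` is the maximum norm of matrices and vectors as functions of their indices). -/
structure IntegrableTrees {d p n a b B : ℕ} (Rβ Rα : TreeRule d p a b) (k : ℕ)
    (P : Measure (Sample d p n × (Fin B → TreeSeed n a b) × (Fin B → TreeSeed n a b))) :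
    Prop where
  moment : ∀ c : Fin B, ∫⁻ x, ⨆ u : Cube d,
    ‖∑ i, treeWeight Rβ k x.1 (x.2.1 c) u i •
      (fun jr : Fin p × Fin p => (x.1 i).2 jr.1 * (x.1 i).2 jr.2)‖ₑ ∂P < ∞
  mean : ∀ c : Fin B, ∫⁻ x, ⨆ u : Cube d,
    ‖∑ i, treeWeight Rα k x.1 (x.2.2 c) u i • (x.1 i).2‖ₑ ∂P < ∞

/-- The data of a statistical experiment of size `n` that satisfies the model assumptions. -/
structure Admissible {d p n a b B : ℕ} (Rβ Rα : TreeRule d p a b) (k : ℕ)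
    (κ : Kernel (Cube d) (Fin p → ℝ))
    (ρ : Measure ((Fin B → TreeSeed n a b) × (Fin B → TreeSeed n a b)))
    (CL σB m q c M₁ ε : ℝ) : Prop where
  markov : IsMarkovKernel κ
  regular : RegularLaw κ CL σB m
  sparse : SparsePDClass (condCov κ) q c M₁ ε
  seeds : SeedsLaw ρ
  integrable : IntegrableTrees Rβ Rα k (jointLaw n B κ ρ)

/-- The thresholded estimator with threshold `M(u) r`. -/
def threshEstimator {d p n a b B : ℕ} (S : ℝ → ℝ → ℝ) (M : Cube d → ℝ) (r : ℝ)
    (Rβ Rα : TreeRule d p a b) (k : ℕ)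
    (x : Sample d p n × (Fin B → TreeSeed n a b) × (Fin B → TreeSeed n a b)) (u : Cube d) :
    Matrix (Fin p) (Fin p) ℝ :=
  shrinkMatrix S (M u * r) (covEstimator Rβ Rα k x.1 x.2.1 x.2.2 u)

end

end ForestCov

namespace ForestCov

noncomputable section

/-! ### Geometry of the trees -/

section Geometry

variable {d b k : ℕ}

/-! The error of a forest average at `u` is noise (the weighted deviations of the responses from
their conditional means) plus bias (the weighted variation of a Lipschitz conditional mean over the
leaves). Both are bounded by a constant times the rate, uniformly in `u`; the rest is matrix
analysis.

Noise. Take about n/s trees on pairwise disjoint subsamples. By honesty the responses in their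
estimation samples do not influence the weights, and the squared weights of the average over these N
trees add up to at most 1/N, so Bernstein's condition yields a Gaussian-type exponential moment
(`lintegral_exp_weighted_le`, `lintegral_sum_exp_blockNoise_le`). As `u` varies these weights take
only polynomially many values, since they change only across thresholds of internal nodes. A large
forest is nearly a convex combination of such block averages, as in Hoeffding's treatment of
U-statistics (`Balanced.exists_mixture`), and Jensen's inequality passes the exponential moment on
to it (`exp_le_noiseGauge`). How many trees are needed depends on the number of possible subsamples,
not on the law of the data.

Bias. Let b be the size of the estimation half. Down to a depth H of about (4/5) log b / log(1/ω)
every node keeps b^(1/5) points. Up to a stretched exponential probability, counts in these nodes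
are comparable to volumes, and each cut shortens its side by a factor at most 1 - 4ω/5
(`GoodDesign.side_path_le`). Random splitting bounds the mean of this factor, raised to the number
of cuts along a feature, by (1 - (4/5)ωπ/d)^H (`TreeRule.IsRegular.integral_path_pow_le`), which has
the order of the second term of the rate because ω ≤ 1/5 (`biasExponent_le`). Averages over the
trees concentrate, and n^d grid points suffice for all `u` (`avg_nodeDiam_le`).

Matrices. If each estimated entry is within half a threshold of its target, the thresholded error of
an entry σ is of order λ^(1-q)|σ|^q. Row sparsity and Schur's test bound the spectral norm of the
error, and the lower eigenvalue bound transfers this to the inverses (`shrinkMatrix_bounds`,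
`Coercive.inv_bounds`). Two facts have to be derived: the conditional means are bounded
(`Bernstein.sq_mean_le`), and the rate is eventually small because the sparsity bound is at least
ε^q (`lt_of_mul_rpow_lt`). -/

theorem cell_cons_subset (ℓ : Labels d) (c : Bool) (v : List Bool) :
    cell ℓ (c :: v) ⊆ cell ℓ v := fun _ h => h.1

theorem cell_antitone (ℓ : Labels d) {v w : List Bool} (h : v <:+ w) : cell ℓ w ⊆ cell ℓ v := by
  induction w with
  | nil => rw [List.suffix_nil.1 h]
  | cons c w ih =>
    rcases List.suffix_cons_iff.1 h with rfl | h
    · exact subset_rfl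
    · exact (cell_cons_subset ℓ c w).trans (ih h)

theorem nodeCount_mono_of_subset {x : Fin b → Cube d} {ℓ ℓ' : Labels d} {v w : List Bool}
    (h : cell ℓ v ⊆ cell ℓ' w) : nodeCount x ℓ v ≤ nodeCount x ℓ' w := by
  classical
  unfold nodeCount
  apply Finset.card_le_card
  intro i hi
  simp only [Finset.mem_filter, Finset.mem_univ, true_and] at hi ⊢
  exact h hi

theorem nodeCount_children (x : Fin b → Cube d) (ℓ : Labels d) (v : List Bool) :
    nodeCount x ℓ (true :: v) + nodeCount x ℓ (false :: v) = nodeCount x ℓ v := by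
  classical
  unfold nodeCount
  rw [← Finset.card_union_of_disjoint]
  · congr 1
    ext i
    simp only [cell, Finset.mem_union, Finset.mem_filter, Finset.mem_univ, true_and,
      Set.mem_ofPred_eq]
    rcases le_or_gt ((x i (ℓ v).1 : unitInterval) : ℝ) (ℓ v).2 with h | h
    · simp [h]
    · simp [h]
  · rw [Finset.disjoint_left]
    intro i
    simp only [cell, Finset.mem_filter, Finset.mem_univ, true_and, Set.mem_ofPred_eq]
    by_cases h : ((x i (ℓ v).1 : unitInterval) : ℝ) ≤ (ℓ v).2 <;> simp [h]

theorem nodeCount_nil (x : Fin b → Cube d) (ℓ : Labels d) : nodeCount x ℓ [] = b := by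
  classical
  simp [nodeCount, cell]

theorem IsInternal.of_suffix {x : Fin b → Cube d} {ℓ : Labels d} {v w : List Bool}
    (h : v <:+ w) (hw : IsInternal k x ℓ w) : IsInternal k x ℓ v :=
  le_trans hw (nodeCount_mono_of_subset (cell_antitone ℓ h))

/-- The node of depth `h` that contains `u`. -/
def path (ℓ : Labels d) (u : Cube d) : ℕ → List Bool
  | 0 => []
  | h + 1 => decide (((u (ℓ (path ℓ u h)).1 : unitInterval) : ℝ) ≤ (ℓ (path ℓ u h)).2) ::
      path ℓ u h

@[simp] theorem length_path (ℓ : Labels d) (u : Cube d) (h : ℕ) : (path ℓ u h).length = h := by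
  induction h with
  | zero => rfl
  | succ h ih => simp [path, ih]

/-- The cells of a given depth partition the cube, and `path` picks the one containing `u`.
Membership becomes an equation between words, which gives disjointness at once. -/
theorem mem_cell_iff (ℓ : Labels d) (u : Cube d) (v : List Bool) :
    u ∈ cell ℓ v ↔ path ℓ u v.length = v := by
  induction v with
  | nil => simp [cell, path]
  | cons c v ih =>
    simp only [cell, Set.mem_ofPred_eq, List.length_cons, path, List.cons.injEq]
    rw [ih]
    constructor
    · rintro ⟨h1, h2⟩
      refine ⟨?_, h1⟩
      rw [h1]
      cases c <;> simp_all
    · rintro ⟨h1, h2⟩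
      refine ⟨h2, ?_⟩
      rw [h2] at h1
      rw [← h1]
      simp

theorem mem_cell_path (ℓ : Labels d) (u : Cube d) (h : ℕ) : u ∈ cell ℓ (path ℓ u h) := by
  rw [mem_cell_iff, length_path]

theorem path_suffix (ℓ : Labels d) (u : Cube d) {h h' : ℕ} (hh : h ≤ h') :
    path ℓ u h <:+ path ℓ u h' := by
  induction h', hh using Nat.le_induction with
  | base => exact List.suffix_rfl
  | succ n _ ih => exact ih.trans (List.suffix_cons _ _)

theorem sameLeaf_iff {x : Fin b → Cube d} {ℓ : Labels d} {u u' : Cube d} :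
    SameLeaf k x ℓ u u' ↔ ∃ h, IsLeaf k x ℓ (path ℓ u' h) ∧ u ∈ cell ℓ (path ℓ u' h) := by
  constructor
  · rintro ⟨v, hv, hu, hu'⟩
    rw [mem_cell_iff] at hu'
    exact ⟨v.length, by rwa [hu'], by rwa [hu']⟩
  · rintro ⟨h, h1, h2⟩
    exact ⟨_, h1, h2, mem_cell_path ℓ u' h⟩

/-- Points that are on the same side of every cut made at an internal node have the same leaf. -/
theorem sameLeaf_congr_of_sides {x : Fin b → Cube d} {ℓ : Labels d} {u u' : Cube d}
    (h : ∀ v, IsInternal k x ℓ v → ((((u (ℓ v).1 : unitInterval) : ℝ) ≤ (ℓ v).2) ↔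
      (((u' (ℓ v).1 : unitInterval) : ℝ) ≤ (ℓ v).2))) (y : Cube d) :
    SameLeaf k x ℓ y u ↔ SameLeaf k x ℓ y u' := by
  -- Only nodes whose proper ancestors are all internal matter, so every cut met on the way is
  -- covered by the hypothesis.
  have key : ∀ v, (∀ c w, v = c :: w → IsInternal k x ℓ w) → (u ∈ cell ℓ v ↔ u' ∈ cell ℓ v) := by
    intro v
    induction v with
    | nil => simp [cell]
    | cons c v ih =>
      intro hv
      have hi := hv c v rfl
      have := ih (fun c' w hw => hi.of_suffix (hw ▸ List.suffix_cons _ _))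
      simp only [cell, Set.mem_ofPred_eq, this, h v hi]
  constructor
  · rintro ⟨v, hv, h1, h2⟩
    exact ⟨v, hv, h1, (key v hv.2).1 h2⟩
  · rintro ⟨v, hv, h1, h2⟩
    exact ⟨v, hv, h1, (key v hv.2).2 h2⟩

/-- The properties of a tree at a given sample in general position. -/
structure GoodTree (k : ℕ) (ω : ℝ) (x : Fin b → Cube d) (ℓ : Labels d) : Prop where
  regular : ∀ v, IsInternal k x ℓ v → ∀ c : Bool,
    ω * (nodeCount x ℓ v : ℝ) ≤ (nodeCount x ℓ (c :: v) : ℝ)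
  min_leaf : ∀ v, IsInternal k x ℓ v → ∀ c : Bool, k ≤ nodeCount x ℓ (c :: v)

/-- Each split leaves at least `k ≥ 1` points in the sibling, so every step down costs one of the
`b` points. Hence internal nodes have depth less than `b`. -/
theorem GoodTree.length_add_nodeCount_le {ω : ℝ} {x : Fin b → Cube d} {ℓ : Labels d}
    (hT : GoodTree k ω x ℓ) (hk : 1 ≤ k) :
    ∀ v, (∀ c w, v = c :: w → IsInternal k x ℓ w) → v.length + nodeCount x ℓ v ≤ b := by
  intro v
  induction v with
  | nil => simp [nodeCount_nil]
  | cons c v ih =>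
    intro hv
    have hi := hv c v rfl
    have h1 := ih (fun c' w hw => hi.of_suffix (hw ▸ List.suffix_cons _ _))
    have h2 := nodeCount_children x ℓ v
    have h3 := hT.min_leaf v hi true
    have h4 := hT.min_leaf v hi false
    simp only [List.length_cons]
    cases c <;> omega

theorem GoodTree.length_lt {ω : ℝ} {x : Fin b → Cube d} {ℓ : Labels d}
    (hT : GoodTree k ω x ℓ) (hk : 1 ≤ k) {v : List Bool} (hv : IsInternal k x ℓ v) :
    v.length < b := by
  have := hT.length_add_nodeCount_le hk v
    (fun c w h => hv.of_suffix (h ▸ List.suffix_cons _ _))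
  unfold IsInternal at hv
  omega

/-- The depth bound makes the path of `u` leave the internal nodes; the first node to do so is a
leaf. It holds `k` points because its parent was split, or, if it is the root, because `k ≤ b`. -/
theorem GoodTree.exists_leaf {ω : ℝ} {x : Fin b → Cube d} {ℓ : Labels d}
    (hT : GoodTree k ω x ℓ) (hk : 1 ≤ k) (hb : k ≤ b) (u : Cube d) :
    ∃ h, IsLeaf k x ℓ (path ℓ u h) ∧ k ≤ nodeCount x ℓ (path ℓ u h) := by
  classical
  have hex : ∃ h, ¬ IsInternal k x ℓ (path ℓ u h) :=
    ⟨b, fun hi => by simpa using hT.length_lt hk hi⟩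
  refine ⟨Nat.find hex, ⟨Nat.find_spec hex, ?_⟩, ?_⟩
  · intro c w hw
    rcases hh : Nat.find hex with _ | h
    · rw [hh] at hw; simp [path] at hw
    · rw [hh] at hw
      simp only [path, List.cons.injEq] at hw
      rw [← hw.2]
      by_contra hcon
      exact Nat.find_min hex (by omega) hcon
  · rcases hh : Nat.find hex with _ | h
    · simpa [path, nodeCount_nil] using hb
    · have : IsInternal k x ℓ (path ℓ u h) := by
        by_contra hcon
        exact Nat.find_min hex (by omega) hcon
      exact hT.min_leaf _ this _

theorem exists_mem_cell_of_pos {x : Fin b → Cube d} {ℓ : Labels d} {v : List Bool}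
    (h : 0 < nodeCount x ℓ v) : ∃ i, x i ∈ cell ℓ v := by
  classical
  obtain ⟨i, hi⟩ := Finset.card_pos.1 h
  exact ⟨i, (Finset.mem_filter.1 hi).2⟩

/-- While ω^H b stays above 2k, nodes of smaller depth are internal, so regularity applies at each
of them and one step down loses at most a factor `ω` of the points. -/
theorem GoodTree.pow_mul_le {ω : ℝ} (hω : 0 ≤ ω) (hω1 : ω ≤ 1) {x : Fin b → Cube d}
    {ℓ : Labels d} (hT : GoodTree k ω x ℓ) {H : ℕ} (hH : 2 * (k : ℝ) ≤ ω ^ H * b) :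
    ∀ v : List Bool, v.length ≤ H → ω ^ v.length * b ≤ nodeCount x ℓ v := by
  intro v
  induction v with
  | nil => simp [nodeCount_nil]
  | cons c v ih =>
    intro hv
    simp only [List.length_cons] at hv ⊢
    have h1 := ih (by omega)
    have h2 : IsInternal k x ℓ v := by
      unfold IsInternal
      have : ω ^ H ≤ ω ^ v.length := pow_le_pow_of_le_one hω hω1 (by omega)
      have h3 : ω ^ H * b ≤ ω ^ v.length * b := by gcongr
      have : (2 * k : ℝ) ≤ nodeCount x ℓ v := by linarith
      exact_mod_cast this
    have h3 := hT.regular v h2 c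
    calc ω ^ (v.length + 1) * b = ω * (ω ^ v.length * b) := by ring
      _ ≤ ω * nodeCount x ℓ v := by gcongr
      _ ≤ _ := h3

/-! The number of internal nodes -/

theorem cell_disjoint_of_length_eq {ℓ : Labels d} {v w : List Bool} (h : v.length = w.length)
    {u : Cube d} (hv : u ∈ cell ℓ v) (hw : u ∈ cell ℓ w) : v = w := by
  rw [mem_cell_iff] at hv hw
  rw [← hv, ← hw, h]

/-- Internal nodes of equal depth have disjoint nonempty cells, so choosing a point in each is
injective. The trivial count 2^h would ruin the union bound over representatives. -/
theorem card_internal_le (hk : 1 ≤ k) (x : Fin b → Cube d) (ℓ : Labels d) (h : ℕ) :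
    Set.ncard {v : Fin h → Bool | IsInternal k x ℓ (List.ofFn v)} ≤ b := by
  classical
  have hex : ∀ v : Fin h → Bool, IsInternal k x ℓ (List.ofFn v) →
      ∃ i, x i ∈ cell ℓ (List.ofFn v) := by
    intro v hv
    apply exists_mem_cell_of_pos
    unfold IsInternal at hv
    omega
  by_cases hb : Nonempty (Fin b)
  · have hb' := hb
    choose! f hf using hex
    have := Set.ncard_le_ncard_of_injOn (s := {v : Fin h → Bool | IsInternal k x ℓ (List.ofFn v)})
      (t := (Set.univ : Set (Fin b))) f (fun _ _ => Set.mem_univ _) (by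
      intro v hv w hw hvw
      have h1 := hf v hv
      have h2 := hf w hw
      rw [← hvw] at h2
      exact List.ofFn_injective (cell_disjoint_of_length_eq (by simp) h1 h2))
    simpa [Set.ncard_univ] using this
  · have : {v : Fin h → Bool | IsInternal k x ℓ (List.ofFn v)} = ∅ := by
      ext v
      simp only [Set.mem_ofPred_eq, Set.mem_empty_iff_false, iff_false]
      intro hv
      exact hb ⟨(hex v hv).choose⟩
    simp [this]

end Geometry

/-! ### Elementary properties of the weights -/

section Weights

variable {d p n a b k : ℕ}

/-- The covariates of the estimation sample. -/
def treeCov (D : Sample d p n) (f : Fin a ⊕ Fin b → Fin n) : Fin b → Cube d :=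
  fun i => (D (f (Sum.inr i))).1

/-- The tree grown with given seed. -/
def treeLabels (R : TreeRule d p a b) (D : Sample d p n) (t : TreeSeed n a b) : Labels d :=
  R.grow (fun i => D (t.1 (Sum.inl i))) (treeCov D t.1) t.2

theorem mem_neighbors {R : TreeRule d p a b} {D : Sample d p n} {t : TreeSeed n a b}
    {u : Cube d} {i : Fin n} : i ∈ neighbors R k D t u ↔ (∃ i', t.1 (Sum.inr i') = i) ∧
      SameLeaf k (treeCov D t.1) (treeLabels R D t) (D i).1 u := by
  classical
  simp only [neighbors, Finset.mem_filter, Finset.mem_univ, true_and]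
  rfl

theorem treeWeight_nonneg (R : TreeRule d p a b) (D : Sample d p n) (t : TreeSeed n a b)
    (u : Cube d) (i : Fin n) : 0 ≤ treeWeight R k D t u i := by
  unfold treeWeight; split_ifs <;> positivity

theorem treeWeight_le_one (R : TreeRule d p a b) (D : Sample d p n) (t : TreeSeed n a b)
    (u : Cube d) (i : Fin n) : treeWeight R k D t u i ≤ 1 := by
  unfold treeWeight
  split_ifs with h
  · have : (1 : ℝ) ≤ (neighbors R k D t u).card := by
      exact_mod_cast Finset.card_pos.2 ⟨i, h⟩
    rw [div_le_one (by linarith)]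
    exact this
  · exact zero_le_one

theorem sum_treeWeight_eq (R : TreeRule d p a b) (D : Sample d p n) (t : TreeSeed n a b)
    (u : Cube d) : ∑ i, treeWeight R k D t u i =
      if (neighbors R k D t u).Nonempty then 1 else 0 := by
  classical
  unfold treeWeight
  rw [← Finset.sum_filter]
  simp only [Finset.filter_mem_eq_inter, Finset.univ_inter, Finset.sum_const, nsmul_eq_mul]
  split_ifs with h
  · have : ((neighbors R k D t u).card : ℝ) ≠ 0 := by
      exact_mod_cast (Finset.card_pos.2 h).ne'
    field_simp
  · simp [Finset.not_nonempty_iff_eq_empty.1 h]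

theorem sum_treeWeight_le_one (R : TreeRule d p a b) (D : Sample d p n) (t : TreeSeed n a b)
    (u : Cube d) : ∑ i, treeWeight R k D t u i ≤ 1 := by
  rw [sum_treeWeight_eq]; split_ifs <;> norm_num

theorem treeWeight_eq_zero {R : TreeRule d p a b} {D : Sample d p n} {t : TreeSeed n a b}
    {u : Cube d} {i : Fin n} (h : ∀ i', t.1 (Sum.inr i') ≠ i) : treeWeight R k D t u i = 0 := by
  unfold treeWeight
  rw [if_neg]
  rw [mem_neighbors]
  rintro ⟨⟨i', hi'⟩, -⟩
  exact h i' hi'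

theorem treeLabels_congr (R : TreeRule d p a b) {D D' : Sample d p n} {t : TreeSeed n a b}
    (h1 : ∀ i, (D i).1 = (D' i).1) (h2 : ∀ i, D (t.1 (Sum.inl i)) = D' (t.1 (Sum.inl i))) :
    treeLabels R D t = treeLabels R D' t := by
  unfold treeLabels treeCov
  simp only [h1, h2]

theorem treeCov_congr {D D' : Sample d p n} (f : Fin a ⊕ Fin b → Fin n)
    (h1 : ∀ i, (D i).1 = (D' i).1) : treeCov D f = treeCov D' f := by
  unfold treeCov
  simp only [h1]

/-- Honesty: the weights do not depend on the responses in the estimation sample. -/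
theorem treeWeight_congr (R : TreeRule d p a b) {D D' : Sample d p n} {t : TreeSeed n a b}
    (h1 : ∀ i, (D i).1 = (D' i).1) (h2 : ∀ i, D (t.1 (Sum.inl i)) = D' (t.1 (Sum.inl i)))
    (u : Cube d) (i : Fin n) : treeWeight R k D t u i = treeWeight R k D' t u i := by
  have : neighbors R k D t u = neighbors R k D' t u := by
    ext i
    rw [mem_neighbors, mem_neighbors, treeLabels_congr R h1 h2, treeCov_congr t.1 h1, h1]
  unfold treeWeight
  rw [this]

/-- The weights see `u` only through its sides of the cuts at internal nodes. This reduces a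
supremum over the cube to finitely many representatives. -/
theorem treeWeight_congr_of_sides {R : TreeRule d p a b} {D : Sample d p n} {t : TreeSeed n a b}
    {u u' : Cube d}
    (h : ∀ v, IsInternal k (treeCov D t.1) (treeLabels R D t) v →
      ((((u (treeLabels R D t v).1 : unitInterval) : ℝ) ≤ (treeLabels R D t v).2) ↔
      (((u' (treeLabels R D t v).1 : unitInterval) : ℝ) ≤ (treeLabels R D t v).2)))
    (i : Fin n) : treeWeight R k D t u i = treeWeight R k D t u' i := by
  have : neighbors R k D t u = neighbors R k D t u' := by
    ext i
    rw [mem_neighbors, mem_neighbors, sameLeaf_congr_of_sides h]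
  unfold treeWeight
  rw [this]

/-- No two observations share a covariate coordinate. -/
def SampleGenPos (D : Sample d p n) : Prop :=
  ∀ j : Fin d, Function.Injective fun i => (D i).1 j

theorem SampleGenPos.genPos {D : Sample d p n} (hD : SampleGenPos D)
    {f : Fin a ⊕ Fin b → Fin n} (hf : Function.Injective f) :
    GenPos (fun i => D (f (Sum.inl i))) (treeCov D f) := by
  intro j
  have : (fun i : Fin a ⊕ Fin b => Sum.elim (fun i₁ => (D (f (Sum.inl i₁))).1 j)
      (fun i₂ => treeCov D f i₂ j) i) = (fun i => (D i).1 j) ∘ f := by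
    ext i; cases i <;> rfl
  rw [this]
  exact (hD j).comp hf

theorem TreeRule.IsRegular.goodTree {R : TreeRule d p a b} {ω π : ℝ} (hR : R.IsRegular k ω π)
    {D : Sample d p n} (hD : SampleGenPos D) {t : TreeSeed n a b}
    (hf : Function.Injective t.1) : GoodTree k ω (treeCov D t.1) (treeLabels R D t) where
  regular := hR.regular _ _ (hD.genPos hf) t.2
  min_leaf := hR.min_leaf _ _ (hD.genPos hf) t.2

theorem GoodTree.neighbors_nonempty {R : TreeRule d p a b} {ω : ℝ}
    {D : Sample d p n} {t : TreeSeed n a b}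
    (hT : GoodTree k ω (treeCov D t.1) (treeLabels R D t)) (hk : 1 ≤ k) (hb : k ≤ b)
    (u : Cube d) : (neighbors R k D t u).Nonempty := by
  obtain ⟨h, h1, h2⟩ := hT.exists_leaf hk hb u
  obtain ⟨i, hi⟩ := exists_mem_cell_of_pos (lt_of_lt_of_le (by omega) h2)
  exact ⟨t.1 (Sum.inr i), mem_neighbors.2 ⟨⟨i, rfl⟩, sameLeaf_iff.2 ⟨h, h1, hi⟩⟩⟩

/-- The neighbors of `u` lie in the node of depth `H` of `u`, if all nodes of smaller depth are
internal. -/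
theorem mem_cell_path_of_mem_neighbors {R : TreeRule d p a b}
    {D : Sample d p n} {t : TreeSeed n a b} {u : Cube d} {H : ℕ}
    (hH : ∀ h < H, IsInternal k (treeCov D t.1) (treeLabels R D t)
      (path (treeLabels R D t) u h)) {i : Fin n} (hi : i ∈ neighbors R k D t u) :
    (D i).1 ∈ cell (treeLabels R D t) (path (treeLabels R D t) u H) := by
  obtain ⟨-, hs⟩ := mem_neighbors.1 hi
  obtain ⟨h, h1, h2⟩ := sameLeaf_iff.1 hs
  have : H ≤ h := by
    by_contra hcon
    exact h1.1 (hH h (by omega))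
  exact cell_antitone _ (path_suffix _ u this) h2

end Weights

/-! ### Measurability -/

section Measurability

variable {Ω : Type*} [MeasurableSpace Ω] {d p n a b k : ℕ}

theorem measurableSet_le_cut {L : Ω → Labels d} (hL : Measurable L) {X : Ω → Cube d}
    (hX : Measurable X) (v : List Bool) :
    MeasurableSet {w | ((X w (L w v).1 : unitInterval) : ℝ) ≤ (L w v).2} := by
  have hLv : Measurable fun w => L w v := (measurable_pi_apply v).comp hL
  have : {w | ((X w (L w v).1 : unitInterval) : ℝ) ≤ (L w v).2} =
      ⋃ j : Fin d, {w | (L w v).1 = j} ∩ {w | ((X w j : unitInterval) : ℝ) ≤ (L w v).2} := by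
    ext w
    simp
  rw [this]
  refine MeasurableSet.iUnion fun j => MeasurableSet.inter ?_ ?_
  · exact (measurable_fst.comp hLv) (measurableSet_singleton j)
  · exact measurableSet_le (measurable_subtype_coe.comp ((measurable_pi_apply j).comp hX))
      (measurable_snd.comp hLv)

theorem measurableSet_mem_cell {L : Ω → Labels d} (hL : Measurable L) {X : Ω → Cube d}
    (hX : Measurable X) (v : List Bool) : MeasurableSet {w | X w ∈ cell (L w) v} := by
  induction v with
  | nil => simp [cell]
  | cons c v ih =>
    have h := measurableSet_le_cut hL hX v
    cases c
    · have : {w | X w ∈ cell (L w) (false :: v)} = {w | X w ∈ cell (L w) v} ∩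
          {w | ((X w (L w v).1 : unitInterval) : ℝ) ≤ (L w v).2}ᶜ := by
        ext w; simp [cell]
      rw [this]
      exact ih.inter h.compl
    · have : {w | X w ∈ cell (L w) (true :: v)} = {w | X w ∈ cell (L w) v} ∩
          {w | ((X w (L w v).1 : unitInterval) : ℝ) ≤ (L w v).2} := by
        ext w; simp [cell]
      rw [this]
      exact ih.inter h

theorem measurable_nodeCount {L : Ω → Labels d} (hL : Measurable L) {x : Ω → Fin b → Cube d}
    (hx : Measurable x) (v : List Bool) : Measurable fun w => nodeCount (x w) (L w) v := by
  classical
  unfold nodeCount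
  simp only [Finset.card_filter]
  refine Finset.measurable_sum _ fun i _ => Measurable.ite ?_ measurable_const measurable_const
  exact measurableSet_mem_cell hL ((measurable_pi_apply i).comp hx) v

theorem measurableSet_isInternal {L : Ω → Labels d} (hL : Measurable L)
    {x : Ω → Fin b → Cube d} (hx : Measurable x) (v : List Bool) :
    MeasurableSet {w | IsInternal k (x w) (L w) v} :=
  measurableSet_le measurable_const (measurable_nodeCount hL hx v)

theorem measurableSet_isLeaf {L : Ω → Labels d} (hL : Measurable L)
    {x : Ω → Fin b → Cube d} (hx : Measurable x) (v : List Bool) :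
    MeasurableSet {w | IsLeaf k (x w) (L w) v} := by
  have h : MeasurableSet {w | ∀ c u, v = c :: u → IsInternal k (x w) (L w) u} := by
    cases v with
    | nil => simp
    | cons c v =>
      have : {w | ∀ c' u, c :: v = c' :: u → IsInternal k (x w) (L w) u} =
          {w | IsInternal k (x w) (L w) v} := by
        ext w; simp
      rw [this]
      exact measurableSet_isInternal hL hx v
  exact (measurableSet_isInternal hL hx v).compl.inter h

theorem measurableSet_sameLeaf {L : Ω → Labels d} (hL : Measurable L)
    {x : Ω → Fin b → Cube d} (hx : Measurable x) {X Y : Ω → Cube d} (hX : Measurable X)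
    (hY : Measurable Y) : MeasurableSet {w | SameLeaf k (x w) (L w) (X w) (Y w)} := by
  have : {w | SameLeaf k (x w) (L w) (X w) (Y w)} = ⋃ v, {w | IsLeaf k (x w) (L w) v} ∩
      ({w | X w ∈ cell (L w) v} ∩ {w | Y w ∈ cell (L w) v}) := by
    ext w; simp [SameLeaf]
  rw [this]
  exact MeasurableSet.iUnion fun v => (measurableSet_isLeaf hL hx v).inter
    ((measurableSet_mem_cell hL hX v).inter (measurableSet_mem_cell hL hY v))

/-- The selection of a coordinate by a random index. -/
theorem measurable_apply_index {E ι : Type*} [MeasurableSpace E] [Countable ι]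
    [MeasurableSpace ι] [MeasurableSingletonClass ι] {D : Ω → ι → E} (hD : Measurable D)
    {i : Ω → ι} (hi : Measurable i) : Measurable fun w => D w (i w) := by
  intro s hs
  have : (fun w => D w (i w)) ⁻¹' s = ⋃ j, {w | i w = j} ∩ {w | D w j ∈ s} := by
    ext w; simp
  rw [this]
  exact MeasurableSet.iUnion fun j => (hi (measurableSet_singleton j)).inter
    (((measurable_pi_apply j).comp hD) hs)

theorem measurable_treeCov {D : Ω → Sample d p n} (hD : Measurable D)
    {f : Ω → Fin a ⊕ Fin b → Fin n} (hf : Measurable f) :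
    Measurable fun w => treeCov (D w) (f w) := by
  unfold treeCov
  refine measurable_pi_iff.2 fun i => ?_
  have := measurable_apply_index hD ((measurable_pi_apply (Sum.inr i)).comp hf)
  exact measurable_fst.comp this

theorem measurable_treeLabels (R : TreeRule d p a b) {D : Ω → Sample d p n} (hD : Measurable D)
    {t : Ω → TreeSeed n a b} (ht : Measurable t) :
    Measurable fun w => treeLabels R (D w) (t w) := by
  unfold treeLabels
  refine R.measurable_grow.comp (Measurable.prodMk ?_ (Measurable.prodMk ?_ ?_))
  · refine measurable_pi_iff.2 fun i => ?_
    exact measurable_apply_index hD ((measurable_pi_apply _).comp (measurable_fst.comp ht))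
  · exact measurable_treeCov hD (measurable_fst.comp ht)
  · exact measurable_snd.comp ht

theorem measurableSet_mem_neighbors (R : TreeRule d p a b) {D : Ω → Sample d p n}
    (hD : Measurable D) {t : Ω → TreeSeed n a b} (ht : Measurable t) {u : Ω → Cube d}
    (hu : Measurable u) (i : Fin n) :
    MeasurableSet {w | i ∈ neighbors R k (D w) (t w) (u w)} := by
  simp only [mem_neighbors]
  have hf : Measurable fun w => (t w).1 := measurable_fst.comp ht
  refine MeasurableSet.inter (s₁ := {w | ∃ i', (t w).1 (Sum.inr i') = i}) ?_
    (measurableSet_sameLeaf (measurable_treeLabels R hD ht) (measurable_treeCov hD hf)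
      (measurable_fst.comp ((measurable_pi_apply i).comp hD)) hu)
  rw [Set.ofPred_exists]
  exact MeasurableSet.iUnion fun i' =>
    ((measurable_pi_apply (Sum.inr i')).comp hf) (measurableSet_singleton i)

theorem measurable_treeWeight (R : TreeRule d p a b) {D : Ω → Sample d p n}
    (hD : Measurable D) {t : Ω → TreeSeed n a b} (ht : Measurable t) {u : Ω → Cube d}
    (hu : Measurable u) (i : Fin n) :
    Measurable fun w => treeWeight R k (D w) (t w) (u w) i := by
  classical
  unfold treeWeight
  refine Measurable.ite (measurableSet_mem_neighbors R hD ht hu i) ?_ measurable_const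
  have : ∀ w, (neighbors R k (D w) (t w) (u w)).card =
      ∑ j, if j ∈ neighbors R k (D w) (t w) (u w) then 1 else 0 := by
    intro w; simp
  simp only [this]
  refine measurable_const.div (measurable_from_nat.comp ?_)
  exact Finset.measurable_sum _ fun j _ =>
    Measurable.ite (measurableSet_mem_neighbors R hD ht hu j) measurable_const measurable_const

end Measurability

/-! ### Exponential moments under Bernstein's condition -/

section BernsteinMGF

variable {E : Type*} [MeasurableSpace E] {σ m : ℝ} {μ : Measure E} {f : E → ℝ}

/-- In the exponential series the factorial cancels the growth of the moments, and the restriction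
on `t` leaves a geometric series of ratio 1/2. -/
theorem Bernstein.integral_pow_mul_le [IsProbabilityMeasure μ] (h : Bernstein σ m μ f) {t : ℝ}
    (ht : |t| * |m| ≤ 1 / 2) (l : ℕ) :
    |t ^ (l + 2) * ∫ y, (f y - ∫ y', f y' ∂μ) ^ (l + 2) ∂μ| / ((l + 2)! : ℝ) ≤
      1 / 2 * σ ^ 2 * t ^ 2 * (1 / 2) ^ l := by
  have h2 := (h.2 (l + 2) (by omega)).2
  have hf : (0 : ℝ) < ((l + 2)! : ℝ) := by positivity
  rw [div_le_iff₀ hf, abs_mul, abs_pow]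
  have h3 : 1 / 2 * ((l + 2)! : ℝ) * σ ^ 2 * m ^ l ≤ 1 / 2 * ((l + 2)! : ℝ) * σ ^ 2 * |m| ^ l := by
    rw [← abs_pow]
    gcongr
    exact le_abs_self _
  calc |t| ^ (l + 2) * |∫ y, (f y - ∫ y', f y' ∂μ) ^ (l + 2) ∂μ|
      ≤ |t| ^ (l + 2) * (1 / 2 * ((l + 2)! : ℝ) * σ ^ 2 * |m| ^ l) := by
        gcongr
        exact h2.trans h3
    _ = 1 / 2 * σ ^ 2 * |t| ^ 2 * (|t| * |m|) ^ l * ((l + 2)! : ℝ) := by ring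
    _ ≤ 1 / 2 * σ ^ 2 * |t| ^ 2 * (1 / 2) ^ l * ((l + 2)! : ℝ) := by gcongr
    _ = _ := by rw [sq_abs]

/-- Bernstein's condition controls signed moments, not absolute ones of odd order. The series of
cosh has only even powers, which are nonnegative, so it can be integrated termwise without further
information; cosh then serves as the dominating function for exp. -/
theorem Bernstein.integrable_cosh [IsProbabilityMeasure μ] (h : Bernstein σ m μ f) {t : ℝ}
    (ht : |t| * |m| ≤ 1 / 2) :
    Integrable (fun y => Real.cosh (t * (f y - ∫ y', f y' ∂μ))) μ := by
  set g : E → ℝ := fun y => f y - ∫ y', f y' ∂μ with hg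
  have hgm : AEStronglyMeasurable g μ := (h.1.sub (integrable_const _)).1
  have hpow : ∀ n : ℕ, Integrable (fun y => (t * g y) ^ (2 * n) / ((2 * n)! : ℝ)) μ := by
    intro n
    rcases n with _ | n
    · simp
    · have := (h.2 (2 * (n + 1)) (by omega)).1
      simp only [mul_pow]
      exact (this.const_mul _).div_const _
  have hnn : ∀ (n : ℕ) y, 0 ≤ (t * g y) ^ (2 * n) / ((2 * n)! : ℝ) := by
    intro n y
    rw [pow_mul]
    positivity
  -- The summand 1 covers n = 0; for larger n the factor 2 comes from 1/2 and the shift (1/4)^n = 4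
  -- (1/4)^(n+1).
  have hint : ∀ n : ℕ, ∫ y, (t * g y) ^ (2 * n) / ((2 * n)! : ℝ) ∂μ ≤
      (1 + 2 * σ ^ 2 * t ^ 2) * (1 / 4) ^ n := by
    intro n
    rcases n with _ | n
    · simp; positivity
    · have := h.integral_pow_mul_le ht (2 * n)
      rw [show 2 * n + 2 = 2 * (n + 1) by ring] at this
      have h1 : ∫ y, (t * g y) ^ (2 * (n + 1)) / ((2 * (n + 1))! : ℝ) ∂μ =
          t ^ (2 * (n + 1)) * (∫ y, (g y) ^ (2 * (n + 1)) ∂μ) / ((2 * (n + 1))! : ℝ) := by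
        simp only [mul_pow]
        rw [integral_div, integral_const_mul]
      rw [h1]
      refine (div_le_div_of_nonneg_right (le_abs_self _) (by positivity)).trans (this.trans ?_)
      have h4 : ((1 / 2 : ℝ)) ^ (2 * n) = (1 / 4) ^ n := by rw [pow_mul]; norm_num
      rw [h4, pow_succ (1 / 4 : ℝ) n]
      have : (0 : ℝ) < (1 / 4) ^ n := by positivity
      linarith
  refine ⟨(Real.continuous_cosh.comp_aestronglyMeasurable (hgm.const_mul t)), ?_⟩
  rw [hasFiniteIntegral_iff_ofReal (Eventually.of_forall fun y => (Real.cosh_pos _).le)]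
  have h1 : ∀ y, ENNReal.ofReal (Real.cosh (t * g y)) =
      ∑' n, ENNReal.ofReal ((t * g y) ^ (2 * n) / ((2 * n)! : ℝ)) := by
    intro y
    rw [Real.cosh_eq_tsum, ENNReal.ofReal_tsum_of_nonneg (fun n => hnn n y)
      (Real.hasSum_cosh _).summable]
  rw [lintegral_congr h1, lintegral_tsum (fun n => (hpow n).1.aemeasurable.ennreal_ofReal)]
  have h2 : ∀ n, ∫⁻ y, ENNReal.ofReal ((t * g y) ^ (2 * n) / ((2 * n)! : ℝ)) ∂μ ≤
      ENNReal.ofReal ((1 + 2 * σ ^ 2 * t ^ 2) * (1 / 4) ^ n) := by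
    intro n
    rw [← ofReal_integral_eq_lintegral_ofReal (hpow n) (Eventually.of_forall (hnn n))]
    exact ENNReal.ofReal_le_ofReal (hint n)
  refine (ENNReal.tsum_le_tsum h2).trans_lt ?_
  have hs : Summable fun n : ℕ => (1 + 2 * σ ^ 2 * t ^ 2) * (1 / 4 : ℝ) ^ n :=
    (summable_geometric_of_lt_one (by norm_num) (by norm_num)).mul_left _
  rw [← ENNReal.ofReal_tsum_of_nonneg (fun n => by positivity) hs]
  exact ENNReal.ofReal_lt_top

/-- Twice cosh dominates all partial sums of the exponential series, so it may be integrated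
termwise: the constant term gives 1, the linear one vanishes by centring, and the others sum to at
most σ²t². Then 1 + x ≤ e^x. -/
theorem Bernstein.lintegral_exp_le [IsProbabilityMeasure μ] (h : Bernstein σ m μ f) {t : ℝ}
    (ht : |t| * |m| ≤ 1 / 2) :
    ∫⁻ y, ENNReal.ofReal (Real.exp (t * (f y - ∫ y', f y' ∂μ))) ∂μ ≤
      ENNReal.ofReal (Real.exp (σ ^ 2 * t ^ 2)) := by
  have hcosh := h.integrable_cosh ht
  set g : E → ℝ := fun y => f y - ∫ y', f y' ∂μ with hg
  have hgi : Integrable g μ := h.1.sub (integrable_const _)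
  have hgm : AEStronglyMeasurable g μ := hgi.1
  have hexp_le : ∀ z : ℝ, Real.exp |z| ≤ 2 * Real.cosh z := by
    intro z
    rw [Real.cosh_eq]
    rcases abs_cases z with ⟨h, _⟩ | ⟨h, _⟩ <;> rw [h] <;>
      linarith [Real.exp_pos z, Real.exp_pos (-z)]
  have hbd : Integrable (fun y => 2 * Real.cosh (t * g y)) μ := hcosh.const_mul 2
  have hpi : ∀ l : ℕ, Integrable (fun y => (g y) ^ l) μ := by
    intro l
    rcases l with _ | _ | l
    · simp
    · simpa using hgi
    · exact (h.2 (l + 2) (by omega)).1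
  have hlim : Tendsto (fun N : ℕ => ∫ y, ∑ l ∈ Finset.range N, (t * g y) ^ l / (l ! : ℝ) ∂μ) atTop
      (𝓝 (∫ y, Real.exp (t * g y) ∂μ)) := by
    refine tendsto_integral_of_dominated_convergence _ (fun N => ?_) hbd (fun N => ?_) ?_
    · refine Finset.aestronglyMeasurable_fun_sum _ fun l _ => ?_
      have h0 : AEStronglyMeasurable (fun y => (t * g y) ^ l) μ := (hgm.const_mul t).pow l
      simpa only [div_eq_mul_inv] using h0.mul_const _
    · refine Eventually.of_forall fun y => ?_
      refine (norm_sum_le _ _).trans (le_trans ?_ (hexp_le _))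
      refine le_trans (le_of_eq ?_) (Real.sum_le_exp_of_nonneg (abs_nonneg (t * g y)) N)
      refine Finset.sum_congr rfl fun l _ => ?_
      rw [norm_div, norm_pow, Real.norm_eq_abs]
      simp
    · refine Eventually.of_forall fun y => ?_
      have := (NormedSpace.expSeries_div_hasSum_exp (t * g y)).tendsto_sum_nat
      rwa [← Real.exp_eq_exp_ℝ] at this
  have hle : ∫ y, Real.exp (t * g y) ∂μ ≤ Real.exp (σ ^ 2 * t ^ 2) := by
    have hg0 : ∫ y, g y ∂μ = 0 := by
      simp only [hg]
      rw [integral_sub h.1 (integrable_const _)]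
      simp
    refine le_trans ?_ (Real.add_one_le_exp _)
    refine le_of_tendsto hlim ((eventually_ge_atTop 2).mono fun N hN => ?_)
    obtain ⟨N, rfl⟩ := Nat.exists_eq_add_of_le hN
    have hterm : ∀ l, ∫ y, (t * g y) ^ l / (l ! : ℝ) ∂μ =
        t ^ l * (∫ y, (g y) ^ l ∂μ) / (l ! : ℝ) := by
      intro l
      simp only [mul_pow]
      rw [integral_div, integral_const_mul]
    rw [integral_finsetSum]
    · rw [Finset.sum_range_add]
      have h0 : ∑ l ∈ Finset.range 2, ∫ y, (t * g y) ^ l / (l ! : ℝ) ∂μ = 1 := by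
        rw [Finset.sum_range_succ, Finset.sum_range_succ, hterm 1]
        simp [hg0]
      rw [h0, add_comm]
      gcongr
      calc ∑ l ∈ Finset.range N, ∫ y, (t * g y) ^ (2 + l) / ((2 + l)! : ℝ) ∂μ
          ≤ ∑ l ∈ Finset.range N, 1 / 2 * σ ^ 2 * t ^ 2 * (1 / 2) ^ l := by
            refine Finset.sum_le_sum fun l _ => ?_
            rw [hterm, add_comm 2 l]
            exact (div_le_div_of_nonneg_right (le_abs_self _) (by positivity)).trans
              (h.integral_pow_mul_le ht l)
        _ = 1 / 2 * σ ^ 2 * t ^ 2 * ∑ l ∈ Finset.range N, (1 / 2 : ℝ) ^ l := by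
            rw [Finset.mul_sum]
        _ ≤ 1 / 2 * σ ^ 2 * t ^ 2 * 2 := by
            gcongr
            exact sum_geometric_two_le N
        _ = σ ^ 2 * t ^ 2 := by ring
    · intro l _
      simp only [mul_pow]
      exact ((hpi l).const_mul _).div_const _
  have hei : Integrable (fun y => Real.exp (t * g y)) μ := by
    refine hbd.mono' (Real.continuous_exp.comp_aestronglyMeasurable (hgm.const_mul t))
      (Eventually.of_forall fun y => ?_)
    rw [Real.norm_eq_abs, abs_of_pos (Real.exp_pos _)]
    exact (Real.exp_le_exp.2 (le_abs_self _)).trans (hexp_le _)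
  rw [← ofReal_integral_eq_lintegral_ofReal hei (Eventually.of_forall fun y => (Real.exp_pos _).le)]
  exact ENNReal.ofReal_le_ofReal hle

end BernsteinMGF

/-! ### Averaging out the responses given the covariates -/

section Resampling

variable {A E : Type*} [MeasurableSpace A] [MeasurableSpace E] {n : ℕ}

/-- Fubini and disintegration in a single coordinate: drawing the response of one observation
afresh, given its covariate, leaves the law of the sample unchanged. -/
theorem lintegral_pi_resample (ν : Measure A) [IsProbabilityMeasure ν] (κ : Kernel A E)
    [IsMarkovKernel κ] (i : Fin n) {F : (Fin n → A × E) → ℝ≥0∞} (hF : Measurable F) :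
    ∫⁻ D, F D ∂Measure.pi (fun _ : Fin n => ν ⊗ₘ κ) =
      ∫⁻ D, ∫⁻ y, F (Function.update D i ((D i).1, y)) ∂κ (D i).1
        ∂Measure.pi (fun _ : Fin n => ν ⊗ₘ κ) := by
  have hupd : Measurable fun q : (Fin n → A × E) × (A × E) => Function.update q.1 i q.2 := by
    refine measurable_pi_iff.2 fun j => ?_
    by_cases h : j = i
    · subst h; simpa using measurable_snd
    · simp only [ne_eq, h, not_false_eq_true, Function.update_of_ne]
      exact (measurable_pi_apply j).comp measurable_fst
  refine lintegral_eq_of_lmarginal_eq {i} hF ?_ ?_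
  · have hκ : (fun D : Fin n → A × E =>
        ∫⁻ y, F (Function.update D i ((D i).1, y)) ∂κ (D i).1) = fun D =>
        ∫⁻ y, F (Function.update D i ((D i).1, y)) ∂(κ.comap (fun D : Fin n → A × E => (D i).1)
          (measurable_fst.comp (measurable_pi_apply i))) D := by
      ext D; rw [Kernel.comap_apply]
    rw [hκ]
    refine Measurable.lintegral_kernel_prod_right ?_
    refine hF.comp (g := F) (hupd.comp (f := fun q : (Fin n → A × E) × E =>
      (q.1, ((q.1 i).1, q.2))) ?_)
    exact measurable_fst.prodMk ((measurable_fst.comp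
      ((measurable_pi_apply i).comp measurable_fst)).prodMk measurable_snd)
  · rw [lmarginal_singleton, lmarginal_singleton]
    ext D
    have hFu : Measurable fun z : A × E => F (Function.update D i z) :=
      hF.comp (measurable_update D)
    rw [Measure.lintegral_compProd hFu]
    simp only [Function.update_self, Function.update_idem]
    rw [Measure.lintegral_compProd (f := fun z : A × E =>
      ∫⁻ y, F (Function.update D i (z.1, y)) ∂κ z.1)]
    · simp
    · have hk2 : (fun z : A × E => ∫⁻ y, F (Function.update D i (z.1, y)) ∂κ z.1) = fun z =>
          ∫⁻ y, F (Function.update D i (z.1, y)) ∂(Kernel.comap κ (Prod.fst : A × E → A)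
            (measurable_fst : Measurable (Prod.fst : A × E → A))) z := by
        ext z; rw [Kernel.comap_apply]
      rw [hk2]
      refine Measurable.lintegral_kernel_prod_right ?_
      exact hFu.comp ((measurable_fst.comp measurable_fst).prodMk measurable_snd)

/-- Exponential moments of sums of noise variables whose weights do not depend on the responses
that carry the noise. -/
theorem lintegral_exp_weighted_le (ν : Measure A) [IsProbabilityMeasure ν] (κ : Kernel A E)
    [IsMarkovKernel κ] {η : A × E → ℝ} (hη : Measurable η) {V T : ℝ}
    (hmgf : ∀ a t, |t| ≤ T → ∫⁻ y, ENNReal.ofReal (Real.exp (t * η (a, y))) ∂κ a ≤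
      ENNReal.ofReal (Real.exp (V * t ^ 2)))
    {w : Fin n → (Fin n → A × E) → ℝ} (hw : ∀ i, Measurable (w i)) (J : Finset (Fin n))
    (hwT : ∀ i D, |w i D| ≤ T)
    (hhon : ∀ i ∈ J, ∀ D y i', w i' (Function.update D i ((D i).1, y)) = w i' D) :
    ∀ {G : (Fin n → A × E) → ℝ≥0∞}, Measurable G →
    (∀ i ∈ J, ∀ D y, G (Function.update D i ((D i).1, y)) = G D) →
    ∫⁻ D, G D * ENNReal.ofReal (Real.exp (∑ i ∈ J, w i D * η (D i)))
        ∂Measure.pi (fun _ : Fin n => ν ⊗ₘ κ) ≤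
      ∫⁻ D, G D * ENNReal.ofReal (Real.exp (V * ∑ i ∈ J, w i D ^ 2))
        ∂Measure.pi (fun _ : Fin n => ν ⊗ₘ κ) := by
  classical
  -- One observation is integrated out at a time. Resampling its response changes neither `G`, nor
  -- the weights, nor the other noise terms, so what remains is one exponential moment; its bound is
  -- absorbed into `G`, which is why `G` is arbitrary in the induction.
  induction J using Finset.induction_on with
  | empty => intro G _ _; simp
  | insert i J hi ih =>
    intro G hG hGhon
    have hsum : ∀ J' : Finset (Fin n), Measurable fun D : Fin n → A × E =>
        ∑ i' ∈ J', w i' D * η (D i') := fun J' => Finset.measurable_sum _ fun j _ =>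
          (hw j).mul (hη.comp (measurable_pi_apply j))
    have step : ∫⁻ D, G D * ENNReal.ofReal (Real.exp (∑ i' ∈ insert i J, w i' D * η (D i')))
        ∂Measure.pi (fun _ : Fin n => ν ⊗ₘ κ) ≤
        ∫⁻ D, (G D * ENNReal.ofReal (Real.exp (V * w i D ^ 2))) *
          ENNReal.ofReal (Real.exp (∑ i' ∈ J, w i' D * η (D i')))
          ∂Measure.pi (fun _ : Fin n => ν ⊗ₘ κ) := by
      have hm : Measurable fun D => G D *
          ENNReal.ofReal (Real.exp (∑ i' ∈ insert i J, w i' D * η (D i'))) :=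
        hG.mul (hsum _).exp.ennreal_ofReal
      rw [lintegral_pi_resample ν κ i hm]
      refine lintegral_mono fun D => ?_
      have h1 : ∀ y, G (Function.update D i ((D i).1, y)) *
          ENNReal.ofReal (Real.exp (∑ i' ∈ insert i J, w i' (Function.update D i ((D i).1, y)) *
            η (Function.update D i ((D i).1, y) i'))) =
          (G D * ENNReal.ofReal (Real.exp (∑ i' ∈ J, w i' D * η (D i')))) *
            ENNReal.ofReal (Real.exp (w i D * η ((D i).1, y))) := by
        intro y
        rw [hGhon i (Finset.mem_insert_self _ _), Finset.sum_insert hi, Real.exp_add,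
          ENNReal.ofReal_mul (Real.exp_pos _).le, Function.update_self,
          hhon i (Finset.mem_insert_self _ _)]
        have : ∑ i' ∈ J, w i' (Function.update D i ((D i).1, y)) *
            η (Function.update D i ((D i).1, y) i') = ∑ i' ∈ J, w i' D * η (D i') := by
          refine Finset.sum_congr rfl fun j hj => ?_
          rw [hhon i (Finset.mem_insert_self _ _), Function.update_of_ne]
          rintro rfl; exact hi hj
        rw [this]
        ring
      simp only [h1]
      rw [lintegral_const_mul]
      · calc _ ≤ (G D * ENNReal.ofReal (Real.exp (∑ i' ∈ J, w i' D * η (D i')))) *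
              ENNReal.ofReal (Real.exp (V * w i D ^ 2)) := by
              gcongr
              exact hmgf _ _ (hwT i D)
          _ = _ := by ring
      · exact ((hη.comp measurable_prodMk_left).const_mul _).exp.ennreal_ofReal
    refine step.trans ((ih (fun j hj => hhon j (Finset.mem_insert_of_mem hj))
      (G := fun D => G D * ENNReal.ofReal (Real.exp (V * w i D ^ 2))) (hG.mul (((hw i).pow_const 2).const_mul V).exp.ennreal_ofReal) ?_).trans (le_of_eq ?_))
    · intro j hj D y
      rw [hGhon j (Finset.mem_insert_of_mem hj), hhon j (Finset.mem_insert_of_mem hj)]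
    · refine lintegral_congr fun D => ?_
      rw [Finset.sum_insert hi, mul_add, Real.exp_add, ENNReal.ofReal_mul (Real.exp_pos _).le,
        mul_assoc]

end Resampling

/-! ### Averages of trees grown on disjoint subsamples -/

section Blocks

variable {d p n a b k N : ℕ}

/-- The nodes of depth less than `b`. -/
abbrev Node (b : ℕ) : Type := Σ h : Fin b, (Fin h → Bool)

/-- Indices for the coordinates of representatives: either the upper end of the unit interval or
the threshold of a node of one of `N` trees. -/
abbrev RepIndex (d b N : ℕ) : Type := Fin d → Option (Fin N × Node b)

/-- The threshold to which an index refers. -/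
def repCoord (R : TreeRule d p a b) (D : Sample d p n) (t : Fin N → TreeSeed n a b) :
    Option (Fin N × Node b) → unitInterval
  | none => 1
  | some q => Set.projIcc 0 1 zero_le_one (treeLabels R D (t q.1) (List.ofFn q.2.2)).2

/-- The index refers to internal nodes. -/
def RepValid (R : TreeRule d p a b) (k : ℕ) (D : Sample d p n) (t : Fin N → TreeSeed n a b) :
    Option (Fin N × Node b) → Prop
  | none => True
  | some q => IsInternal k (treeCov D (t q.1).1) (treeLabels R D (t q.1)) (List.ofFn q.2.2)

/-- The representative with a given index. -/
def repPoint (R : TreeRule d p a b) (D : Sample d p n) (t : Fin N → TreeSeed n a b)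
    (I : RepIndex d b N) : Cube d := fun j => repCoord R D t (I j)

/-- Take the smallest number not below `x` among 1 and the thresholds of internal nodes: no
threshold separates it from `x`, and since cuts have the form `≤`, both lie on the same side of all
of them. Thresholds of every feature are admitted, so one index set serves all coordinates. -/
theorem exists_rep_coord (hk : 1 ≤ k) {ω : ℝ} (R : TreeRule d p a b) (D : Sample d p n)
    (t : Fin N → TreeSeed n a b)
    (hT : ∀ l, GoodTree k ω (treeCov D (t l).1) (treeLabels R D (t l))) (x : unitInterval) :
    ∃ o, RepValid R k D t o ∧ ∀ l v,
      IsInternal k (treeCov D (t l).1) (treeLabels R D (t l)) v →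
      ((x : ℝ) ≤ (treeLabels R D (t l) v).2 ↔
        (repCoord R D t o : ℝ) ≤ (treeLabels R D (t l) v).2) := by
  classical
  let S : Finset (Option (Fin N × Node b)) :=
    Finset.univ.filter fun o => RepValid R k D t o ∧ x ≤ repCoord R D t o
  have hS : S.Nonempty := ⟨none, Finset.mem_filter.2
    ⟨Finset.mem_univ _, trivial, unitInterval.le_one'⟩⟩
  obtain ⟨o, ho, hmin⟩ := S.exists_min_image (repCoord R D t) hS
  simp only [S, Finset.mem_filter, Finset.mem_univ, true_and] at ho hmin
  refine ⟨o, ho.1, fun l v hv => ⟨fun hx => ?_, fun h => le_trans (by exact_mod_cast ho.2) h⟩⟩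
  have hlen := (hT l).length_lt hk hv
  let q : Fin N × Node b := (l, ⟨⟨v.length, hlen⟩, fun i => v.get i⟩)
  have hq : List.ofFn q.2.2 = v := List.ofFn_get v
  -- Clipping to the unit interval could only raise a negative threshold, and this one is at least
  -- `x`.
  have h0 : (0 : ℝ) ≤ (treeLabels R D (t l) v).2 := x.2.1.trans hx
  have hc : repCoord R D t (some q) = Set.projIcc 0 1 zero_le_one (treeLabels R D (t l) v).2 := by
    simp only [repCoord]
    rw [hq]
  have hle : (repCoord R D t (some q) : ℝ) ≤ (treeLabels R D (t l) v).2 := by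
    rw [hc, Set.coe_projIcc]
    exact max_le h0 (min_le_right _ _)
  have hge : x ≤ repCoord R D t (some q) := by
    rw [hc]
    have := Set.monotone_projIcc (zero_le_one (α := ℝ)) hx
    rwa [Set.projIcc_val] at this
  have hval : RepValid R k D t (some q) := by
    simp only [RepValid]
    rw [hq]
    exact hv
  have := hmin (some q) ⟨hval, hge⟩
  exact le_trans (by exact_mod_cast this) hle

theorem exists_repPoint (hk : 1 ≤ k) {ω : ℝ} (R : TreeRule d p a b) (D : Sample d p n)
    (t : Fin N → TreeSeed n a b)
    (hT : ∀ l, GoodTree k ω (treeCov D (t l).1) (treeLabels R D (t l))) (u : Cube d) :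
    ∃ I : RepIndex d b N, (∀ j, RepValid R k D t (I j)) ∧ ∀ l i,
      treeWeight R k D (t l) u i = treeWeight R k D (t l) (repPoint R D t I) i := by
  choose I hI1 hI2 using fun j => exists_rep_coord hk R D t hT (u j)
  refine ⟨I, hI1, fun l i => treeWeight_congr_of_sides (fun v hv => ?_) i⟩
  exact hI2 _ l v hv

-- Per coordinate there are `b` depths with at most `b` internal nodes each, for each of `N` trees,
-- and the end point 1. The full index set is exponentially large; only the indices valid for the
-- sample are few, so the indicators have to stay inside the integrals.
open Classical in
theorem sum_repValid_le (hk : 1 ≤ k) (R : TreeRule d p a b) (D : Sample d p n)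
    (t : Fin N → TreeSeed n a b) :
    ∑ I : RepIndex d b N, (if ∀ j, RepValid R k D t (I j) then (1 : ℝ≥0∞) else 0) ≤
      ((N * (b * b) + 1) ^ d : ℕ) := by
  have h1 : ∑ I : RepIndex d b N, (if ∀ j, RepValid R k D t (I j) then (1 : ℝ≥0∞) else 0) =
      ((Finset.univ.filter fun I : RepIndex d b N => ∀ j, RepValid R k D t (I j)).card : ℝ≥0∞) := by
    rw [Finset.sum_boole]
  rw [h1]
  norm_cast
  have h2 : (Finset.univ.filter fun I : RepIndex d b N => ∀ j, RepValid R k D t (I j)) =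
      Fintype.piFinset fun _ => Finset.univ.filter (RepValid R k D t) := by
    ext I; simp
  rw [h2, Fintype.card_piFinset]
  simp only [Finset.prod_const, Finset.card_univ, Fintype.card_fin]
  refine Nat.pow_le_pow_left ?_ d
  rw [Finset.card_filter, Fintype.sum_option]
  rw [add_comm]
  refine add_le_add ?_ (by split_ifs <;> simp)
  rw [Fintype.sum_prod_type]
  refine (Finset.sum_le_sum (g := fun _ => b * b) fun l _ => ?_).trans (by simp)
  rw [Fintype.sum_sigma]
  refine (Finset.sum_le_sum (g := fun _ => b) fun h _ => ?_).trans (by simp)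
  rw [← Finset.card_filter]
  have := card_internal_le hk (treeCov D (t l).1) (treeLabels R D (t l)) (h : ℕ)
  rw [Set.ncard_eq_toFinset_card'] at this
  refine le_trans (le_of_eq ?_) this
  congr 1
  ext v
  simp only [Finset.mem_filter, Finset.mem_univ, true_and, Set.mem_toFinset]
  rfl

/-- The average of the noise over the trees with the given seeds. -/
def blockNoise (R : TreeRule d p a b) (k : ℕ) (η : Cube d × (Fin p → ℝ) → ℝ) (D : Sample d p n)
    (t : Fin N → TreeSeed n a b) (u : Cube d) : ℝ :=
  (1 / (N : ℝ)) * ∑ l, ∑ i, treeWeight R k D (t l) u i * η (D i)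

section Measurability

variable {Ω : Type*} [MeasurableSpace Ω]

theorem measurable_repCoord (R : TreeRule d p a b) {D : Ω → Sample d p n} (hD : Measurable D)
    {t : Ω → Fin N → TreeSeed n a b} (ht : Measurable t) (o : Option (Fin N × Node b)) :
    Measurable fun w => repCoord R (D w) (t w) o := by
  cases o with
  | none => exact measurable_const
  | some q =>
    simp only [repCoord]
    have h := (measurable_pi_apply (List.ofFn q.2.2)).comp
      (measurable_treeLabels R hD ((measurable_pi_apply q.1).comp ht))
    exact continuous_projIcc.measurable.comp (measurable_snd.comp h)

theorem measurable_repPoint (R : TreeRule d p a b) {D : Ω → Sample d p n} (hD : Measurable D)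
    {t : Ω → Fin N → TreeSeed n a b} (ht : Measurable t) (I : RepIndex d b N) :
    Measurable fun w => repPoint R (D w) (t w) I :=
  measurable_pi_iff.2 fun j => measurable_repCoord R hD ht (I j)

theorem measurableSet_repValid (R : TreeRule d p a b) {D : Ω → Sample d p n} (hD : Measurable D)
    {t : Ω → Fin N → TreeSeed n a b} (ht : Measurable t) (I : RepIndex d b N) :
    MeasurableSet {w | ∀ j, RepValid R k (D w) (t w) (I j)} := by
  rw [Set.ofPred_forall]
  refine MeasurableSet.iInter fun j => ?_
  cases I j with
  | none => simp [RepValid]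
  | some q =>
    have hq : Measurable fun w => t w q.1 := (measurable_pi_apply q.1).comp ht
    exact measurableSet_isInternal (measurable_treeLabels R hD hq)
      (measurable_treeCov hD (measurable_fst.comp hq)) _

theorem measurable_blockNoise (R : TreeRule d p a b) {η : Cube d × (Fin p → ℝ) → ℝ}
    (hη : Measurable η) {D : Ω → Sample d p n} (hD : Measurable D)
    {t : Ω → Fin N → TreeSeed n a b} (ht : Measurable t) {u : Ω → Cube d} (hu : Measurable u) :
    Measurable fun w => blockNoise R k η (D w) (t w) (u w) := by
  unfold blockNoise
  refine (Finset.measurable_sum _ fun l _ => Finset.measurable_sum _ fun i _ => ?_).const_mul _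
  exact (measurable_treeWeight R hD ((measurable_pi_apply l).comp ht) hu i).mul
    (hη.comp ((measurable_pi_apply i).comp hD))

end Measurability

-- Validity, representatives and weights are unaffected by the responses that carry the noise, so
-- these can be averaged out for each index. Disjointness bounds the total weight of an observation
-- over the trees by one, so its square is at most the weight itself, and the squared coefficients
-- sum to at most (c/N)² N = c²/N.
open Classical in
theorem lintegral_sum_exp_blockNoise_le (hk : 1 ≤ k) (R : TreeRule d p a b)
    (κ : Kernel (Cube d) (Fin p → ℝ)) [IsMarkovKernel κ]
    {η : Cube d × (Fin p → ℝ) → ℝ} (hη : Measurable η) {V T : ℝ} (hV : 0 ≤ V)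
    (hmgf : ∀ a t, |t| ≤ T → ∫⁻ y, ENNReal.ofReal (Real.exp (t * η (a, y))) ∂κ a ≤
      ENNReal.ofReal (Real.exp (V * t ^ 2)))
    (t : Fin N → TreeSeed n a b)
    (ht : Function.Injective fun q : Fin N × (Fin a ⊕ Fin b) => (t q.1).1 q.2)
    {c : ℝ} (hc : |c| ≤ N * T) (hN : 0 < N) :
    ∫⁻ D, ∑ I : RepIndex d b N, (if ∀ j, RepValid R k D t (I j) then (1 : ℝ≥0∞) else 0) *
        ENNReal.ofReal (Real.exp (c * blockNoise R k η D t (repPoint R D t I)))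
      ∂Measure.pi (fun _ : Fin n => (volume : Measure (Cube d)) ⊗ₘ κ) ≤
      ((N * (b * b) + 1) ^ d : ℕ) * ENNReal.ofReal (Real.exp (V * (c ^ 2 / N))) := by
  have hN' : (0 : ℝ) < N := by exact_mod_cast hN
  have hinr : ∀ l i l' i', (t l).1 (Sum.inr i) = (t l').1 (Sum.inr i') → l = l' := by
    intro l i l' i' h
    have := @ht (l, Sum.inr i) (l', Sum.inr i') h
    exact (Prod.ext_iff.1 this).1
  have hm0 : Measurable (fun D : Sample d p n => t) := measurable_const
  have hrep : ∀ I, Measurable fun D : Sample d p n => repPoint R D t I := fun I =>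
    measurable_repPoint R measurable_id hm0 I
  have hval : ∀ I : RepIndex d b N, Measurable fun D : Sample d p n =>
      (if ∀ j, RepValid R k D t (I j) then (1 : ℝ≥0∞) else 0) := fun I =>
    Measurable.ite (measurableSet_repValid R measurable_id hm0 I) measurable_const measurable_const
  -- the tree weights of distinct trees have disjoint supports
  have hsum01 : ∀ (D : Sample d p n) u i, ∑ l, treeWeight R k D (t l) u i ≤ 1 := by
    intro D u i
    by_cases h : ∃ l i', (t l).1 (Sum.inr i') = i
    · obtain ⟨l, i', rfl⟩ := h
      rw [Finset.sum_eq_single l]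
      · exact treeWeight_le_one _ _ _ _ _
      · intro l' _ hl'
        exact treeWeight_eq_zero fun i'' h => hl' (hinr _ _ _ _ h)
      · simp
    · push Not at h
      rw [Finset.sum_eq_zero fun l _ => treeWeight_eq_zero (h l)]
      exact zero_le_one
  have hsum0 : ∀ (D : Sample d p n) u i, 0 ≤ ∑ l, treeWeight R k D (t l) u i := fun D u i =>
    Finset.sum_nonneg fun l _ => treeWeight_nonneg _ _ _ _ _
  let J : Finset (Fin n) := Finset.univ.filter fun i => ∃ l i', (t l).1 (Sum.inr i') = i
  let w : RepIndex d b N → Fin n → Sample d p n → ℝ := fun I i D =>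
    c / N * ∑ l, treeWeight R k D (t l) (repPoint R D t I) i
  have hw : ∀ I i, Measurable (w I i) := fun I i =>
    (Finset.measurable_sum _ fun l _ => measurable_treeWeight R measurable_id
      measurable_const (hrep I) i).const_mul _
  -- An observation in one estimation sample lies in no splitting sample of the whole block, so
  -- changing its response changes none of the trees.
  have hinv1 : ∀ i ∈ J, ∀ (D : Sample d p n) y l,
      (∀ i', (Function.update D i ((D i).1, y) i').1 = (D i').1) ∧
      (∀ i', Function.update D i ((D i).1, y) ((t l).1 (Sum.inl i')) =
        D ((t l).1 (Sum.inl i'))) := by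
    intro i hi D y l
    obtain ⟨l', i₀, rfl⟩ := (Finset.mem_filter.1 hi).2
    constructor
    · intro i'
      by_cases h : i' = (t l').1 (Sum.inr i₀)
      · subst h; simp
      · simp [h]
    · intro i'
      rw [Function.update_of_ne]
      intro h
      have := @ht (l, Sum.inl i') (l', Sum.inr i₀) h
      simp at this
  have hlab : ∀ i ∈ J, ∀ (D : Sample d p n) y l,
      treeLabels R (Function.update D i ((D i).1, y)) (t l) = treeLabels R D (t l) ∧
      treeCov (Function.update D i ((D i).1, y)) (t l).1 = treeCov D (t l).1 := by
    intro i hi D y l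
    obtain ⟨h1, h2⟩ := hinv1 i hi D y l
    exact ⟨treeLabels_congr R h1 h2, treeCov_congr _ h1⟩
  have hrepinv : ∀ i ∈ J, ∀ (D : Sample d p n) y I,
      repPoint R (Function.update D i ((D i).1, y)) t I = repPoint R D t I := by
    intro i hi D y I
    ext1 j
    unfold repPoint
    rcases I j with _ | q
    · rfl
    · simp only [repCoord, (hlab i hi D y q.1).1]
  rw [lintegral_finsetSum]
  · calc _ ≤ ∑ I : RepIndex d b N, ∫⁻ D, (if ∀ j, RepValid R k D t (I j) then (1 : ℝ≥0∞) else 0) *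
          ENNReal.ofReal (Real.exp (V * (c ^ 2 / N)))
          ∂Measure.pi (fun _ : Fin n => (volume : Measure (Cube d)) ⊗ₘ κ) := by
          refine Finset.sum_le_sum fun I _ => ?_
          have key := lintegral_exp_weighted_le (volume : Measure (Cube d)) κ hη hmgf (hw I) J
            (fun i D => by
              simp only [w]
              rw [abs_mul, abs_div, Nat.abs_cast, abs_of_nonneg (hsum0 _ _ _)]
              have : |c| / N ≤ T := by rw [div_le_iff₀ hN']; linarith
              calc |c| / N * _ ≤ |c| / N * 1 := by gcongr; exact hsum01 _ _ _
                _ ≤ T := by linarith)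
            (fun i hi D y i' => by
              simp only [w, hrepinv i hi D y I]
              congr 1
              refine Finset.sum_congr rfl fun l _ => ?_
              obtain ⟨h1, h2⟩ := hinv1 i hi D y l
              exact treeWeight_congr R h1 h2 _ _)
            (hval I)
            (fun i hi D y => by
              have : ∀ o, RepValid R k (Function.update D i ((D i).1, y)) t o ↔
                  RepValid R k D t o := by
                intro o
                rcases o with _ | q
                · rfl
                · simp only [RepValid, (hlab i hi D y q.1).1, (hlab i hi D y q.1).2]
              simp only [this])
          refine (le_of_eq ?_).trans (key.trans (lintegral_mono fun D => ?_))
          · refine lintegral_congr fun D => ?_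
            congr 3
            rw [Finset.sum_subset (Finset.subset_univ J)]
            · simp only [blockNoise, w]
              rw [← mul_assoc, Finset.sum_comm, Finset.mul_sum]
              refine Finset.sum_congr rfl fun i _ => ?_
              rw [← Finset.sum_mul]
              ring
            · intro i _ hi
              have hi' : ∀ l i', (t l).1 (Sum.inr i') ≠ i := by
                simpa [J] using hi
              simp only [w]
              rw [Finset.sum_eq_zero fun l _ => treeWeight_eq_zero (hi' l)]
              simp
          · gcongr
            calc ∑ i ∈ J, w I i D ^ 2 ≤ ∑ i, w I i D ^ 2 :=
                  Finset.sum_le_sum_of_subset_of_nonneg (Finset.subset_univ _)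
                    fun _ _ _ => sq_nonneg _
              _ ≤ ∑ i, (c / N) ^ 2 * ∑ l, treeWeight R k D (t l) (repPoint R D t I) i := by
                  refine Finset.sum_le_sum fun i _ => ?_
                  simp only [w]
                  rw [mul_pow]
                  gcongr
                  rw [sq]
                  exact mul_le_of_le_one_left (hsum0 _ _ _) (hsum01 _ _ _)
              _ = (c / N) ^ 2 * ∑ l, ∑ i, treeWeight R k D (t l) (repPoint R D t I) i := by
                  rw [← Finset.mul_sum, Finset.sum_comm]
              _ ≤ (c / N) ^ 2 * ∑ _l : Fin N, 1 := by
                  gcongr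
                  exact sum_treeWeight_le_one _ _ _ _
              _ = c ^ 2 / N := by
                  simp
                  field_simp
      _ = (∫⁻ D, ∑ I : RepIndex d b N, (if ∀ j, RepValid R k D t (I j) then (1 : ℝ≥0∞) else 0)
          ∂Measure.pi (fun _ : Fin n => (volume : Measure (Cube d)) ⊗ₘ κ)) *
          ENNReal.ofReal (Real.exp (V * (c ^ 2 / N))) := by
          rw [lintegral_finsetSum _ (fun I _ => hval I), Finset.sum_mul]
          refine Finset.sum_congr rfl fun I _ => ?_
          rw [lintegral_mul_const _ (hval I)]
      _ ≤ _ := by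
          gcongr
          calc _ ≤ ∫⁻ _D : Sample d p n, (((N * (b * b) + 1) ^ d : ℕ) : ℝ≥0∞)
                ∂Measure.pi (fun _ : Fin n => (volume : Measure (Cube d)) ⊗ₘ κ) :=
                lintegral_mono fun D => sum_repValid_le hk R D t
            _ = _ := by simp
  · intro I _
    refine (hval I).mul (Measurable.ennreal_ofReal (Measurable.exp (Measurable.const_mul ?_ _)))
    exact measurable_blockNoise R hη measurable_id measurable_const (hrep I)

end Blocks

/-! ### Forests as mixtures of averages over disjoint subsamples -/

section Mixture

variable {J : Type*} [Fintype J] {n B N : ℕ}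

theorem exists_perm_comp_eq {α : Type*} [Finite α] (f g : J ↪ α) :
    ∃ σ : Equiv.Perm α, ∀ j, σ (f j) = g j := by
  classical
  let e : {x // x ∈ Set.range f} ≃ {x // x ∈ Set.range g} :=
    (Equiv.ofInjective f f.injective).symm.trans (Equiv.ofInjective g g.injective)
  have := Fintype.ofFinite α
  refine ⟨e.extendSubtype, fun j => ?_⟩
  rw [e.extendSubtype_apply_of_mem _ ⟨j, rfl⟩]
  have : (Equiv.ofInjective f f.injective).symm ⟨f j, ⟨j, rfl⟩⟩ = j := by
    rw [Equiv.symm_apply_eq]; rfl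
  simp [e, this]

/-- The average of a function of an embedding is the same for each equivariant parametrization. -/
theorem sum_embedding_average [DecidableEq J] {X : Type*} [Fintype X] (g : X → (J ↪ Fin n))
    (e : Equiv.Perm (Fin n) → Equiv.Perm X)
    (he : ∀ σ x, g (e σ x) = (g x).trans σ.toEmbedding) (f₀ : J ↪ Fin n) (A : (J ↪ Fin n) → ℝ) :
    (n ! : ℝ) * ∑ x, A (g x) =
      (Fintype.card X : ℝ) * ∑ σ : Equiv.Perm (Fin n), A (f₀.trans σ.toEmbedding) := by
  -- Permutations act transitively on embeddings, so the average over the orbit does not depend on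
  -- the starting point.
  have h1 : ∀ x, ∑ σ : Equiv.Perm (Fin n), A ((g x).trans σ.toEmbedding) =
      ∑ σ : Equiv.Perm (Fin n), A (f₀.trans σ.toEmbedding) := by
    intro x
    obtain ⟨ρ, hρ⟩ := exists_perm_comp_eq f₀ (g x)
    refine Fintype.sum_equiv (Equiv.mulRight ρ) _ _ fun σ => ?_
    congr 1
    ext j
    simp [hρ]
  have h2 : ∀ σ : Equiv.Perm (Fin n), ∑ x, A ((g x).trans σ.toEmbedding) = ∑ x, A (g x) := by
    intro σ
    refine Fintype.sum_equiv (e σ) _ _ fun x => ?_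
    rw [he]
  calc (n ! : ℝ) * ∑ x, A (g x)
      = ∑ σ : Equiv.Perm (Fin n), ∑ x, A ((g x).trans σ.toEmbedding) := by
        simp [h2, Fintype.card_perm]
    _ = ∑ x, ∑ σ : Equiv.Perm (Fin n), A ((g x).trans σ.toEmbedding) := Finset.sum_comm
    _ = _ := by simp [h1]

open Classical in
/-- The number of trees with given labels. -/
def labelCount (F : Fin B → J → Fin n) (f : J ↪ Fin n) : ℕ :=
  (Finset.univ.filter fun c => F c = f).card

/-- All subsamples are about equally frequent. -/
def Balanced (δ : ℝ) (F : Fin B → J → Fin n) : Prop :=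
  (∀ c, Function.Injective (F c)) ∧ ∀ f : J ↪ Fin n,
    |(labelCount F f : ℝ) / B - 1 / (Nat.card (J ↪ Fin n) : ℝ)| < δ / (Nat.card (J ↪ Fin n) : ℝ)

/-- A probability on the tuples of trees with disjoint subsamples such that a tree chosen at
random from a random tuple is almost a tree chosen at random. -/
structure IsBlockMixture (N : ℕ) (δ : ℝ) (F : Fin B → J → Fin n)
    (Q : (Fin N → Fin B) → ℝ) : Prop where
  nonneg : ∀ τ, 0 ≤ Q τ
  sum_eq : ∑ τ, Q τ = 1
  disjoint : ∀ τ, Q τ ≠ 0 → Function.Injective fun q : Fin N × J => F (τ q.1) q.2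
  approx : ∀ (T : Fin B → ℝ) (K : ℝ), (∀ c, |T c| ≤ K) →
    |(1 / (B : ℝ)) * ∑ c, T c - ∑ τ, Q τ * ((1 / (N : ℝ)) * ∑ l, T (τ l))| ≤ δ * K

/-- Hoeffding's device: draw at random an embedding of `Fin N × J`, that is, `N` disjoint
subsamples, and for each of them a random tree grown on exactly that subsample. Every row of the
embedding is uniform, so a single position of the tuple carries a uniform subsample and then a
uniform tree on it; the forest average differs from this only by the imbalance of the label counts.
-/
theorem Balanced.exists_mixture [DecidableEq J] {δ : ℝ} (hδ : δ ≤ 1) {F : Fin B → J → Fin n}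
    (hF : Balanced δ F) (hN : 0 < N) (hn : N * Fintype.card J ≤ n) :
    ∃ Q, IsBlockMixture N δ F Q := by
  classical
  -- the number of embeddings is positive
  have hex : Nonempty ((Fin N × J) ↪ Fin n) := by
    rw [Function.Embedding.nonempty_iff_card_le]
    simpa using hn
  obtain ⟨Φ₀⟩ := hex
  have : Nonempty ((Fin N × J) ↪ Fin n) := ⟨Φ₀⟩
  let row : ((Fin N × J) ↪ Fin n) → Fin N → (J ↪ Fin n) := fun Φ l =>
    ⟨fun j => Φ (l, j), fun j j' h => by simpa using Φ.injective h⟩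
  let f₀ : J ↪ Fin n := row Φ₀ ⟨0, hN⟩
  have : Nonempty (J ↪ Fin n) := ⟨f₀⟩
  have hcard : (0 : ℝ) < Nat.card (J ↪ Fin n) := by exact_mod_cast Nat.card_pos
  have hP : (0 : ℝ) < Fintype.card ((Fin N × J) ↪ Fin n) := by exact_mod_cast Fintype.card_pos
  have hN' : (0 : ℝ) < N := by exact_mod_cast hN
  have hpos : ∀ f : J ↪ Fin n, (0 : ℝ) < labelCount F f := by
    intro f
    -- With `δ ≤ 1`, the strict inequality in `Balanced` rules out a subsample on which no tree was
    -- grown.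
    rcases Nat.eq_zero_or_pos (labelCount F f) with h | h
    · have := hF.2 f
      rw [h] at this
      simp only [Nat.cast_zero, zero_div, zero_sub, abs_neg] at this
      rw [abs_of_pos (by positivity), div_lt_div_iff_of_pos_right hcard] at this
      linarith
    · exact_mod_cast h
  let g : (J ↪ Fin n) → Fin B → ℝ := fun f c => if F c = f then 1 / (labelCount F f : ℝ) else 0
  have hg0 : ∀ f c, 0 ≤ g f c := fun f c => by
    simp only [g]; split_ifs <;> positivity
  have hg1 : ∀ f, ∑ c, g f c = 1 := by
    intro f
    simp only [g]
    rw [← Finset.sum_filter, Finset.sum_const, nsmul_eq_mul]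
    have := (hpos f).ne'
    rw [show ((Finset.univ.filter fun c => F c = ⇑f).card : ℝ) = labelCount F f by
      simp [labelCount]]
    field_simp
  let P : ℝ := Fintype.card ((Fin N × J) ↪ Fin n)
  let Q : (Fin N → Fin B) → ℝ := fun τ => (1 / P) * ∑ Φ, ∏ l, g (row Φ l) (τ l)
  have hprod : ∀ (h : Fin N → Fin B → ℝ), ∑ τ : Fin N → Fin B, ∏ l, h l (τ l) =
      ∏ l, ∑ c, h l c := by
    intro h
    rw [Finset.prod_univ_sum, Fintype.piFinset_univ]
  let A : (Fin B → ℝ) → (J ↪ Fin n) → ℝ := fun T f => ∑ c, g f c * T c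
  have hlin : ∀ (T : Fin B → ℝ) (l : Fin N), ∑ τ, Q τ * T (τ l) =
      (1 / P) * ∑ Φ, A T (row Φ l) := by
    intro T l
    simp only [Q]
    simp only [mul_assoc, ← Finset.mul_sum]
    congr 1
    simp only [Finset.sum_mul]
    rw [Finset.sum_comm]
    refine Finset.sum_congr rfl fun Φ _ => ?_
    -- The function of the `l`-th entry is inserted as a factor at `l`, so that the sum over tuples
    -- becomes a product of sums, all but one equal to 1.
    have h1 : ∀ τ : Fin N → Fin B, (∏ l', g (row Φ l') (τ l')) * T (τ l) =
        ∏ l', (g (row Φ l') (τ l') * if l' = l then T (τ l') else 1) := by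
      intro τ
      rw [Finset.prod_mul_distrib, Finset.prod_ite_eq']
      simp
    simp only [h1]
    rw [hprod fun l' c => g (row Φ l') c * if l' = l then T c else 1]
    rw [Finset.prod_eq_single l]
    · simp [A]
    · intro l' _ hl'
      simp [hl', hg1]
    · simp
  have hrow : ∀ (T : Fin B → ℝ) (l : Fin N), (1 / P) * ∑ Φ, A T (row Φ l) =
      (1 / (Nat.card (J ↪ Fin n) : ℝ)) * ∑ f, A T f := by
    intro T l
    have h1 := sum_embedding_average (fun Φ => row Φ l)
      (fun σ => Equiv.embeddingCongr (Equiv.refl _) σ) (by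
        intro σ Φ; ext j; rfl) f₀ (A T)
    have h2 := sum_embedding_average (fun f : J ↪ Fin n => f)
      (fun σ => Equiv.embeddingCongr (Equiv.refl _) σ) (by
        intro σ Φ; ext j; rfl) f₀ (A T)
    have hfac : (0 : ℝ) < (n ! : ℝ) := by positivity
    rw [← Nat.card_eq_fintype_card] at h2
    have e1 : ∑ Φ, A T (row Φ l) = P * (∑ σ : Equiv.Perm (Fin n),
        A T (f₀.trans σ.toEmbedding)) / (n ! : ℝ) := by
      rw [eq_div_iff hfac.ne', mul_comm]; exact h1
    have e2 : ∑ f, A T f = (Nat.card (J ↪ Fin n) : ℝ) * (∑ σ : Equiv.Perm (Fin n),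
        A T (f₀.trans σ.toEmbedding)) / (n ! : ℝ) := by
      rw [eq_div_iff hfac.ne', mul_comm]; exact h2
    rw [e1, e2]
    have : P ≠ 0 := hP.ne'
    field_simp
  have hAone : ∀ f, A (fun _ => 1) f = 1 := fun f => by simp [A, hg1]
  refine ⟨Q, ⟨fun τ => ?_, ?_, fun τ hτ => ?_, fun T K hT => ?_⟩⟩
  · refine mul_nonneg (by positivity) (Finset.sum_nonneg fun Φ _ => Finset.prod_nonneg fun l _ =>
      hg0 _ _)
  · have := hlin (fun _ => 1) ⟨0, hN⟩
    simp only [mul_one] at this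
    rw [this]
    simp only [hAone, Finset.sum_const, Finset.card_univ, nsmul_eq_mul, mul_one]
    exact one_div_mul_cancel hP.ne'
  · have h1 : ∃ Φ, ∏ l, g (row Φ l) (τ l) ≠ 0 := by
      by_contra hcon
      push Not at hcon
      exact hτ (by simp [Q, hcon])
    obtain ⟨Φ, hΦ⟩ := h1
    have h2 : ∀ l j, F (τ l) j = Φ (l, j) := by
      intro l j
      have h3 := (Finset.prod_ne_zero_iff.1 hΦ) l (Finset.mem_univ _)
      have h4 : F (τ l) = row Φ l := by
        by_contra hne
        exact h3 (if_neg hne)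
      rw [h4]; rfl
    have : (fun q : Fin N × J => F (τ q.1) q.2) = Φ := by
      ext q; rw [h2]
    rw [this]
    exact Φ.injective
  · have hK : ∀ f, |A T f| ≤ K := by
      intro f
      calc |A T f| ≤ ∑ c, |g f c * T c| := Finset.abs_sum_le_sum_abs _ _
        _ ≤ ∑ c, g f c * K := by
            refine Finset.sum_le_sum fun c _ => ?_
            rw [abs_mul, abs_of_nonneg (hg0 f c)]
            exact mul_le_mul_of_nonneg_left (hT c) (hg0 f c)
        _ = K := by rw [← Finset.sum_mul, hg1, one_mul]
    have e1 : ∑ τ, Q τ * ((1 / (N : ℝ)) * ∑ l, T (τ l)) =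
        (1 / (Nat.card (J ↪ Fin n) : ℝ)) * ∑ f, A T f := by
      have : ∀ τ, Q τ * ((1 / (N : ℝ)) * ∑ l, T (τ l)) =
          (1 / (N : ℝ)) * ∑ l, Q τ * T (τ l) := by
        intro τ
        rw [Finset.mul_sum, Finset.mul_sum, Finset.mul_sum]
        exact Finset.sum_congr rfl fun l _ => by ring
      simp only [this]
      rw [← Finset.mul_sum, Finset.sum_comm]
      simp only [hlin, hrow]
      simp
      field_simp
    have e2 : (1 / (B : ℝ)) * ∑ c, T c = ∑ f : J ↪ Fin n, (labelCount F f : ℝ) / B * A T f := by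
      have h1 : ∀ c, ∑ f : J ↪ Fin n, (labelCount F f : ℝ) / B * (g f c * T c) =
          1 / (B : ℝ) * T c := by
        intro c
        rw [Finset.sum_eq_single ⟨F c, hF.1 c⟩]
        · have := (hpos ⟨F c, hF.1 c⟩).ne'
          simp only [g, Function.Embedding.coeFn_mk, if_true]
          field_simp
        · intro f _ hf
          have : F c ≠ f := by
            rintro h
            exact hf (by ext j; simp [h])
          simp [g, this]
        · simp
      simp only [A, Finset.mul_sum]
      rw [Finset.sum_comm]
      simp only [h1]
    rw [e1, e2, Finset.mul_sum, ← Finset.sum_sub_distrib]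
    calc _ ≤ ∑ f : J ↪ Fin n, |(labelCount F f : ℝ) / B * A T f -
          1 / (Nat.card (J ↪ Fin n) : ℝ) * A T f| := Finset.abs_sum_le_sum_abs _ _
      _ ≤ ∑ f : J ↪ Fin n, δ / (Nat.card (J ↪ Fin n) : ℝ) * K := by
          refine Finset.sum_le_sum fun f _ => ?_
          rw [← sub_mul, abs_mul]
          exact mul_le_mul (hF.2 f).le (hK f) (abs_nonneg _)
            ((abs_nonneg _).trans (hF.2 f).le)
      _ = δ * K := by
          rw [Finset.sum_const, Finset.card_univ, nsmul_eq_mul, ← Nat.card_eq_fintype_card]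
          field_simp

end Mixture

/-! ### Averages over the trees of a forest -/

section ForestAverages

/-- Chebyshev's inequality for averages of independent bounded variables. -/
theorem pi_mean_deviation_le {Ω : Type*} [MeasurableSpace Ω] (ν : Measure Ω)
    [IsProbabilityMeasure ν] {h : Ω → ℝ} (hm : Measurable h) {K : ℝ} (hK : ∀ w, |h w| ≤ K)
    {B : ℕ} (hB : 0 < B) {δ : ℝ} (hδ : 0 < δ) :
    Measure.pi (fun _ : Fin B => ν) {t | δ ≤ |(1 / (B : ℝ)) * ∑ c, h (t c) - ∫ w, h w ∂ν|} ≤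
      ENNReal.ofReal (K ^ 2 / (B * δ ^ 2)) := by
  have hB' : (0 : ℝ) < B := by exact_mod_cast hB
  have hLp : MemLp h 2 ν := MemLp.of_bound hm.aestronglyMeasurable K (Eventually.of_forall hK)
  have hLpi : ∀ c : Fin B, MemLp (fun t : Fin B → Ω => h (t c)) 2 (Measure.pi fun _ => ν) :=
    fun c => MemLp.of_bound (hm.comp (measurable_pi_apply c)).aestronglyMeasurable K
      (Eventually.of_forall fun t => hK _)
  set X : (Fin B → Ω) → ℝ := ∑ c, fun t => h (t c) with hX
  have hXL : MemLp X 2 (Measure.pi fun _ : Fin B => ν) := memLp_finsetSum' _ fun c _ => hLpi c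
  have hXint : ∫ t, X t ∂(Measure.pi fun _ : Fin B => ν) = B * ∫ w, h w ∂ν := by
    simp only [hX, Finset.sum_apply]
    rw [integral_finsetSum _ fun c _ => (hLpi c).integrable (by norm_num)]
    have : ∀ c : Fin B, ∫ t : Fin B → Ω, h (t c) ∂(Measure.pi fun _ : Fin B => ν) =
        ∫ w, h w ∂ν := fun c =>
      integral_comp_eval (μ := fun _ : Fin B => ν) (i := c) hm.aestronglyMeasurable
    simp [this]
  have hvar : Var[X; Measure.pi fun _ : Fin B => ν] ≤ B * K ^ 2 := by
    rw [hX, variance_sum_pi (fun _ => hLp)]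
    simp only [Finset.sum_const, Finset.card_univ, Fintype.card_fin, nsmul_eq_mul]
    gcongr
    refine (variance_le_expectation_sq hm.aestronglyMeasurable).trans ?_
    calc ∫ w, (h ^ 2) w ∂ν ≤ ∫ _w, K ^ 2 ∂ν := by
          refine integral_mono_of_nonneg (Eventually.of_forall fun w => sq_nonneg _)
            (integrable_const _) (Eventually.of_forall fun w => ?_)
          simp only [Pi.pow_apply]
          rw [← sq_abs]
          exact pow_le_pow_left₀ (abs_nonneg _) (hK w) 2
      _ = K ^ 2 := by simp
  have := meas_ge_le_variance_div_sq hXL (c := B * δ) (by positivity)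
  refine le_trans (measure_mono fun t ht => ?_) (this.trans (ENNReal.ofReal_le_ofReal ?_))
  · simp only [Set.mem_ofPred_eq] at ht ⊢
    rw [hXint]
    have h1 : X t - B * ∫ w, h w ∂ν = B * ((1 / (B : ℝ)) * ∑ c, h (t c) - ∫ w, h w ∂ν) := by
      simp only [hX, Finset.sum_apply]
      field_simp
    rw [h1, abs_mul, abs_of_pos hB']
    gcongr
  · rw [div_le_div_iff₀ (by positivity) (by positivity)]
    calc _ ≤ (B * K ^ 2) * (B * δ ^ 2) := by gcongr
      _ = K ^ 2 * (B * δ) ^ 2 := by ring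

variable {n a b B : ℕ}

theorem nonempty_embedding (hn : a + b ≤ n) : Nonempty ((Fin a ⊕ Fin b) ↪ Fin n) := by
  rw [Function.Embedding.nonempty_iff_card_le]
  simpa using hn

theorem isProbabilityMeasure_treeSeedLaw (hn : a + b ≤ n) :
    IsProbabilityMeasure (treeSeedLaw n a b) := by
  obtain ⟨f⟩ := nonempty_embedding hn
  have : IsProbabilityMeasure
      (uniformOn {f : Fin a ⊕ Fin b → Fin n | Function.Injective f}) :=
    isProbabilityMeasure_uniformOn (Set.toFinite _) ⟨f, f.injective⟩
  unfold treeSeedLaw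
  infer_instance

theorem treeSeedLaw_fst_eq (f : (Fin a ⊕ Fin b) ↪ Fin n) :
    treeSeedLaw n a b {t | t.1 = f} =
      ENNReal.ofReal (1 / (Nat.card ((Fin a ⊕ Fin b) ↪ Fin n) : ℝ)) := by
  classical
  have h1 : {t : TreeSeed n a b | t.1 = f} = {(f : Fin a ⊕ Fin b → Fin n)} ×ˢ Set.univ := by
    ext t; simp
  unfold treeSeedLaw
  rw [h1, Measure.prod_prod, measure_univ, mul_one, uniformOn, cond_apply (Set.toFinite _).measurableSet]
  have h2 : {f : Fin a ⊕ Fin b → Fin n | Function.Injective f} ∩ {(f : Fin a ⊕ Fin b → Fin n)} =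
      {(f : Fin a ⊕ Fin b → Fin n)} := by
    rw [Set.inter_eq_right]
    simpa using f.injective
  rw [h2, Measure.count_singleton, mul_one, Measure.count_apply_finite _ (Set.toFinite _)]
  have h3 : (Set.toFinite {f : Fin a ⊕ Fin b → Fin n | Function.Injective f}).toFinset.card =
      Nat.card ((Fin a ⊕ Fin b) ↪ Fin n) := by
    rw [← Nat.card_congr (Equiv.subtypeInjectiveEquivEmbedding _ _),
      ← Set.ncard_eq_toFinset_card]
    rfl
  rw [h3]
  have : 0 < Nat.card ((Fin a ⊕ Fin b) ↪ Fin n) := by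
    have : Nonempty ((Fin a ⊕ Fin b) ↪ Fin n) := ⟨f⟩
    exact Nat.card_pos
  rw [one_div, ENNReal.ofReal_inv_of_pos (by exact_mod_cast this), ENNReal.ofReal_natCast]

theorem treeSeedLaw_not_injective :
    treeSeedLaw n a b {t | ¬ Function.Injective t.1} = 0 := by
  have h1 : {t : TreeSeed n a b | ¬ Function.Injective t.1} =
      {f : Fin a ⊕ Fin b → Fin n | Function.Injective f}ᶜ ×ˢ Set.univ := by
    ext t; simp
  unfold treeSeedLaw
  rw [h1, Measure.prod_prod, (uniformOn_eq_zero_iff (Set.toFinite _)).2 (Set.inter_compl_self _),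
    zero_mul]

-- Chebyshev's inequality with accuracy δ/C for each of the C embeddings, and a union bound: C ·
-- C²/(Bδ²). The size of C is harmless since the number of trees is at disposal.
open Classical in
theorem forestSeedLaw_not_balanced_le (hn : a + b ≤ n) (hB : 0 < B) {δ : ℝ} (hδ : 0 < δ) :
    forestSeedLaw B n a b {t | ¬ Balanced δ fun c => (t c).1} ≤
      ENNReal.ofReal ((Nat.card ((Fin a ⊕ Fin b) ↪ Fin n) : ℝ) ^ 3 / (B * δ ^ 2)) := by
  have := isProbabilityMeasure_treeSeedLaw hn
  have := nonempty_embedding hn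
  set C : ℝ := (Nat.card ((Fin a ⊕ Fin b) ↪ Fin n) : ℝ) with hC
  have hC0 : 0 < C := by
    rw [hC]; exact_mod_cast Nat.card_pos
  have hB' : (0 : ℝ) < B := by exact_mod_cast hB
  let h : ((Fin a ⊕ Fin b) ↪ Fin n) → TreeSeed n a b → ℝ := fun f t => if t.1 = f then 1 else 0
  have hmeas : ∀ f : (Fin a ⊕ Fin b) ↪ Fin n, MeasurableSet {t : TreeSeed n a b | t.1 = f} :=
    fun f => measurable_fst (measurableSet_singleton _)
  have hm : ∀ f, Measurable (h f) := fun f => Measurable.ite (hmeas f) measurable_const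
    measurable_const
  have hint : ∀ f, ∫ t, h f t ∂treeSeedLaw n a b = 1 / C := by
    intro f
    have h1 : h f = Set.indicator {t : TreeSeed n a b | t.1 = f} 1 := by
      ext t; simp [h, Set.indicator_apply]
    rw [h1, integral_indicator_one (hmeas f), measureReal_def, treeSeedLaw_fst_eq,
      ENNReal.toReal_ofReal (by positivity)]
  have hsub : {t : Fin B → TreeSeed n a b | ¬ Balanced δ fun c => (t c).1} ⊆
      (⋃ c, {t | ¬ Function.Injective (t c).1}) ∪
      ⋃ f, {t | δ / C ≤ |(1 / (B : ℝ)) * ∑ c, h f (t c) - ∫ w, h f w ∂treeSeedLaw n a b|} := by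
    intro t ht
    by_contra hcon
    simp only [Set.mem_union, Set.mem_iUnion, Set.mem_ofPred_eq, not_or, not_exists,
      not_not, not_le] at hcon
    refine ht ⟨hcon.1, fun f => ?_⟩
    have := hcon.2 f
    rw [hint] at this
    have h2 : ∑ c, h f (t c) = labelCount (fun c => (t c).1) f := by
      simp only [h, labelCount, Finset.sum_boole]
    rw [h2] at this
    rwa [div_mul_eq_mul_div, one_mul] at this
  refine (measure_mono hsub).trans ((measure_union_le _ _).trans ?_)
  have hz : forestSeedLaw B n a b (⋃ c, {t | ¬ Function.Injective (t c).1}) = 0 := by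
    rw [measure_iUnion_null_iff]
    intro c
    have := (measurePreserving_eval (fun _ : Fin B => treeSeedLaw n a b) c).quasiMeasurePreserving
      |>.preimage_null treeSeedLaw_not_injective
    exact this
  rw [hz, zero_add]
  refine (measure_iUnion_le _).trans ?_
  rw [tsum_fintype]
  calc _ ≤ ∑ _f : (Fin a ⊕ Fin b) ↪ Fin n, ENNReal.ofReal (1 ^ 2 / (B * (δ / C) ^ 2)) := by
        refine Finset.sum_le_sum fun f _ => ?_
        exact pi_mean_deviation_le _ (hm f) (K := 1)
          (fun w => by simp only [h]; split_ifs <;> simp) hB (by positivity)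
    _ = ENNReal.ofReal (C * (1 ^ 2 / (B * (δ / C) ^ 2))) := by
        rw [Finset.sum_const, Finset.card_univ, nsmul_eq_mul, ENNReal.ofReal_mul hC0.le, hC,
          ENNReal.ofReal_natCast, Nat.card_eq_fintype_card]
    _ = _ := by
        congr 1
        field_simp

end ForestAverages

/-! ### The noise of a forest -/

section ForestNoise

variable {d p n a b k N B : ℕ} {ι : Type*} [Fintype ι]

theorem sum_forestWeight_mul (R : TreeRule d p a b) (D : Sample d p n)
    (t : Fin B → TreeSeed n a b) (u : Cube d) (z : Fin n → ℝ) :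
    ∑ i, forestWeight R k D t u i * z i =
      (1 / (B : ℝ)) * ∑ c, ∑ i, treeWeight R k D (t c) u i * z i := by
  simp only [forestWeight, mul_assoc, Finset.sum_mul]
  rw [← Finset.mul_sum, Finset.sum_comm]

open Classical in
/-- A choice of a mixture, if there is one. -/
def mixture {J : Type*} [Fintype J] (N : ℕ) (δ : ℝ) (F : Fin B → J → Fin n) :
    (Fin N → Fin B) → ℝ :=
  if h : ∃ Q, IsBlockMixture N δ F Q then h.choose else 0

open Classical in
/-- The sum of the exponentials of the block averages of the noise over all representatives. -/
def noiseGauge (R : TreeRule d p a b) (k N : ℕ) (δ : ℝ) (η : ι → Cube d × (Fin p → ℝ) → ℝ)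
    (c : ℝ) (x : Sample d p n × (Fin B → TreeSeed n a b)) : ℝ≥0∞ :=
  ∑ τ : Fin N → Fin B, ENNReal.ofReal (mixture N δ (fun e => (x.2 e).1) τ) *
    ∑ i : ι, ∑ s : Bool, ∑ I : RepIndex d b N,
      (if ∀ j, RepValid R k x.1 (fun l => x.2 (τ l)) (I j) then (1 : ℝ≥0∞) else 0) *
      ENNReal.ofReal (Real.exp ((if s then c else -c) * blockNoise R k (η i) x.1
        (fun l => x.2 (τ l)) (repPoint R x.1 (fun l => x.2 (τ l)) I)))

theorem measurable_noiseGauge_summand (R : TreeRule d p a b) {η : Cube d × (Fin p → ℝ) → ℝ}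
    (hη : Measurable η) (c : ℝ) {Ω : Type*} [MeasurableSpace Ω] {D : Ω → Sample d p n}
    (hD : Measurable D) {t : Ω → Fin N → TreeSeed n a b} (ht : Measurable t)
    (I : RepIndex d b N) : Measurable fun w =>
      (open Classical in if ∀ j, RepValid R k (D w) (t w) (I j) then (1 : ℝ≥0∞) else 0) *
      ENNReal.ofReal (Real.exp (c * blockNoise R k η (D w) (t w) (repPoint R (D w) (t w) I))) := by
  refine Measurable.mul ?_ (Measurable.ennreal_ofReal (Measurable.exp (Measurable.const_mul ?_ _)))
  · exact Measurable.ite (measurableSet_repValid R hD ht I) measurable_const measurable_const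
  · exact measurable_blockNoise R hη hD ht (measurable_repPoint R hD ht I)

theorem measurable_noiseGauge (R : TreeRule d p a b) (δ : ℝ)
    {η : ι → Cube d × (Fin p → ℝ) → ℝ} (hη : ∀ i, Measurable (η i)) (c : ℝ) :
    Measurable (noiseGauge R k N δ η c : Sample d p n × (Fin B → TreeSeed n a b) → ℝ≥0∞) := by
  unfold noiseGauge
  refine Finset.measurable_sum _ fun τ _ => Measurable.mul ?_ ?_
  · have h1 : Measurable fun x : Sample d p n × (Fin B → TreeSeed n a b) =>
        fun e => (x.2 e).1 := measurable_pi_iff.2 fun e =>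
      measurable_fst.comp ((measurable_pi_apply e).comp measurable_snd)
    -- The mixture is chosen non-constructively, but it depends only on the labels, which form a
    -- finite discrete space.
    have h2 : Measurable fun F : Fin B → Fin a ⊕ Fin b → Fin n =>
        ENNReal.ofReal (mixture N δ F τ) := Measurable.of_discrete
    exact h2.comp h1
  · refine Finset.measurable_sum _ fun i _ => Finset.measurable_sum _ fun s _ =>
      Finset.measurable_sum _ fun I _ => ?_
    exact measurable_noiseGauge_summand R (hη i) _ measurable_fst
      (measurable_pi_iff.2 fun l => (measurable_pi_apply (τ l)).comp measurable_snd) I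

theorem mixture_spec_or {J : Type*} [Fintype J] (N : ℕ) (δ : ℝ) (F : Fin B → J → Fin n) :
    IsBlockMixture N δ F (mixture N δ F) ∨ mixture N δ F = 0 := by
  unfold mixture
  split_ifs with h
  · exact Or.inl h.choose_spec
  · exact Or.inr rfl

/-- The seeds are independent of the data and can be fixed. A mixture has total mass one and charges
only tuples with disjoint subsamples, to which the block bound applies for each statistic and each
sign; without a mixture the gauge vanishes. -/
theorem lintegral_noiseGauge_le (hk : 1 ≤ k) (R : TreeRule d p a b)
    (κ : Kernel (Cube d) (Fin p → ℝ)) [IsMarkovKernel κ] (δ : ℝ)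
    {η : ι → Cube d × (Fin p → ℝ) → ℝ} (hη : ∀ i, Measurable (η i)) {V T : ℝ} (hV : 0 ≤ V)
    (hmgf : ∀ i a t, |t| ≤ T → ∫⁻ y, ENNReal.ofReal (Real.exp (t * η i (a, y))) ∂κ a ≤
      ENNReal.ofReal (Real.exp (V * t ^ 2)))
    (ν : Measure (Fin B → TreeSeed n a b)) [IsProbabilityMeasure ν]
    {c : ℝ} (hc0 : 0 ≤ c) (hc : c ≤ N * T) (hN : 0 < N) :
    ∫⁻ x, noiseGauge R k N δ η c x
      ∂((Measure.pi fun _ : Fin n => (volume : Measure (Cube d)) ⊗ₘ κ).prod ν) ≤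
      (2 * Fintype.card ι * (N * (b * b) + 1) ^ d : ℕ) *
        ENNReal.ofReal (Real.exp (V * (c ^ 2 / N))) := by
  classical
  rw [lintegral_prod_symm _ (measurable_noiseGauge R δ hη c).aemeasurable]
  set L : ℝ≥0∞ := (2 * Fintype.card ι * (N * (b * b) + 1) ^ d : ℕ) *
        ENNReal.ofReal (Real.exp (V * (c ^ 2 / N))) with hL
  have key : ∀ t : Fin B → TreeSeed n a b, ∫⁻ D, noiseGauge R k N δ η c (D, t)
      ∂(Measure.pi fun _ : Fin n => (volume : Measure (Cube d)) ⊗ₘ κ) ≤ L := by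
    intro t
    rcases mixture_spec_or N δ (fun e => (t e).1) with hQ | hQ
    · have hms : ∀ (τ : Fin N → Fin B) i (s : Bool) (I : RepIndex d b N),
          Measurable fun D : Sample d p n => (if ∀ j, RepValid R k D (fun l => t (τ l)) (I j)
            then (1 : ℝ≥0∞) else 0) *
          ENNReal.ofReal (Real.exp ((if s then c else -c) * blockNoise R k (η i) D
        (fun l => t (τ l)) (repPoint R D (fun l => t (τ l)) I))) := by
        intro τ i s I
        exact measurable_noiseGauge_summand R (hη i) _ measurable_id measurable_const I
      unfold noiseGauge
      simp only
      rw [lintegral_finsetSum]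
      · have hτ : ∀ τ : Fin N → Fin B,
            ∫⁻ D, ENNReal.ofReal (mixture N δ (fun e => (t e).1) τ) *
              ∑ i : ι, ∑ s : Bool, ∑ I : RepIndex d b N,
                (if ∀ j, RepValid R k D (fun l => t (τ l)) (I j) then (1 : ℝ≥0∞) else 0) *
                ENNReal.ofReal (Real.exp ((if s then c else -c) * blockNoise R k (η i) D
                (fun l => t (τ l)) (repPoint R D (fun l => t (τ l)) I)))
            ∂(Measure.pi fun _ : Fin n => (volume : Measure (Cube d)) ⊗ₘ κ) ≤
            ENNReal.ofReal (mixture N δ (fun e => (t e).1) τ) * L := by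
          intro τ
          rcases eq_or_ne (mixture N δ (fun e => (t e).1) τ) 0 with h0 | h0
          · simp [h0]
          have hinj := hQ.disjoint τ h0
          rw [lintegral_const_mul]
          · gcongr
            rw [lintegral_finsetSum]
            · have : ∀ i : ι, ∫⁻ D, ∑ s : Bool, ∑ I : RepIndex d b N,
                  (if ∀ j, RepValid R k D (fun l => t (τ l)) (I j) then (1 : ℝ≥0∞) else 0) *
                  ENNReal.ofReal (Real.exp ((if s then c else -c) * blockNoise R k (η i) D
                  (fun l => t (τ l)) (repPoint R D (fun l => t (τ l)) I)))
                  ∂(Measure.pi fun _ : Fin n => (volume : Measure (Cube d)) ⊗ₘ κ) ≤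
                  2 * (((N * (b * b) + 1) ^ d : ℕ) *
                    ENNReal.ofReal (Real.exp (V * (c ^ 2 / N)))) := by
                intro i
                rw [lintegral_finsetSum]
                · rw [Fintype.sum_bool, two_mul]
                  refine add_le_add ?_ ?_
                  · simp only [if_true]
                    exact lintegral_sum_exp_blockNoise_le hk R κ (hη i) hV (hmgf i) (fun l => t (τ l)) hinj
                      (by rwa [abs_of_nonneg hc0]) hN
                  · simp only [Bool.false_eq_true, if_false]
                    have := lintegral_sum_exp_blockNoise_le hk R κ (hη i) hV (hmgf i) (fun l => t (τ l)) hinj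
                      (c := -c) (by rwa [abs_neg, abs_of_nonneg hc0]) hN
                    rwa [neg_sq] at this
                · intro s _
                  exact Finset.measurable_sum _ fun I _ => hms τ i s I
              refine (Finset.sum_le_sum fun i _ => this i).trans ?_
              rw [Finset.sum_const, Finset.card_univ, nsmul_eq_mul, hL]
              refine le_of_eq ?_
              push_cast
              ring
            · intro i _
              exact Finset.measurable_sum _ fun s _ => Finset.measurable_sum _ fun I _ => hms τ i s I
          · exact Finset.measurable_sum _ fun i _ => Finset.measurable_sum _ fun s _ =>
              Finset.measurable_sum _ fun I _ => hms τ i s I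
        refine (Finset.sum_le_sum fun τ _ => hτ τ).trans ?_
        rw [← Finset.sum_mul, ← ENNReal.ofReal_sum_of_nonneg fun τ _ => hQ.nonneg τ, hQ.sum_eq]
        simp
      · intro τ _
        exact (Finset.measurable_sum _ fun i _ => Finset.measurable_sum _ fun s _ =>
              Finset.measurable_sum _ fun I _ => hms τ i s I).const_mul _
    · simp [noiseGauge, hQ]
  calc _ ≤ ∫⁻ _t, L ∂ν := lintegral_mono key
    _ = L := by simp

/-- Jensen's inequality moves the exponential inside the convex combination of blocks, so no union
bound over tuples of trees is paid. Replacing the forest by the mixture costs `δ * K`, and each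
block sees `u` as one of its valid representatives, which is one summand of the gauge. -/
theorem exp_le_noiseGauge (hk : 1 ≤ k) {ω π : ℝ} {R : TreeRule d p a b}
    (hR : R.IsRegular k ω π) {δ : ℝ} (hδ : δ ≤ 1) (hN : 0 < N) (hn : N * (a + b) ≤ n)
    {η : ι → Cube d × (Fin p → ℝ) → ℝ} {c : ℝ} (hc0 : 0 ≤ c) {K y : ℝ}
    {D : Sample d p n} {t : Fin B → TreeSeed n a b} (hD : SampleGenPos D)
    (ht : Balanced δ fun e => (t e).1) (hK0 : 0 ≤ K) (hK : ∀ i j, |η i (D j)| ≤ K)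
    {u : Cube d} {i : ι}
    (hy : y + δ * K < |∑ j, forestWeight R k D t u j * η i (D j)|) :
    ENNReal.ofReal (Real.exp (c * y)) ≤ noiseGauge R k N δ η c (D, t) := by
  classical
  have hexQ : ∃ Q, IsBlockMixture N δ (fun e => (t e).1) Q :=
    ht.exists_mixture hδ hN (by simpa using hn)
  have hQ : IsBlockMixture N δ (fun e => (t e).1) (mixture N δ fun e => (t e).1) := by
    unfold mixture
    rw [dif_pos hexQ]
    exact hexQ.choose_spec
  set Q := mixture N δ (fun e => (t e).1) with hQdef
  let T : Fin B → ℝ := fun e => ∑ j, treeWeight R k D (t e) u j * η i (D j)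
  have hT : ∀ e, |T e| ≤ K := by
    intro e
    calc |T e| ≤ ∑ j, |treeWeight R k D (t e) u j * η i (D j)| := Finset.abs_sum_le_sum_abs _ _
      _ ≤ ∑ j, treeWeight R k D (t e) u j * K := by
          refine Finset.sum_le_sum fun j _ => ?_
          rw [abs_mul, abs_of_nonneg (treeWeight_nonneg _ _ _ _ _)]
          exact mul_le_mul_of_nonneg_left (hK i j) (treeWeight_nonneg _ _ _ _ _)
      _ ≤ K := by
          rw [← Finset.sum_mul]
          exact mul_le_of_le_one_left hK0 (sum_treeWeight_le_one _ _ _ _)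
  have hblock : ∀ τ : Fin N → Fin B, blockNoise R k (η i) D (fun l => t (τ l)) u =
      (1 / (N : ℝ)) * ∑ l, T (τ l) := fun τ => rfl
  rw [sum_forestWeight_mul] at hy
  have happ := hQ.approx T K hT
  set main : ℝ := ∑ τ, Q τ * blockNoise R k (η i) D (fun l => t (τ l)) u with hmain
  have hy' : y < |main| := by
    have h1 := abs_sub_abs_le_abs_sub ((1 / (B : ℝ)) * ∑ e, T e) main
    have h2 : |(1 / (B : ℝ)) * ∑ e, T e - main| ≤ δ * K := happ
    linarith
  -- The sign is that of the mixture average; the gauge contains both.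
  obtain ⟨s, hs⟩ : ∃ s : Bool, c * y ≤ (if s then c else -c) * main := by
    rcases lt_abs.1 hy' with h | h
    · exact ⟨true, by simp only [if_true]; gcongr⟩
    · refine ⟨false, ?_⟩
      simp only [Bool.false_eq_true, if_false]
      nlinarith
  set c' : ℝ := if s then c else -c with hc'
  have hjensen : Real.exp (c' * main) ≤
      ∑ τ, Q τ * Real.exp (c' * blockNoise R k (η i) D (fun l => t (τ l)) u) := by
    have h1 : c' * main = ∑ τ, Q τ • (c' * blockNoise R k (η i) D (fun l => t (τ l)) u) := by
      rw [hmain, Finset.mul_sum]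
      refine Finset.sum_congr rfl fun τ _ => ?_
      rw [smul_eq_mul]; ring
    rw [h1]
    exact convexOn_exp.map_sum_le (fun τ _ => hQ.nonneg τ) hQ.sum_eq (fun τ _ => Set.mem_univ _)
  calc ENNReal.ofReal (Real.exp (c * y))
      ≤ ENNReal.ofReal
          (∑ τ, Q τ * Real.exp (c' * blockNoise R k (η i) D (fun l => t (τ l)) u)) :=
        ENNReal.ofReal_le_ofReal ((Real.exp_le_exp.2 hs).trans hjensen)
    _ = ∑ τ, ENNReal.ofReal (Q τ) *
          ENNReal.ofReal (Real.exp (c' * blockNoise R k (η i) D (fun l => t (τ l)) u)) := by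
        rw [ENNReal.ofReal_sum_of_nonneg fun τ _ => mul_nonneg (hQ.nonneg τ) (Real.exp_pos _).le]
        exact Finset.sum_congr rfl fun τ _ => ENNReal.ofReal_mul (hQ.nonneg τ)
    _ ≤ noiseGauge R k N δ η c (D, t) := by
        unfold noiseGauge
        refine Finset.sum_le_sum fun τ _ => ?_
        gcongr
        obtain ⟨I, hI1, hI2⟩ := exists_repPoint hk R D (fun l => t (τ l))
          (fun l => hR.goodTree hD (ht.1 (τ l))) u
        have hrep : blockNoise R k (η i) D (fun l => t (τ l)) u =
            blockNoise R k (η i) D (fun l => t (τ l)) (repPoint R D (fun l => t (τ l)) I) := by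
          unfold blockNoise
          simp only [hI2]
        let S : ι → Bool → RepIndex d b N → ℝ≥0∞ := fun i s I =>
          (if ∀ j, RepValid R k D (fun l => t (τ l)) (I j) then (1 : ℝ≥0∞) else 0) *
          ENNReal.ofReal (Real.exp ((if s then c else -c) * blockNoise R k (η i) D
            (fun l => t (τ l)) (repPoint R D (fun l => t (τ l)) I)))
        calc _ = S i s I := by
              simp only [S, if_pos hI1, one_mul]
              rw [hrep]
          _ ≤ ∑ I, S i s I := Finset.single_le_sum (f := S i s) (fun _ _ => zero_le) (Finset.mem_univ I)
          _ ≤ ∑ s, ∑ I, S i s I := Finset.single_le_sum (f := fun s => ∑ I, S i s I)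
              (fun _ _ => zero_le) (Finset.mem_univ s)
          _ ≤ ∑ i, ∑ s, ∑ I, S i s I := Finset.single_le_sum (f := fun i => ∑ s, ∑ I, S i s I)
              (fun _ _ => zero_le) (Finset.mem_univ i)

/-- Markov's inequality for the gauge, a measurable function that dominates the event over all `u`,
whose own measurability is never needed. -/
theorem forest_noise_le (hk : 1 ≤ k) {ω π : ℝ} {R : TreeRule d p a b}
    (hR : R.IsRegular k ω π) {δ : ℝ} (hδ : δ ≤ 1) (hN : 0 < N) (hn : N * (a + b) ≤ n)
    (κ : Kernel (Cube d) (Fin p → ℝ)) [IsMarkovKernel κ]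
    {η : ι → Cube d × (Fin p → ℝ) → ℝ} (hη : ∀ i, Measurable (η i)) {V T : ℝ} (hV : 0 ≤ V)
    (hmgf : ∀ i a t, |t| ≤ T → ∫⁻ y, ENNReal.ofReal (Real.exp (t * η i (a, y))) ∂κ a ≤
      ENNReal.ofReal (Real.exp (V * t ^ 2)))
    (ν : Measure (Fin B → TreeSeed n a b)) [IsProbabilityMeasure ν]
    {c : ℝ} (hc0 : 0 ≤ c) (hc : c ≤ N * T) {K : ℝ} (hK0 : 0 ≤ K) (y : ℝ) :
    ((Measure.pi fun _ : Fin n => (volume : Measure (Cube d)) ⊗ₘ κ).prod ν)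
      {x | SampleGenPos x.1 ∧ Balanced δ (fun e => (x.2 e).1) ∧
        (∀ i j, |η i (x.1 j)| ≤ K) ∧
        ∃ u i, y + δ * K < |∑ j, forestWeight R k x.1 x.2 u j * η i (x.1 j)|} ≤
      (2 * Fintype.card ι * (N * (b * b) + 1) ^ d : ℕ) *
        ENNReal.ofReal (Real.exp (V * (c ^ 2 / N) - c * y)) := by
  have h1 := meas_ge_le_lintegral_div (ε := ENNReal.ofReal (Real.exp (c * y)))
    (μ := (Measure.pi fun _ : Fin n => (volume : Measure (Cube d)) ⊗ₘ κ).prod ν)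
    (measurable_noiseGauge (k := k) (N := N) R δ hη c).aemeasurable
    (by simpa using Real.exp_pos _) ENNReal.ofReal_ne_top
  refine (measure_mono ?_).trans (h1.trans ?_)
  · rintro ⟨D, t⟩ ⟨h1, h2, h3, u, i, h4⟩
    exact exp_le_noiseGauge hk hR hδ hN hn hc0 h1 h2 hK0 h3 h4
  · refine (ENNReal.div_le_div_right (lintegral_noiseGauge_le hk R κ δ hη hV hmgf ν hc0 hc hN)
      _).trans (le_of_eq ?_)
    rw [Real.exp_sub, ENNReal.ofReal_div_of_pos (Real.exp_pos _), mul_div_assoc]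

end ForestNoise

/-! ### The boxes of the nodes -/

section Boxes

variable {d b k : ℕ}

/-- The lower and upper corners of the hyperrectangle of a node. -/
def box (ℓ : Labels d) : List Bool → (Fin d → ℝ) × (Fin d → ℝ)
  | [] => (fun _ => 0, fun _ => 1)
  | c :: v =>
    -- Clamping the threshold to the parent's side keeps the corners ordered even if the cut misses
    -- the box.
    let θ := max ((box ℓ v).1 (ℓ v).1) (min ((box ℓ v).2 (ℓ v).1) (ℓ v).2)
    if c then ((box ℓ v).1, Function.update (box ℓ v).2 (ℓ v).1 θ)
    else (Function.update (box ℓ v).1 (ℓ v).1 θ, (box ℓ v).2)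

/-- The side lengths of the hyperrectangle of a node. -/
def side (ℓ : Labels d) (v : List Bool) (j : Fin d) : ℝ := (box ℓ v).2 j - (box ℓ v).1 j

theorem box_bounds (ℓ : Labels d) (v : List Bool) (j : Fin d) :
    0 ≤ (box ℓ v).1 j ∧ (box ℓ v).1 j ≤ (box ℓ v).2 j ∧ (box ℓ v).2 j ≤ 1 := by
  induction v generalizing j with
  | nil => simp [box]
  | cons c v ih =>
    obtain ⟨h1, h2, h3⟩ := ih j
    by_cases hj : j = (ℓ v).1
    · subst hj
      cases c
      · simp only [box, Bool.false_eq_true, if_false, Function.update_self]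
        exact ⟨h1.trans (le_max_left _ _), max_le h2 (min_le_left _ _), h3⟩
      · simp only [box, if_true, Function.update_self]
        exact ⟨h1, le_max_left _ _, max_le (h2.trans h3) ((min_le_left _ _).trans h3)⟩
    · cases c <;> simp [box, hj, h1, h2, h3]

theorem side_nonneg (ℓ : Labels d) (v : List Bool) (j : Fin d) : 0 ≤ side ℓ v j :=
  sub_nonneg.2 (box_bounds ℓ v j).2.1

theorem side_le_one (ℓ : Labels d) (v : List Bool) (j : Fin d) : side ℓ v j ≤ 1 := by
  have := box_bounds ℓ v j
  unfold side
  linarith [this.1, this.2.2]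

theorem side_cons_of_ne (ℓ : Labels d) (c : Bool) (v : List Bool) {j : Fin d} (hj : (ℓ v).1 ≠ j) :
    side ℓ (c :: v) j = side ℓ v j := by
  cases c <;> simp [side, box, hj.symm]

theorem side_children (ℓ : Labels d) (c : Bool) (v : List Bool) :
    side ℓ (c :: v) (ℓ v).1 + side ℓ ((!c) :: v) (ℓ v).1 = side ℓ v (ℓ v).1 := by
  cases c <;> simp [side, box]

theorem side_cons_le (ℓ : Labels d) (c : Bool) (v : List Bool) (j : Fin d) :
    side ℓ (c :: v) j ≤ side ℓ v j := by
  by_cases hj : (ℓ v).1 = j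
  · subst hj
    linarith [side_children ℓ c v, side_nonneg ℓ ((!c) :: v) (ℓ v).1]
  · exact (side_cons_of_ne ℓ c v hj).le

theorem mem_box_of_mem_cell {ℓ : Labels d} {v : List Bool} {u : Cube d} (hu : u ∈ cell ℓ v)
    (j : Fin d) : (box ℓ v).1 j ≤ u j ∧ (u j : ℝ) ≤ (box ℓ v).2 j := by
  induction v generalizing j with
  | nil => exact ⟨(u j).2.1, (u j).2.2⟩
  | cons c v ih =>
    have hv := ih hu.1
    by_cases hj : j = (ℓ v).1
    · subst hj
      obtain ⟨h1, h2⟩ := hv (ℓ v).1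
      have h3 := hu.2
      cases c
      · simp only [Bool.false_eq_true, false_iff, not_le] at h3
        simp only [box, Bool.false_eq_true, if_false, Function.update_self]
        exact ⟨max_le h1 ((min_le_right _ _).trans h3.le), h2⟩
      · simp only [true_iff] at h3
        simp only [box, if_true, Function.update_self]
        exact ⟨h1, le_max_of_le_right (le_min h2 h3)⟩
    · cases c <;> simpa [box, hj] using hv j

/-- The left child contains its threshold and the right child does not, so cells are half-open and
the inequality at the lower corner has to be strict. -/
theorem mem_cell_of_mem_box {ℓ : Labels d} {v : List Bool} {u : Cube d}
    (hu : ∀ j, (box ℓ v).1 j < u j ∧ (u j : ℝ) ≤ (box ℓ v).2 j) : u ∈ cell ℓ v := by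
  induction v with
  | nil => simp [cell]
  | cons c v ih =>
    have hb := box_bounds ℓ v (ℓ v).1
    have hju := hu (ℓ v).1
    cases c
    · simp only [box, Bool.false_eq_true, if_false, Function.update_self] at hju
      refine ⟨ih fun j => ?_, ?_⟩
      · by_cases hj : j = (ℓ v).1
        · subst hj
          exact ⟨(le_max_left _ _).trans_lt hju.1, hju.2⟩
        · simpa [box, hj] using hu j
      · simp only [Bool.false_eq_true, false_iff, not_le]
        have h1 := (le_max_right _ _).trans_lt hju.1
        rcases min_lt_iff.1 h1 with h | h
        · linarith [hju.2]
        · exact h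
    · simp only [box, if_true, Function.update_self] at hju
      have h1 : (u (ℓ v).1 : ℝ) ≤ min ((box ℓ v).2 (ℓ v).1) (ℓ v).2 := by
        rcases le_max_iff.1 hju.2 with h | h
        · linarith [hju.1]
        · exact h
      refine ⟨ih fun j => ?_, ?_⟩
      · by_cases hj : j = (ℓ v).1
        · subst hj
          exact ⟨hju.1, h1.trans (min_le_left _ _)⟩
        · simpa [box, hj] using hu j
      · simp only [true_iff]
        exact h1.trans (min_le_right _ _)

/-- The number of cuts along the feature `j` at the proper ancestors of a node. -/
def splitCount (ℓ : Labels d) (j : Fin d) : List Bool → ℕ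
  | [] => 0
  | _ :: v => splitCount ℓ j v + if (ℓ v).1 = j then 1 else 0

theorem dist_le_sum_side {ℓ : Labels d} {v : List Bool} {u u' : Cube d} (hu : u ∈ cell ℓ v)
    (hu' : u' ∈ cell ℓ v) : dist u u' ≤ ∑ j, side ℓ v j := by
  rw [dist_pi_le_iff (Finset.sum_nonneg fun j _ => side_nonneg ℓ v j)]
  intro j
  refine le_trans ?_ (Finset.single_le_sum (f := side ℓ v) (fun j _ => side_nonneg ℓ v j)
    (Finset.mem_univ j))
  obtain ⟨h1, h2⟩ := mem_box_of_mem_cell hu j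
  obtain ⟨h3, h4⟩ := mem_box_of_mem_cell hu' j
  rw [Subtype.dist_eq, Real.dist_eq, abs_le]
  unfold side
  constructor <;> linarith

/-! ### Regular designs -/

open Classical in
/-- The number of points in a set. -/
def pointCount (x : Fin b → Cube d) (S : Set (Cube d)) : ℕ :=
  (Finset.univ.filter fun i => x i ∈ S).card

theorem pointCount_mono (x : Fin b → Cube d) {S S' : Set (Cube d)} (h : S ⊆ S') :
    pointCount x S ≤ pointCount x S' := by
  classical
  unfold pointCount
  refine Finset.card_le_card fun i hi => ?_
  simp only [Finset.mem_filter, Finset.mem_univ, true_and] at hi ⊢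
  exact h hi

/-- A box with corners on the grid of mesh `1 / b`. -/
def gridBox (d b : ℕ) (lo hi : Fin d → ℕ) : Set (Cube d) :=
  {u | ∀ j, (lo j : ℝ) / b ≤ u j ∧ (u j : ℝ) ≤ hi j / b}

theorem measurableSet_gridBox (lo hi : Fin d → ℕ) : MeasurableSet (gridBox d b lo hi) := by
  unfold gridBox
  rw [Set.ofPred_forall]
  refine MeasurableSet.iInter fun j => ?_
  have h : Measurable fun u : Cube d => ((u j : unitInterval) : ℝ) :=
    measurable_subtype_coe.comp (measurable_pi_apply j)
  exact (measurableSet_le measurable_const h).inter (measurableSet_le h measurable_const)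

theorem volume_gridBox (hb : 0 < b) {lo hi : Fin d → ℕ} (h1 : ∀ j, lo j ≤ hi j)
    (h2 : ∀ j, hi j ≤ b) :
    (volume : Measure (Cube d)).real (gridBox d b lo hi) =
      ∏ j, ((hi j : ℝ) / b - (lo j : ℝ) / b) := by
  have hb' : (0 : ℝ) < b := by exact_mod_cast hb
  have hl : ∀ j, (lo j : ℝ) / b ∈ unitInterval := fun j => by
    refine ⟨by positivity, ?_⟩
    rw [div_le_one hb']
    exact_mod_cast (h1 j).trans (h2 j)
  have hh : ∀ j, (hi j : ℝ) / b ∈ unitInterval := fun j => by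
    refine ⟨by positivity, ?_⟩
    rw [div_le_one hb']
    exact_mod_cast h2 j
  have h3 : gridBox d b lo hi = Set.univ.pi fun j =>
      Set.Icc (⟨_, hl j⟩ : unitInterval) ⟨_, hh j⟩ := by
    ext u
    simp only [gridBox, Set.mem_ofPred_eq, Set.mem_pi, Set.mem_univ, true_implies, Set.mem_Icc,
      ← Subtype.coe_le_coe]
  rw [h3, measureReal_def, volume_pi, Measure.pi_pi, ENNReal.toReal_prod]
  refine Finset.prod_congr rfl fun j _ => ?_
  rw [unitInterval.volume_Icc, ENNReal.toReal_ofReal]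
  simp only [sub_nonneg]
  gcongr
  exact_mod_cast h1 j

/-- The numbers of points in grid boxes are close to their expectations. -/
def GoodDesign (K : ℝ) (x : Fin b → Cube d) : Prop :=
  ∀ lo hi : Fin d → Fin (b + 2),
    (K ≤ pointCount x (gridBox d b (fun j => lo j) fun j => hi j) →
      (pointCount x (gridBox d b (fun j => lo j) fun j => hi j) : ℝ) <
        16 / 15 * (b * (volume : Measure (Cube d)).real
          (gridBox d b (fun j => lo j) fun j => hi j))) ∧
    (K / 2 ≤ b * (volume : Measure (Cube d)).real (gridBox d b (fun j => lo j) fun j => hi j) →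
      14 / 15 * (b * (volume : Measure (Cube d)).real
          (gridBox d b (fun j => lo j) fun j => hi j)) <
      pointCount x (gridBox d b (fun j => lo j) fun j => hi j))

/-- Factors in [0,1] are exchanged one at a time, each exchange costing at most its own error. This
bounds the effect on a volume of rounding a box to the grid. -/
theorem prod_le_prod_add_sum {ι : Type*} (s : Finset ι) {f g e : ι → ℝ} (hf : ∀ i, 0 ≤ f i)
    (hf1 : ∀ i, f i ≤ 1) (hg : ∀ i, 0 ≤ g i) (hg1 : ∀ i, g i ≤ 1) (he : ∀ i, 0 ≤ e i)
    (h : ∀ i, f i ≤ g i + e i) : ∏ i ∈ s, f i ≤ ∏ i ∈ s, g i + ∑ i ∈ s, e i := by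
  classical
  induction s using Finset.induction_on with
  | empty => simp
  | insert i s hi ih =>
    rw [Finset.prod_insert hi, Finset.prod_insert hi, Finset.sum_insert hi]
    have h1 : (0 : ℝ) ≤ ∏ i ∈ s, g i := Finset.prod_nonneg fun j _ => hg j
    have h2 : ∏ i ∈ s, g i ≤ 1 := Finset.prod_le_one (fun j _ => hg j) fun j _ => hg1 j
    have h3 : 0 ≤ ∑ i ∈ s, e i := Finset.sum_nonneg fun j _ => he j
    calc f i * ∏ i ∈ s, f i ≤ f i * (∏ i ∈ s, g i + ∑ i ∈ s, e i) := by gcongr; exact hf i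
      _ = f i * ∏ i ∈ s, g i + f i * ∑ i ∈ s, e i := by ring
      _ ≤ (g i + e i) * ∏ i ∈ s, g i + 1 * ∑ i ∈ s, e i := by
          gcongr
          · exact h i
          · exact hf1 i
      _ ≤ _ := by nlinarith [he i]

/-- The volume of the hyperrectangle of a node. -/
def boxVolume (ℓ : Labels d) (v : List Bool) : ℝ := ∏ j, side ℓ v j

/-- The box is rounded outwards to the grid of mesh 1/b. Each side grows by at most 2/b, so b times
the volume grows by at most 2d. -/
theorem GoodDesign.nodeCount_le (hb : 0 < b) {K : ℝ} {x : Fin b → Cube d} (hx : GoodDesign K x)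
    {ℓ : Labels d} {v : List Bool} (hv : K ≤ nodeCount x ℓ v) :
    (nodeCount x ℓ v : ℝ) ≤ 16 / 15 * (b * boxVolume ℓ v + 2 * d) := by
  have hb' : (0 : ℝ) < b := by exact_mod_cast hb
  let lo : Fin d → ℕ := fun j => ⌊b * (box ℓ v).1 j⌋₊
  let hi : Fin d → ℕ := fun j => ⌈b * (box ℓ v).2 j⌉₊
  have hB := box_bounds ℓ v
  have hlohi : ∀ j, lo j ≤ hi j := fun j => by
    have h1 : (lo j : ℝ) ≤ b * (box ℓ v).1 j :=
      Nat.floor_le (mul_nonneg hb'.le (hB j).1)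
    have h2 : b * (box ℓ v).2 j ≤ (hi j : ℝ) := Nat.le_ceil _
    have h3 : (b : ℝ) * (box ℓ v).1 j ≤ b * (box ℓ v).2 j := by gcongr; exact (hB j).2.1
    exact_mod_cast h1.trans (h3.trans h2)
  have hhib : ∀ j, hi j ≤ b := fun j => by
    refine Nat.ceil_le.2 ?_
    calc (b : ℝ) * (box ℓ v).2 j ≤ b * 1 := by gcongr; exact (hB j).2.2
      _ = b := mul_one _
  have hlo2 : ∀ j, lo j < b + 2 := fun j => by have := hlohi j; have := hhib j; omega
  have hhi2 : ∀ j, hi j < b + 2 := fun j => by have := hhib j; omega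
  have hsub : cell ℓ v ⊆ gridBox d b lo hi := by
    intro u hu j
    obtain ⟨h1, h2⟩ := mem_box_of_mem_cell hu j
    rw [div_le_iff₀ hb', le_div_iff₀ hb', mul_comm (u j : ℝ)]
    constructor
    · refine (Nat.floor_le (mul_nonneg hb'.le (hB j).1)).trans ?_
      gcongr
    · refine le_trans ?_ (Nat.le_ceil _)
      gcongr
  have hcount : (nodeCount x ℓ v : ℝ) ≤ pointCount x (gridBox d b lo hi) := by
    exact_mod_cast pointCount_mono x hsub
  have := (hx (fun j => ⟨lo j, hlo2 j⟩) fun j => ⟨hi j, hhi2 j⟩).1 (hv.trans hcount)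
  refine hcount.trans (this.le.trans ?_)
  simp only
  rw [volume_gridBox hb hlohi hhib]
  gcongr
  have hf1 : ∀ j, (hi j : ℝ) / b - (lo j : ℝ) / b ≤ 1 := fun j => by
    have h1 : (hi j : ℝ) / b ≤ 1 := by
      rw [div_le_one hb']; exact_mod_cast hhib j
    have h2 : (0 : ℝ) ≤ (lo j : ℝ) / b := by positivity
    linarith
  have key := prod_le_prod_add_sum Finset.univ (f := fun j => (hi j : ℝ) / b - (lo j : ℝ) / b)
    (g := side ℓ v) (e := fun _ => 2 / b) (fun j => by
      simp only [sub_nonneg]; gcongr; exact_mod_cast hlohi j) hf1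
    (side_nonneg ℓ v) (side_le_one ℓ v) (fun _ => by positivity) (fun j => by
      have h1 : (hi j : ℝ) < b * (box ℓ v).2 j + 1 :=
        Nat.ceil_lt_add_one (mul_nonneg hb'.le ((hB j).1.trans (hB j).2.1))
      have h2 : (b : ℝ) * (box ℓ v).1 j < lo j + 1 := Nat.lt_floor_add_one _
      rw [← sub_div, div_le_iff₀ hb', add_mul, div_mul_cancel₀ _ hb'.ne']
      unfold side
      linarith)
  calc (b : ℝ) * ∏ j, ((hi j : ℝ) / b - (lo j : ℝ) / b)
      ≤ b * (∏ j, side ℓ v j + ∑ _j : Fin d, 2 / (b : ℝ)) := by gcongr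
    _ = b * boxVolume ℓ v + 2 * d := by
      simp [boxVolume]
      field_simp

/-- The box is rounded inwards, again at a cost of at most 2d in b times the volume; the assumed
size prevents the rounding from emptying it. -/
theorem GoodDesign.le_nodeCount (hb : 0 < b) {K : ℝ} (hK : 2 < K) {x : Fin b → Cube d}
    (hx : GoodDesign K x) {ℓ : Labels d} {v : List Bool}
    (hv : K / 2 + 2 * d ≤ b * boxVolume ℓ v) :
    14 / 15 * (b * boxVolume ℓ v - 2 * d) ≤ (nodeCount x ℓ v : ℝ) := by
  have hb' : (0 : ℝ) < b := by exact_mod_cast hb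
  -- The next grid point strictly above the corner, because cells may exclude their lower faces.
  let lo : Fin d → ℕ := fun j => ⌊b * (box ℓ v).1 j⌋₊ + 1
  let hi : Fin d → ℕ := fun j => ⌊b * (box ℓ v).2 j⌋₊
  have hB := box_bounds ℓ v
  have hlo' : ∀ j, (lo j : ℝ) ≤ b * (box ℓ v).1 j + 1 := fun j => by
    have := Nat.floor_le (mul_nonneg hb'.le (hB j).1)
    simp only [lo]
    push_cast
    linarith
  have hhi' : ∀ j, b * (box ℓ v).2 j < (hi j : ℝ) + 1 := fun j => Nat.lt_floor_add_one _
  -- Otherwise a side is at most 1/b, and b times the volume is at most 1 < K/2.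
  have hlohi : ∀ j, lo j ≤ hi j := fun j => by
    by_contra hcon
    have h1 : (hi j : ℝ) + 1 ≤ lo j := by
      push Not at hcon
      exact_mod_cast hcon
    have h2 : b * side ℓ v j ≤ 1 := by
      have := hlo' j
      have := hhi' j
      unfold side
      linarith
    have h3 : boxVolume ℓ v ≤ side ℓ v j := by
      unfold boxVolume
      rw [← Finset.mul_prod_erase _ _ (Finset.mem_univ j)]
      exact mul_le_of_le_one_right (side_nonneg ℓ v j)
        (Finset.prod_le_one (fun i _ => side_nonneg ℓ v i) fun i _ => side_le_one ℓ v i)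
    have h4 : b * boxVolume ℓ v ≤ b * side ℓ v j := by gcongr
    have h5 : (0 : ℝ) ≤ d := by positivity
    linarith
  have hhib : ∀ j, hi j ≤ b := fun j => by
    have h1 : (hi j : ℝ) ≤ b * (box ℓ v).2 j :=
      Nat.floor_le (mul_nonneg hb'.le ((hB j).1.trans (hB j).2.1))
    have h2 : (b : ℝ) * (box ℓ v).2 j ≤ b * 1 := by gcongr; exact (hB j).2.2
    have : (hi j : ℝ) ≤ b := by linarith
    exact_mod_cast this
  have hlo2 : ∀ j, lo j < b + 2 := fun j => by have := hlohi j; have := hhib j; omega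
  have hhi2 : ∀ j, hi j < b + 2 := fun j => by have := hhib j; omega
  have hsub : gridBox d b lo hi ⊆ cell ℓ v := by
    intro u hu
    refine mem_cell_of_mem_box fun j => ?_
    obtain ⟨h1, h2⟩ := hu j
    rw [div_le_iff₀ hb'] at h1
    rw [le_div_iff₀ hb'] at h2
    have h3 : (b : ℝ) * (box ℓ v).1 j < lo j := by
      simp only [lo]
      push_cast
      exact Nat.lt_floor_add_one _
    have h4 : (hi j : ℝ) ≤ b * (box ℓ v).2 j :=
      Nat.floor_le (mul_nonneg hb'.le ((hB j).1.trans (hB j).2.1))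
    constructor
    · nlinarith
    · nlinarith
  have hcount : (pointCount x (gridBox d b lo hi) : ℝ) ≤ nodeCount x ℓ v := by
    exact_mod_cast pointCount_mono x hsub
  have hf1 : ∀ j, (hi j : ℝ) / b - (lo j : ℝ) / b ≤ 1 := fun j => by
    have h1 : (hi j : ℝ) / b ≤ 1 := by
      rw [div_le_one hb']; exact_mod_cast hhib j
    have h2 : (0 : ℝ) ≤ (lo j : ℝ) / b := by positivity
    linarith
  have key := prod_le_prod_add_sum Finset.univ (g := fun j => (hi j : ℝ) / b - (lo j : ℝ) / b)
    (f := side ℓ v) (e := fun _ => 2 / b) (side_nonneg ℓ v) (side_le_one ℓ v) (fun j => by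
      simp only [sub_nonneg]; gcongr; exact_mod_cast hlohi j) hf1
     (fun _ => by positivity) (fun j => by
      have h1 := hlo' j
      have h2 := hhi' j
      rw [← sub_div, ← add_div, le_div_iff₀ hb']
      unfold side
      linarith)
  have hvol : b * boxVolume ℓ v - 2 * d ≤
      b * (volume : Measure (Cube d)).real (gridBox d b lo hi) := by
    rw [volume_gridBox hb hlohi hhib]
    have : (b : ℝ) * boxVolume ℓ v ≤ b * (∏ j, ((hi j : ℝ) / b - (lo j : ℝ) / b) +
        ∑ _j : Fin d, 2 / (b : ℝ)) := by
      unfold boxVolume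
      gcongr
    rw [mul_add] at this
    have h2 : (b : ℝ) * ∑ _j : Fin d, 2 / (b : ℝ) = 2 * d := by
      simp
      field_simp
    linarith
  have := (hx (fun j => ⟨lo j, hlo2 j⟩) fun j => ⟨hi j, hhi2 j⟩).2 (by
    simp only
    linarith)
  simp only at this
  linarith

/-- Regular cuts shorten the sides by a factor. -/
theorem GoodDesign.side_cons_ge (hd : 1 ≤ d) (hb : 0 < b) {K : ℝ} (hK : 100 * (d : ℝ) ≤ K)
    {x : Fin b → Cube d} (hx : GoodDesign K x) {ω : ℝ} (hω : 0 ≤ ω)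
    {ℓ : Labels d} {v : List Bool} (c : Bool) (hv : K ≤ nodeCount x ℓ v)
    (hcv : K ≤ nodeCount x ℓ (c :: v))
    (hreg : ω * (nodeCount x ℓ v : ℝ) ≤ nodeCount x ℓ (c :: v)) :
    4 / 5 * ω * side ℓ v (ℓ v).1 ≤ side ℓ (c :: v) (ℓ v).1 := by
  have hb' : (0 : ℝ) < b := by exact_mod_cast hb
  have hd' : (1 : ℝ) ≤ d := by exact_mod_cast hd
  set j := (ℓ v).1 with hj
  let P : ℝ := ∏ i ∈ Finset.univ.erase j, side ℓ v i
  have hV : boxVolume ℓ v = side ℓ v j * P := by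
    unfold boxVolume
    rw [← Finset.mul_prod_erase _ _ (Finset.mem_univ j)]
  have hV' : boxVolume ℓ (c :: v) = side ℓ (c :: v) j * P := by
    unfold boxVolume
    rw [← Finset.mul_prod_erase _ _ (Finset.mem_univ j)]
    congr 1
    refine Finset.prod_congr rfl fun i hi => ?_
    exact side_cons_of_ne ℓ c v (Finset.ne_of_mem_erase hi).symm
  have hP0 : 0 ≤ P := Finset.prod_nonneg fun i _ => side_nonneg ℓ v i
  have h1 := hx.nodeCount_le hb hcv
  have hle : boxVolume ℓ (c :: v) ≤ boxVolume ℓ v := by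
    rw [hV, hV']
    gcongr
    exact side_cons_le ℓ c v j
  set W := b * boxVolume ℓ v with hW
  set W' := b * boxVolume ℓ (c :: v) with hW'
  have hWW : W' ≤ W := by rw [hW, hW']; gcongr
  -- The child holds at least 100d points, so W' ≥ 15/16 · 100d - 2d. The rounding error 2d is then
  -- at most one thirtieth of W' and of W.
  have h60 : 60 * (d : ℝ) ≤ W' := by linarith
  have hcount : 14 / 15 * (29 / 30) * W ≤ nodeCount x ℓ v := by
    by_cases hcase : K / 2 + 2 * d ≤ W
    · have := hx.le_nodeCount hb (by linarith) hcase
      refine le_trans ?_ this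
      rw [← hW]
      linarith
    · push Not at hcase
      linarith [hv]
  have h3 : ω * (14 / 15 * (29 / 30) * W) ≤ ω * (nodeCount x ℓ v : ℝ) := by gcongr
  -- The constants combine to (14 · 29)/(16 · 31), which exceeds 4/5.
  have h4 : 4 / 5 * ω * W ≤ W' := by
    have : 0 ≤ ω * W := mul_nonneg hω (by linarith)
    nlinarith
  have hPpos : 0 < b * P := by
    rcases hP0.lt_or_eq with h | h
    · positivity
    · exfalso
      rw [hV', ← h] at hW'
      simp only [mul_zero] at hW'
      linarith
  have h5 : (4 / 5 * ω * side ℓ v j) * (b * P) ≤ side ℓ (c :: v) j * (b * P) := by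
    rw [hW, hW', hV, hV'] at h4
    linarith
  exact le_of_mul_le_mul_right h5 hPpos

/-- A cut shortens the child on the path because its sibling is not too short: the lower bound is
applied to the sibling, and the two sides add up to the parent's. All nodes down to depth `H` hold
the `K` points this requires. -/
theorem GoodDesign.side_path_le (hd : 1 ≤ d) (hb : 0 < b) {K : ℝ} (hK : 100 * (d : ℝ) ≤ K)
    (hkK : 2 * (k : ℝ) ≤ K) {x : Fin b → Cube d} (hx : GoodDesign K x) {ω : ℝ} (hω : 0 ≤ ω)
    (hω1 : ω ≤ 1) {ℓ : Labels d} (hT : GoodTree k ω x ℓ) {H : ℕ} (hH : K ≤ ω ^ H * b)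
    (u : Cube d) (j : Fin d) {h : ℕ} (hh : h ≤ H) :
    side ℓ (path ℓ u h) j ≤ (1 - 4 / 5 * ω) ^ splitCount ℓ j (path ℓ u h) := by
  have hcount : ∀ v : List Bool, v.length ≤ H → K ≤ nodeCount x ℓ v := by
    intro v hv
    refine le_trans ?_ (hT.pow_mul_le hω hω1 (hkK.trans hH) v hv)
    refine hH.trans ?_
    gcongr ?_ * _
    exact pow_le_pow_of_le_one hω hω1 hv
  have hρ : 0 ≤ 1 - 4 / 5 * ω := by linarith
  induction h with
  | zero => simpa [path, splitCount] using side_le_one ℓ [] j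
  | succ h ih =>
    have ih' := ih (by omega)
    simp only [path]
    set c := decide (((u (ℓ (path ℓ u h)).1 : unitInterval) : ℝ) ≤ (ℓ (path ℓ u h)).2) with hc
    set v := path ℓ u h with hv
    have hlen : v.length = h := length_path ℓ u h
    simp only [splitCount]
    by_cases hj : (ℓ v).1 = j
    · have h1 : 4 / 5 * ω * side ℓ v (ℓ v).1 ≤ side ℓ ((!c) :: v) (ℓ v).1 := by
        refine hx.side_cons_ge hd hb hK hω (!c) (hcount v (by omega))
          (hcount _ (by simp [hlen]; omega)) ?_
        refine hT.regular v ?_ (!c)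
        have := hkK.trans (hcount v (by omega))
        unfold IsInternal
        exact_mod_cast this
      have h2 := side_children ℓ c v
      rw [hj] at h1 h2
      rw [if_pos hj, pow_succ]
      calc side ℓ (c :: v) j ≤ side ℓ v j * (1 - 4 / 5 * ω) := by linarith
        _ ≤ _ := by gcongr
    · rw [if_neg hj, add_zero, side_cons_of_ne ℓ c v hj]
      exact ih'

end Boxes

/-! ### Random designs are regular -/

section RandomDesign

variable {d b : ℕ}

open Classical in
theorem pointCount_eq_sum (x : Fin b → Cube d) (S : Set (Cube d)) :
    (pointCount x S : ℝ) = ∑ i, S.indicator (fun _ => (1 : ℝ)) (x i) := by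
  simp [pointCount, Set.indicator_apply]

theorem measurable_pointCount {S : Set (Cube d)} (hS : MeasurableSet S) :
    Measurable fun x : Fin b → Cube d => (pointCount x S : ℝ) := by
  simp only [pointCount_eq_sum]
  exact Finset.measurable_sum _ fun i _ =>
    (measurable_const.indicator hS).comp (measurable_pi_apply i)

/-- A binomial generating function is at most that of the Poisson law with the same mean, by 1 + x ≤
e^x. -/
theorem mgf_pointCount_le {S : Set (Cube d)} (hS : MeasurableSet S) (t : ℝ) :
    mgf (fun x : Fin b → Cube d => (pointCount x S : ℝ)) volume t ≤
      Real.exp (b * (volume : Measure (Cube d)).real S * (Real.exp t - 1)) := by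
  unfold mgf
  have h1 : ∀ x : Fin b → Cube d, Real.exp (t * (pointCount x S : ℝ)) =
      ∏ i, Real.exp (t * S.indicator (fun _ => (1 : ℝ)) (x i)) := by
    intro x
    rw [pointCount_eq_sum, Finset.mul_sum, Real.exp_sum]
  simp only [h1]
  rw [integral_fintype_prod_volume_eq_prod
    (fun (_ : Fin b) (y : Cube d) => Real.exp (t * S.indicator (fun _ => (1 : ℝ)) y))]
  have h2 : ∀ y : Cube d, Real.exp (t * S.indicator (fun _ => (1 : ℝ)) y) =
      1 + S.indicator (fun _ => Real.exp t - 1) y := by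
    intro y
    by_cases hy : y ∈ S <;> simp [hy]
  have h3 : ∫ y : Cube d, Real.exp (t * S.indicator (fun _ => (1 : ℝ)) y) =
      1 + (volume : Measure (Cube d)).real S * (Real.exp t - 1) := by
    simp only [h2]
    rw [integral_add (integrable_const _) ((integrable_const _).indicator hS),
      integral_indicator_const _ hS]
    simp
  rw [Finset.prod_const, Finset.card_univ, Fintype.card_fin, h3, mul_assoc, Real.exp_nat_mul]
  refine pow_le_pow_left₀ ?_ ?_ b
  · rw [← h3]
    exact integral_nonneg fun y => (Real.exp_pos _).le
  · rw [add_comm]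
    exact Real.add_one_le_exp _

theorem integrable_exp_pointCount {S : Set (Cube d)} (hS : MeasurableSet S) (t : ℝ) :
    Integrable (fun x : Fin b → Cube d => Real.exp (t * (pointCount x S : ℝ))) volume := by
  refine Integrable.of_bound
    ((measurable_pointCount hS).const_mul t).exp.aestronglyMeasurable (Real.exp (|t| * b))
    (Eventually.of_forall fun x => ?_)
  rw [Real.norm_eq_abs, abs_of_pos (Real.exp_pos _), Real.exp_le_exp]
  have h1 : (pointCount x S : ℝ) ≤ b := by
    classical
    have : pointCount x S ≤ b := (Finset.card_filter_le _ _).trans (by simp)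
    exact_mod_cast this
  calc t * (pointCount x S : ℝ) ≤ |t| * (pointCount x S : ℝ) := by gcongr; exact le_abs_self t
    _ ≤ |t| * b := by gcongr

/-- Both requirements together say that the count reaches the larger of the two levels, so
Chernoff's bound at exponent 1/30 decays in `K` even for boxes of tiny volume. Such boxes matter,
since a node is known only to contain many points. -/
theorem measure_le_pointCount_le {S : Set (Cube d)} (hS : MeasurableSet S) {K : ℝ} :
    (volume : Measure (Fin b → Cube d)).real {x | K ≤ pointCount x S ∧
        16 / 15 * (b * (volume : Measure (Cube d)).real S) ≤ pointCount x S} ≤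
      Real.exp (-(K / 1800)) := by
  set lam := (b : ℝ) * (volume : Measure (Cube d)).real S with hlam
  have hlam0 : 0 ≤ lam := by positivity
  set M := max K (16 / 15 * lam) with hM
  have h1 : {x : Fin b → Cube d | K ≤ pointCount x S ∧ 16 / 15 * lam ≤ pointCount x S} =
      {x | M ≤ (pointCount x S : ℝ)} := by
    ext x
    simp [hM]
  rw [h1]
  have h2 := measure_ge_le_exp_mul_mgf (μ := (volume : Measure (Fin b → Cube d))) M
    (t := 1 / 30) (by norm_num) (integrable_exp_pointCount hS (1 / 30))
  refine h2.trans ?_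
  refine (mul_le_mul_of_nonneg_left (mgf_pointCount_le hS _) (Real.exp_pos _).le).trans ?_
  rw [← Real.exp_add, Real.exp_le_exp, ← hlam]
  have h3 : |Real.exp (1 / 30) - 1 - 1 / 30| ≤ (1 / 30 : ℝ) ^ 2 :=
    Real.abs_exp_sub_one_sub_id_le (by rw [abs_of_pos] <;> norm_num)
  have h4 := (abs_le.1 h3).2
  have h5 : K ≤ M := le_max_left _ _
  have h6 : 16 / 15 * lam ≤ M := le_max_right _ _
  have h7 : lam * (Real.exp (1 / 30) - 1) ≤ lam * (1 / 30 + (1 / 30) ^ 2) := by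
    gcongr
    linarith
  have hM0 : 0 ≤ M := le_trans (by positivity) h6
  nlinarith

theorem measure_pointCount_le_le {S : Set (Cube d)} (hS : MeasurableSet S) {K : ℝ}
    (hK : K / 2 ≤ b * (volume : Measure (Cube d)).real S) :
    (volume : Measure (Fin b → Cube d)).real {x | (pointCount x S : ℝ) ≤
        14 / 15 * (b * (volume : Measure (Cube d)).real S)} ≤
      Real.exp (-(K / 1800)) := by
  set lam := (b : ℝ) * (volume : Measure (Cube d)).real S with hlam
  have hlam0 : 0 ≤ lam := by positivity
  have h2 := measure_le_le_exp_mul_mgf (μ := (volume : Measure (Fin b → Cube d))) (14 / 15 * lam)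
    (t := -(1 / 30)) (by norm_num) (integrable_exp_pointCount hS (-(1 / 30)))
  refine h2.trans ?_
  refine (mul_le_mul_of_nonneg_left (mgf_pointCount_le hS _) (Real.exp_pos _).le).trans ?_
  rw [← Real.exp_add, Real.exp_le_exp, ← hlam]
  have h3 : |Real.exp (-(1 / 30)) - 1 - -(1 / 30)| ≤ (-(1 / 30) : ℝ) ^ 2 :=
    Real.abs_exp_sub_one_sub_id_le (by rw [abs_neg, abs_of_pos] <;> norm_num)
  have h4 := (abs_le.1 h3).2
  have h7 : lam * (Real.exp (-(1 / 30)) - 1) ≤ lam * (-(1 / 30) + (1 / 30) ^ 2) := by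
    gcongr
    linarith
  -- The exponent is at most -λ/900, and λ ≥ K/2 makes this -K/1800.
  nlinarith

/-- A union bound over two tails for each of the (b+2)^(2d) pairs of corners; the exponential wins
once `K` is a power of `b`. -/
theorem measure_not_goodDesign_le (K : ℝ) :
    (volume : Measure (Fin b → Cube d)) {x | ¬ GoodDesign K x} ≤
      ENNReal.ofReal (2 * ((b : ℝ) + 2) ^ (2 * d) * Real.exp (-(K / 1800))) := by
  have hE := (Real.exp_pos (-(K / 1800))).le
  let Q : (Fin d → Fin (b + 2)) × (Fin d → Fin (b + 2)) → Set (Cube d) := fun q =>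
    gridBox d b (fun j => q.1 j) fun j => q.2 j
  have hQ : ∀ q, MeasurableSet (Q q) := fun q => measurableSet_gridBox _ _
  let A : (Fin d → Fin (b + 2)) × (Fin d → Fin (b + 2)) → Set (Fin b → Cube d) := fun q =>
    {x | K ≤ pointCount x (Q q) ∧
        16 / 15 * (b * (volume : Measure (Cube d)).real (Q q)) ≤ pointCount x (Q q)} ∪
    {x | K / 2 ≤ b * (volume : Measure (Cube d)).real (Q q) ∧ (pointCount x (Q q) : ℝ) ≤
        14 / 15 * (b * (volume : Measure (Cube d)).real (Q q))}
  have hsub : {x : Fin b → Cube d | ¬ GoodDesign K x} ⊆ ⋃ q, A q := by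
    intro x hx
    by_contra hcon
    simp only [A, Set.mem_iUnion, Set.mem_union, Set.mem_ofPred_eq, not_exists, not_or, not_and,
      not_le] at hcon
    exact hx fun lo hi => hcon (lo, hi)
  have hA : ∀ q, volume (A q) ≤ ENNReal.ofReal (2 * Real.exp (-(K / 1800))) := by
    intro q
    refine (measure_union_le _ _).trans ?_
    rw [two_mul, ENNReal.ofReal_add hE hE]
    refine add_le_add ?_ ?_
    · rw [← ofReal_measureReal]
      exact ENNReal.ofReal_le_ofReal (measure_le_pointCount_le (hQ q))
    · by_cases hK : K / 2 ≤ b * (volume : Measure (Cube d)).real (Q q)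
      · simp only [hK, true_and]
        rw [← ofReal_measureReal]
        exact ENNReal.ofReal_le_ofReal (measure_pointCount_le_le (hQ q) hK)
      · simp [hK]
  refine (measure_mono hsub).trans ((measure_iUnion_le _).trans ?_)
  rw [tsum_fintype]
  refine (Finset.sum_le_sum fun q _ => hA q).trans (le_of_eq ?_)
  rw [Finset.sum_const, Finset.card_univ, nsmul_eq_mul, ← ENNReal.ofReal_natCast,
    ← ENNReal.ofReal_mul (by positivity)]
  congr 1
  simp only [Fintype.card_prod, Fintype.card_pi, Fintype.card_fin, Finset.prod_const,
    Finset.card_univ]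
  push_cast
  ring

end RandomDesign

/-! ### The expected number of cuts along a feature -/

section ExpectedCuts

variable {d p a b k : ℕ}

/-- A cell is decided by the cuts at the proper ancestors alone, which is what the random-split
condition demands of a conditioning event. -/
theorem cell_congr {ℓ ℓ' : Labels d} {v : List Bool} (h : ∀ w, w <:+ v → w ≠ v → ℓ w = ℓ' w) :
    cell ℓ v = cell ℓ' v := by
  induction v with
  | nil => rfl
  | cons c v ih =>
    have h1 : ℓ v = ℓ' v := h v (List.suffix_cons c v) (by simp)
    have h2 := ih fun w hw hne => h w (hw.trans (List.suffix_cons c v)) (by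
      rintro rfl
      have := hw.length_le
      simp at this)
    simp only [cell, h1, h2]

theorem splitCount_congr {ℓ ℓ' : Labels d} {v : List Bool} (j : Fin d)
    (h : ∀ w, w <:+ v → w ≠ v → ℓ w = ℓ' w) : splitCount ℓ j v = splitCount ℓ' j v := by
  induction v with
  | nil => rfl
  | cons c v ih =>
    have h1 : ℓ v = ℓ' v := h v (List.suffix_cons c v) (by simp)
    have h2 := ih fun w hw hne => h w (hw.trans (List.suffix_cons c v)) (by
      rintro rfl
      have := hw.length_le
      simp at this)
    simp only [splitCount, h1, h2]

theorem measurable_splitCount {Ω : Type*} [MeasurableSpace Ω] {L : Ω → Labels d}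
    (hL : Measurable L) (j : Fin d) (v : List Bool) :
    Measurable fun w => splitCount (L w) j v := by
  induction v with
  | nil => exact measurable_const
  | cons c v ih =>
    simp only [splitCount]
    refine ih.add (Measurable.ite ?_ measurable_const measurable_const)
    exact (measurable_fst.comp ((measurable_pi_apply v).comp hL)) (measurableSet_singleton j)

theorem splitCount_le_length (ℓ : Labels d) (j : Fin d) (v : List Bool) :
    splitCount ℓ j v ≤ v.length := by
  induction v with
  | nil => simp [splitCount]
  | cons c v ih =>
    simp only [splitCount, List.length_cons]
    split_ifs <;> omega

open Classical in
/-- A function of the node that contains `u`, as a sum over all nodes of the same depth. -/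
theorem splitCount_path_eq_sum (ℓ : Labels d) (u : Cube d) (j : Fin d) (h : ℕ) (ρ : ℝ)
    (g : List Bool → ℝ) :
    ρ ^ splitCount ℓ j (path ℓ u h) * g (path ℓ u h) =
      ∑ v : Fin h → Bool, ∑ m ∈ Finset.range (h + 1),
        (if u ∈ cell ℓ (List.ofFn v) ∧ splitCount ℓ j (List.ofFn v) = m then ρ ^ m else 0) *
          g (List.ofFn v) := by
  let v₀ : Fin h → Bool := fun i => (path ℓ u h).get (i.cast (length_path ℓ u h).symm)
  have hv₀ : List.ofFn v₀ = path ℓ u h := by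
    apply List.ext_get
    · simp
    · intro n h1 h2
      simp [v₀]
  rw [Finset.sum_eq_single v₀, Finset.sum_eq_single (splitCount ℓ j (path ℓ u h))]
  · rw [hv₀, if_pos ⟨mem_cell_path ℓ u h, rfl⟩]
  · intro m _ hm
    rw [hv₀, if_neg fun h => hm h.2.symm, zero_mul]
  · intro hm
    exfalso
    refine hm (Finset.mem_range.2 (Nat.lt_succ_of_le ?_))
    simpa using splitCount_le_length ℓ j (path ℓ u h)
  · intro v _ hv
    refine Finset.sum_eq_zero fun m _ => ?_
    rw [if_neg, zero_mul]
    rintro ⟨h1, -⟩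
    rw [mem_cell_iff, List.length_ofFn] at h1
    exact hv (List.ofFn_injective (h1.symm.trans hv₀.symm))
  · simp

theorem measurable_path_pow {Ω : Type*} [MeasurableSpace Ω] {L : Ω → Labels d}
    (hL : Measurable L) {X : Ω → Cube d} (hX : Measurable X) (j : Fin d) (h : ℕ) (ρ : ℝ) :
    Measurable fun w => ρ ^ splitCount (L w) j (path (L w) (X w) h) := by
  classical
  have h1 : ∀ w, ρ ^ splitCount (L w) j (path (L w) (X w) h) = _ := fun w =>
    (mul_one _).symm.trans (splitCount_path_eq_sum (L w) (X w) j h ρ fun _ => 1)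
  simp only [h1]
  refine Finset.measurable_sum _ fun v _ => Finset.measurable_sum _ fun m _ =>
    Measurable.mul_const (Measurable.ite (MeasurableSet.inter ?_ ?_) measurable_const
      measurable_const) _
  · exact measurableSet_mem_cell hL hX _
  · exact (measurable_splitCount hL j _) (measurableSet_singleton m)

/-- One level down, the power is multiplied by `ρ` if the current node of `u` is cut along `j`,
which given the past has probability at least π/d. Each level therefore contributes a factor 1 - (1
- ρ)π/d in mean. The past is decomposed into the events that the node of `u` is `v` and has `m` cuts
along `j` above it, which depend on the ancestors of `v` only. -/
theorem TreeRule.IsRegular.integral_path_pow_le {R : TreeRule d p a b} {ω π : ℝ}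
    (hR : R.IsRegular k ω π) (hπ : 0 ≤ π) {z : Fin a → Cube d × (Fin p → ℝ)}
    {x : Fin b → Cube d} (hzx : GenPos z x) {H : ℕ}
    (hint : ∀ ξ v, v.length < H → IsInternal k x (R.grow z x ξ) v)
    (u : Cube d) (j : Fin d) {ρ : ℝ} (hρ : 0 ≤ ρ) (hρ1 : ρ ≤ 1)
    (hπd : 0 ≤ 1 - (1 - ρ) * (π / d)) {h : ℕ} (hh : h ≤ H) :
    ∫ ξ, ρ ^ splitCount (R.grow z x ξ) j (path (R.grow z x ξ) u h) ≤
      (1 - (1 - ρ) * (π / d)) ^ h := by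
  classical
  have hL : Measurable fun ξ => R.grow z x ξ :=
    R.measurable_grow.comp (f := fun ξ => (z, x, ξ)) (by fun_prop)
  have hbdd : ∀ h, Integrable fun ξ =>
      ρ ^ splitCount (R.grow z x ξ) j (path (R.grow z x ξ) u h) := fun h =>
    Integrable.of_bound (measurable_path_pow hL measurable_const j h ρ).aestronglyMeasurable 1
      (Eventually.of_forall fun ξ => by
        rw [Real.norm_eq_abs, abs_of_nonneg (by positivity)]
        exact pow_le_one₀ hρ hρ1)
  induction h with
  | zero => simp [path, splitCount]
  | succ h ih =>
    have ih' := ih (by omega)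
    -- the events given by the cuts at the ancestors
    let A : (Fin h → Bool) → ℕ → Set (Labels d) := fun v m =>
      {ℓ | u ∈ cell ℓ (List.ofFn v) ∧ splitCount ℓ j (List.ofFn v) = m}
    have hA : ∀ v m, MeasurableSet (A v m) := fun v m =>
      (measurableSet_mem_cell measurable_id measurable_const _).inter
        ((measurable_splitCount measurable_id j _) (measurableSet_singleton m))
    have hfeat : ∀ v : Fin h → Bool, MeasurableSet {ξ | (R.grow z x ξ (List.ofFn v)).1 = j} :=
      fun v => (measurable_fst.comp ((measurable_pi_apply _).comp hL)) (measurableSet_singleton j)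
    have hsplit : ∀ v m, π / d * (volume : Measure unitInterval).real {ξ | R.grow z x ξ ∈ A v m} ≤
        (volume : Measure unitInterval).real
          {ξ | R.grow z x ξ ∈ A v m ∧ (R.grow z x ξ (List.ofFn v)).1 = j} := by
      intro v m
      have h1 := hR.random_split z x hzx (List.ofFn v) j (A v m) (hA v m) (by
        intro ℓ ℓ' hℓ
        simp only [A, Set.mem_ofPred_eq, cell_congr hℓ, splitCount_congr j hℓ])
      have h2 : ∀ ξ, IsInternal k x (R.grow z x ξ) (List.ofFn v) := fun ξ =>
        hint ξ _ (by simp; omega)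
      simp only [h2, and_true, true_and] at h1
      have h3 := ENNReal.toReal_mono (measure_ne_top _ _) h1
      rwa [ENNReal.toReal_mul, ENNReal.toReal_ofReal (by positivity)] at h3
    let G : unitInterval → ℝ := fun ξ => ρ ^ splitCount (R.grow z x ξ) j (path (R.grow z x ξ) u h)
    let G' : unitInterval → ℝ := fun ξ => G ξ *
      if (R.grow z x ξ (path (R.grow z x ξ) u h)).1 = j then 1 else 0
    have hstep : ∀ ξ, ρ ^ splitCount (R.grow z x ξ) j (path (R.grow z x ξ) u (h + 1)) =
        G ξ - (1 - ρ) * G' ξ := by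
      intro ξ
      simp only [G, G', path, splitCount]
      split_ifs
      · rw [pow_succ]; ring
      · simp
    have hGsum : ∀ ξ, G ξ = ∑ v : Fin h → Bool, ∑ m ∈ Finset.range (h + 1),
        {ξ | R.grow z x ξ ∈ A v m}.indicator (fun _ => ρ ^ m) ξ := by
      intro ξ
      have := splitCount_path_eq_sum (R.grow z x ξ) u j h ρ fun _ => 1
      simp only [mul_one] at this
      simp only [G, this]
      refine Finset.sum_congr rfl fun v _ => Finset.sum_congr rfl fun m _ => ?_
      simp only [Set.indicator_apply, A, Set.mem_ofPred_eq]
    have hG'sum : ∀ ξ, G' ξ = ∑ v : Fin h → Bool, ∑ m ∈ Finset.range (h + 1),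
        {ξ | R.grow z x ξ ∈ A v m ∧ (R.grow z x ξ (List.ofFn v)).1 = j}.indicator
          (fun _ => ρ ^ m) ξ := by
      intro ξ
      have := splitCount_path_eq_sum (R.grow z x ξ) u j h ρ
        fun v => if (R.grow z x ξ v).1 = j then 1 else 0
      simp only [G', G, this]
      refine Finset.sum_congr rfl fun v _ => Finset.sum_congr rfl fun m _ => ?_
      simp only [Set.indicator_apply, A, Set.mem_ofPred_eq]
      by_cases h1 : u ∈ cell (R.grow z x ξ) (List.ofFn v) ∧
          splitCount (R.grow z x ξ) j (List.ofFn v) = m <;>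
        by_cases h2 : (R.grow z x ξ (List.ofFn v)).1 = j <;> simp [h1, h2]
    have hm1 : ∀ v m, MeasurableSet {ξ | R.grow z x ξ ∈ A v m} := fun v m => hL (hA v m)
    have hm2 : ∀ v m, MeasurableSet
        {ξ | R.grow z x ξ ∈ A v m ∧ (R.grow z x ξ (List.ofFn v)).1 = j} := fun v m =>
      (hm1 v m).inter (hfeat v)
    have hGint : ∫ ξ, G ξ = ∑ v : Fin h → Bool, ∑ m ∈ Finset.range (h + 1),
        (volume : Measure unitInterval).real {ξ | R.grow z x ξ ∈ A v m} * ρ ^ m := by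
      simp only [hGsum]
      rw [integral_finsetSum _ fun v _ => integrable_finsetSum _ fun m _ =>
        (integrable_const _).indicator (hm1 v m)]
      refine Finset.sum_congr rfl fun v _ => ?_
      rw [integral_finsetSum _ fun m _ => (integrable_const _).indicator (hm1 v m)]
      refine Finset.sum_congr rfl fun m _ => ?_
      rw [integral_indicator_const _ (hm1 v m), smul_eq_mul]
    have hG'int : ∫ ξ, G' ξ = ∑ v : Fin h → Bool, ∑ m ∈ Finset.range (h + 1),
        (volume : Measure unitInterval).real
          {ξ | R.grow z x ξ ∈ A v m ∧ (R.grow z x ξ (List.ofFn v)).1 = j} * ρ ^ m := by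
      simp only [hG'sum]
      rw [integral_finsetSum _ fun v _ => integrable_finsetSum _ fun m _ =>
        (integrable_const _).indicator (hm2 v m)]
      refine Finset.sum_congr rfl fun v _ => ?_
      rw [integral_finsetSum _ fun m _ => (integrable_const _).indicator (hm2 v m)]
      refine Finset.sum_congr rfl fun m _ => ?_
      rw [integral_indicator_const _ (hm2 v m), smul_eq_mul]
    have hGG' : π / d * ∫ ξ, G ξ ≤ ∫ ξ, G' ξ := by
      rw [hGint, hG'int, Finset.mul_sum]
      refine Finset.sum_le_sum fun v _ => ?_
      rw [Finset.mul_sum]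
      refine Finset.sum_le_sum fun m _ => ?_
      rw [← mul_assoc]
      exact mul_le_mul_of_nonneg_right (hsplit v m) (by positivity)
    have hG'i : Integrable G' := by
      have : G' = fun ξ => ∑ v : Fin h → Bool, ∑ m ∈ Finset.range (h + 1),
        {ξ | R.grow z x ξ ∈ A v m ∧ (R.grow z x ξ (List.ofFn v)).1 = j}.indicator
          (fun _ => ρ ^ m) ξ := funext hG'sum
      rw [this]
      exact integrable_finsetSum _ fun v _ => integrable_finsetSum _ fun m _ =>
        (integrable_const _).indicator (hm2 v m)
    simp only [hstep]
    rw [integral_sub (hbdd h) (hG'i.const_mul _), integral_const_mul, pow_succ]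
    have h1 : (1 - ρ) * (π / d * ∫ ξ, G ξ) ≤ (1 - ρ) * ∫ ξ, G' ξ :=
      mul_le_mul_of_nonneg_left hGG' (by linarith)
    calc (∫ ξ, G ξ) - (1 - ρ) * ∫ ξ, G' ξ ≤ (∫ ξ, G ξ) * (1 - (1 - ρ) * (π / d)) := by linarith
      _ ≤ _ := mul_le_mul_of_nonneg_right ih' hπd

end ExpectedCuts

/-! ### The bias of a forest -/

section Bias

variable {d p n a b k B : ℕ}

theorem mem_cell_of_between {ℓ : Labels d} {v : List Bool} {u y w : Cube d} (hu : u ∈ cell ℓ v)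
    (hy : y ∈ cell ℓ v) (hw : ∀ j, (u j ≤ w j ∧ w j ≤ y j) ∨ (y j ≤ w j ∧ w j ≤ u j)) :
    w ∈ cell ℓ v := by
  induction v with
  | nil => simp [cell]
  | cons c v ih =>
    refine ⟨ih hu.1 hy.1, ?_⟩
    have h1 := hu.2
    have h2 := hy.2
    have h3 : ((u (ℓ v).1 : ℝ) ≤ w (ℓ v).1 ∧ (w (ℓ v).1 : ℝ) ≤ y (ℓ v).1) ∨
        ((y (ℓ v).1 : ℝ) ≤ w (ℓ v).1 ∧ (w (ℓ v).1 : ℝ) ≤ u (ℓ v).1) := hw (ℓ v).1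
    rw [h1] at h2
    rw [h1]
    constructor
    · intro h
      have h4 := h2.1 h
      rcases h3 with h3 | h3 <;> linarith [h3.1, h3.2]
    · intro h
      by_contra hcon
      have h4 : ¬ ((y (ℓ v).1 : ℝ) ≤ (ℓ v).2) := fun hh => hcon (h2.2 hh)
      rw [not_le] at hcon h4
      rcases h3 with h3 | h3 <;> linarith [h3.1, h3.2]

/-- The bound for the diameter of the node of depth `H` that contains `u`. -/
def nodeDiam (R : TreeRule d p a b) (H : ℕ) (ρ : ℝ) (D : Sample d p n) (t : TreeSeed n a b)
    (u : Cube d) : ℝ :=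
  ∑ j, ρ ^ splitCount (treeLabels R D t) j (path (treeLabels R D t) u H)

theorem nodeDiam_nonneg (R : TreeRule d p a b) (H : ℕ) {ρ : ℝ} (hρ : 0 ≤ ρ) (D : Sample d p n)
    (t : TreeSeed n a b) (u : Cube d) : 0 ≤ nodeDiam R H ρ D t u :=
  Finset.sum_nonneg fun _ _ => by positivity

theorem nodeDiam_le (R : TreeRule d p a b) (H : ℕ) {ρ : ℝ} (hρ : 0 ≤ ρ) (hρ1 : ρ ≤ 1)
    (D : Sample d p n) (t : TreeSeed n a b) (u : Cube d) : nodeDiam R H ρ D t u ≤ d := by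
  refine (Finset.sum_le_sum (g := fun _ => (1 : ℝ)) fun _ _ => pow_le_one₀ hρ hρ1).trans ?_
  simp

theorem measurable_nodeDiam (R : TreeRule d p a b) (H : ℕ) (ρ : ℝ) {Ω : Type*}
    [MeasurableSpace Ω] {D : Ω → Sample d p n} (hD : Measurable D) {t : Ω → TreeSeed n a b}
    (ht : Measurable t) {u : Ω → Cube d} (hu : Measurable u) :
    Measurable fun w => nodeDiam R H ρ (D w) (t w) (u w) :=
  Finset.measurable_sum _ fun j _ =>
    measurable_path_pow (measurable_treeLabels R hD ht) hu j H ρ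

open Classical in
/-- The indicator of irregular designs. -/
def badDesign (K : ℝ) (D : Sample d p n) (t : TreeSeed n a b) : ℝ :=
  if GoodDesign K (treeCov D t.1) then 0 else 1

theorem dist_cube_le_one (u u' : Cube d) : dist u u' ≤ 1 := by
  rw [dist_pi_le_iff zero_le_one]
  intro j
  rw [Subtype.dist_eq, Real.dist_eq, abs_le]
  have h1 := (u j).2
  have h2 := (u' j).2
  constructor <;> linarith [h1.1, h1.2, h2.1, h2.2]

/-- The requirements on the depth `H` up to which the nodes are analysed. -/
structure DepthBound (d k : ℕ) (ω : ℝ) (b H : ℕ) (K : ℝ) : Prop where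
  dim_le : 100 * (d : ℝ) ≤ K
  leaf_le : 2 * (k : ℝ) ≤ K
  le_pow : K ≤ ω ^ H * b

theorem DepthBound.isInternal {ω K : ℝ} {H : ℕ} (hH : DepthBound d k ω b H K) (hω : 0 ≤ ω)
    (hω1 : ω ≤ 1) {x : Fin b → Cube d} {ℓ : Labels d} (hT : GoodTree k ω x ℓ) {v : List Bool}
    (hv : v.length ≤ H) : IsInternal k x ℓ v := by
  have h1 := hT.pow_mul_le hω hω1 (hH.leaf_le.trans hH.le_pow) v hv
  have h2 : ω ^ H * b ≤ ω ^ v.length * b := by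
    gcongr ?_ * _
    exact pow_le_pow_of_le_one hω hω1 hv
  have h3 : (2 * k : ℝ) ≤ nodeCount x ℓ v := by linarith [hH.leaf_le, hH.le_pow]
  unfold IsInternal
  exact_mod_cast h3

/-- On a regular design the neighbors share the node of depth `H`, whose sides are bounded by powers
of the shrinkage factor; on an irregular one the trivial bound 1 is charged to the indicator. -/
theorem DepthBound.dist_le {ω K : ℝ} {H : ℕ} (hH : DepthBound d k ω b H K) (hd : 1 ≤ d)
    (hω : 0 ≤ ω) (hω1 : ω ≤ 1) (hb : 0 < b)
    {R : TreeRule d p a b} {D : Sample d p n} {t : TreeSeed n a b}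
    (hT : GoodTree k ω (treeCov D t.1) (treeLabels R D t)) {u : Cube d} {i : Fin n}
    (hi : i ∈ neighbors R k D t u) :
    dist (D i).1 u ≤ nodeDiam R H (1 - 4 / 5 * ω) D t u + badDesign K D t := by
  classical
  have hρ : 0 ≤ 1 - 4 / 5 * ω := by linarith
  unfold badDesign
  split_ifs with hG
  · rw [add_zero]
    have h1 : (D i).1 ∈ cell (treeLabels R D t) (path (treeLabels R D t) u H) :=
      mem_cell_path_of_mem_neighbors (fun h hh => hH.isInternal hω hω1 hT (by simp; omega)) hi
    refine (dist_le_sum_side h1 (mem_cell_path _ u H)).trans ?_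
    refine Finset.sum_le_sum fun j _ => ?_
    exact hG.side_path_le hd hb hH.dim_le hH.leaf_le hω hω1 hT hH.le_pow u j le_rfl
  · linarith [dist_cube_le_one (D i).1 u, nodeDiam_nonneg R H hρ D t u]

theorem DepthBound.abs_forest_bias_le {ω π K : ℝ} {H : ℕ} (hH : DepthBound d k ω b H K)
    (hd : 1 ≤ d) (hk : 1 ≤ k) (hkb : k ≤ b) (hω : 0 ≤ ω) (hω1 : ω ≤ 1) (hB : 0 < B)
    {R : TreeRule d p a b} (hR : R.IsRegular k ω π) {D : Sample d p n} (hD : SampleGenPos D)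
    {t : Fin B → TreeSeed n a b} (ht : ∀ c, Function.Injective (t c).1) {g : Cube d → ℝ}
    {L : ℝ} (hL : 0 ≤ L) (hg : ∀ u u', |g u - g u'| ≤ L * dist u u') (u : Cube d) :
    |∑ i, forestWeight R k D t u i * g (D i).1 - g u| ≤
      L * ((1 / (B : ℝ)) * ∑ c, nodeDiam R H (1 - 4 / 5 * ω) D (t c) u +
        (1 / (B : ℝ)) * ∑ c, badDesign K D (t c)) := by
  have hB' : (B : ℝ) ≠ 0 := by exact_mod_cast hB.ne'
  have hT : ∀ c, GoodTree k ω (treeCov D (t c).1) (treeLabels R D (t c)) := fun c =>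
    hR.goodTree hD (ht c)
  have hone : ∀ c, ∑ i, treeWeight R k D (t c) u i = 1 := fun c => by
    rw [sum_treeWeight_eq, if_pos ((hT c).neighbors_nonempty hk hkb u)]
  have htree : ∀ c, |∑ i, treeWeight R k D (t c) u i * g (D i).1 - g u| ≤
      L * (nodeDiam R H (1 - 4 / 5 * ω) D (t c) u + badDesign K D (t c)) := by
    intro c
    have h1 : ∑ i, treeWeight R k D (t c) u i * g (D i).1 - g u =
        ∑ i, treeWeight R k D (t c) u i * (g (D i).1 - g u) := by
      simp only [mul_sub, Finset.sum_sub_distrib, ← Finset.sum_mul, hone, one_mul]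
    rw [h1]
    refine (Finset.abs_sum_le_sum_abs _ _).trans ?_
    calc ∑ i, |treeWeight R k D (t c) u i * (g (D i).1 - g u)|
        ≤ ∑ i, treeWeight R k D (t c) u i *
          (L * (nodeDiam R H (1 - 4 / 5 * ω) D (t c) u + badDesign K D (t c))) := by
          refine Finset.sum_le_sum fun i _ => ?_
          rw [abs_mul, abs_of_nonneg (treeWeight_nonneg _ _ _ _ _)]
          by_cases hi : i ∈ neighbors R k D (t c) u
          · refine mul_le_mul_of_nonneg_left ((hg _ _).trans ?_) (treeWeight_nonneg _ _ _ _ _)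
            exact mul_le_mul_of_nonneg_left (hH.dist_le hd hω hω1 (by omega) (hT c) hi) hL
          · simp [treeWeight, hi]
      _ = _ := by rw [← Finset.sum_mul, hone, one_mul]
  rw [sum_forestWeight_mul]
  have h2 : (1 / (B : ℝ)) * ∑ c, ∑ i, treeWeight R k D (t c) u i * g (D i).1 - g u =
      (1 / (B : ℝ)) * ∑ c, (∑ i, treeWeight R k D (t c) u i * g (D i).1 - g u) := by
    rw [Finset.sum_sub_distrib, mul_sub]
    simp
    field_simp
  rw [h2, abs_mul, abs_of_nonneg (by positivity), ← mul_add, ← Finset.sum_add_distrib,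
    mul_left_comm, Finset.mul_sum]
  gcongr
  exact (Finset.abs_sum_le_sum_abs _ _).trans (Finset.sum_le_sum fun c _ => htree c)

/-- The points whose coordinates are coordinates of the observations. -/
def gridPoint (D : Sample d p n) (I : Fin d → Fin n) : Cube d := fun j => (D (I j)).1 j

/-- The corners of the gap around `x` in the set of `j`-th coordinates of the observations. -/
theorem exists_gap (hn : 0 < n) (D : Sample d p n) (j : Fin d) (x : unitInterval) :
    ∃ i₁ i₂ : Fin n, ∀ i, (x ≤ (D i).1 j → x ≤ (D i₁).1 j ∧ (D i₁).1 j ≤ (D i).1 j) ∧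
      ((D i).1 j < x → (D i).1 j ≤ (D i₂).1 j ∧ (D i₂).1 j ≤ x) := by
  classical
  have h1 : ∃ i₁ : Fin n, ∀ i, x ≤ (D i).1 j → x ≤ (D i₁).1 j ∧ (D i₁).1 j ≤ (D i).1 j := by
    by_cases h : (Finset.univ.filter fun i => x ≤ (D i).1 j).Nonempty
    · obtain ⟨i₁, hi₁, hmin⟩ := Finset.exists_min_image _ (fun i => (D i).1 j) h
      simp only [Finset.mem_filter, Finset.mem_univ, true_and] at hi₁ hmin
      exact ⟨i₁, fun i hi => ⟨hi₁, hmin i hi⟩⟩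
    · refine ⟨⟨0, hn⟩, fun i hi => absurd ⟨i, ?_⟩ h⟩
      simpa using hi
  have h2 : ∃ i₂ : Fin n, ∀ i, (D i).1 j < x → (D i).1 j ≤ (D i₂).1 j ∧ (D i₂).1 j ≤ x := by
    by_cases h : (Finset.univ.filter fun i => (D i).1 j < x).Nonempty
    · obtain ⟨i₂, hi₂, hmax⟩ := Finset.exists_max_image _ (fun i => (D i).1 j) h
      simp only [Finset.mem_filter, Finset.mem_univ, true_and] at hi₂ hmax
      exact ⟨i₂, fun i hi => ⟨hmax i hi, hi₂.le⟩⟩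
    · refine ⟨⟨0, hn⟩, fun i hi => absurd ⟨i, ?_⟩ h⟩
      simpa using hi
  obtain ⟨i₁, h1⟩ := h1
  obtain ⟨i₂, h2⟩ := h2
  exact ⟨i₁, i₂, fun i => ⟨h1 i, h2 i⟩⟩

/-- In each tree the node of `u` contains an observation, and a corner of the gap around `u` lies
coordinatewise between the two, hence in the same node. Which corner it is depends on the tree, so
all 2^d are summed. The suprema over `u` are thereby reduced to n^d points that depend on the data
but not on the trees. -/
theorem avg_nodeDiam_le (hn : 0 < n) {R : TreeRule d p a b} {H : ℕ} {ρ : ℝ} (hρ : 0 ≤ ρ)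
    {D : Sample d p n} {t : Fin B → TreeSeed n a b}
    (hpos : ∀ c u, 0 < nodeCount (treeCov D (t c).1) (treeLabels R D (t c))
      (path (treeLabels R D (t c)) u H)) {M : ℝ}
    (hM : ∀ I, (1 / (B : ℝ)) * ∑ c, nodeDiam R H ρ D (t c) (gridPoint D I) ≤ M) (u : Cube d) :
    (1 / (B : ℝ)) * ∑ c, nodeDiam R H ρ D (t c) u ≤ 2 ^ d * M := by
  classical
  choose i₁ i₂ hi using fun j => exists_gap hn D j (u j)
  let I : (Fin d → Bool) → Fin d → Fin n := fun e j => if e j then i₁ j else i₂ j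
  have htree : ∀ c, nodeDiam R H ρ D (t c) u ≤
      ∑ e, nodeDiam R H ρ D (t c) (gridPoint D (I e)) := by
    intro c
    obtain ⟨i, hi'⟩ := exists_mem_cell_of_pos (hpos c u)
    set i' := (t c).1 (Sum.inr i)
    have hcell : (D i').1 ∈ cell (treeLabels R D (t c)) (path (treeLabels R D (t c)) u H) := hi'
    let e : Fin d → Bool := fun j => decide (u j ≤ (D i').1 j)
    have hg : gridPoint D (I e) ∈
        cell (treeLabels R D (t c)) (path (treeLabels R D (t c)) u H) := by
      refine mem_cell_of_between (mem_cell_path _ u H) hcell fun j => ?_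
      by_cases h : u j ≤ (D i').1 j
      · left
        simpa [gridPoint, I, e, h] using (hi j i').1 h
      · right
        simpa [gridPoint, I, e, h] using (hi j i').2 (not_le.1 h)
    have hpath : path (treeLabels R D (t c)) (gridPoint D (I e)) H =
        path (treeLabels R D (t c)) u H := by
      rw [mem_cell_iff, length_path] at hg
      exact hg
    calc nodeDiam R H ρ D (t c) u = nodeDiam R H ρ D (t c) (gridPoint D (I e)) := by
          unfold nodeDiam
          rw [hpath]
      _ ≤ _ := Finset.single_le_sum
          (f := fun e => nodeDiam R H ρ D (t c) (gridPoint D (I e)))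
          (fun e _ => nodeDiam_nonneg R H hρ D (t c) _) (Finset.mem_univ e)
  calc (1 / (B : ℝ)) * ∑ c, nodeDiam R H ρ D (t c) u
      ≤ (1 / (B : ℝ)) * ∑ c, ∑ e, nodeDiam R H ρ D (t c) (gridPoint D (I e)) := by
        gcongr with c
        exact htree c
    _ = ∑ e, (1 / (B : ℝ)) * ∑ c, nodeDiam R H ρ D (t c) (gridPoint D (I e)) := by
        rw [Finset.sum_comm, Finset.mul_sum]
    _ ≤ ∑ _e : Fin d → Bool, M := Finset.sum_le_sum fun e _ => hM _
    _ = 2 ^ d * M := by simp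

theorem DepthBound.integral_nodeDiam_le {ω π K : ℝ} {H : ℕ} (hH : DepthBound d k ω b H K)
    (hω : 0 ≤ ω) (hω1 : ω ≤ 1) (hπ : 0 ≤ π) (hπ1 : π ≤ 1) (hab : a + b ≤ n)
    {R : TreeRule d p a b} (hR : R.IsRegular k ω π) {D : Sample d p n} (hD : SampleGenPos D)
    (u : Cube d) :
    ∫ t, nodeDiam R H (1 - 4 / 5 * ω) D t u ∂treeSeedLaw n a b ≤
      d * (1 - 4 / 5 * ω * (π / d)) ^ H := by
  classical
  have hprob := isProbabilityMeasure_treeSeedLaw hab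
  obtain ⟨f₀⟩ := nonempty_embedding hab
  have hρ : 0 ≤ 1 - 4 / 5 * ω := by linarith
  have hρ1 : 1 - 4 / 5 * ω ≤ 1 := by linarith
  have hm : Measurable fun t : TreeSeed n a b => nodeDiam R H (1 - 4 / 5 * ω) D t u :=
    measurable_nodeDiam R H _ measurable_const measurable_id measurable_const
  have hbd : ∀ t, ‖nodeDiam R H (1 - 4 / 5 * ω) D t u‖ ≤ d := fun t => by
    rw [Real.norm_eq_abs, abs_of_nonneg (nodeDiam_nonneg R H hρ D t u)]
    exact nodeDiam_le R H hρ hρ1 D t u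
  have hprobU : IsProbabilityMeasure
      (uniformOn {f : Fin a ⊕ Fin b → Fin n | Function.Injective f}) :=
    isProbabilityMeasure_uniformOn (Set.toFinite _) ⟨f₀, f₀.injective⟩
  have hint : Integrable (fun t => nodeDiam R H (1 - 4 / 5 * ω) D t u) (treeSeedLaw n a b) :=
    Integrable.of_bound hm.aestronglyMeasurable _ (Eventually.of_forall hbd)
  have hdd : π / d ≤ 1 := by
    rcases Nat.eq_zero_or_pos d with h | h
    · simp [h]
    · have : (1 : ℝ) ≤ d := by exact_mod_cast h
      rw [div_le_one (by linarith)]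
      linarith
  have hπd0 : 0 ≤ π / d := by positivity
  have hr : 0 ≤ 1 - (1 - (1 - 4 / 5 * ω)) * (π / d) := by nlinarith
  unfold treeSeedLaw at hint ⊢
  rw [integral_prod _ hint]
  have hinner : ∀ f : Fin a ⊕ Fin b → Fin n, Function.Injective f →
      ∫ ξ, nodeDiam R H (1 - 4 / 5 * ω) D (f, ξ) u ≤ d * (1 - 4 / 5 * ω * (π / d)) ^ H := by
    intro f hf
    have hmj : ∀ j, Integrable fun ξ : unitInterval => (1 - 4 / 5 * ω) ^
        splitCount (treeLabels R D (f, ξ)) j (path (treeLabels R D (f, ξ)) u H) := fun j =>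
      Integrable.of_bound (measurable_path_pow (measurable_treeLabels R measurable_const
        measurable_prodMk_left) measurable_const j H _).aestronglyMeasurable 1
        (Eventually.of_forall fun ξ => by
          rw [Real.norm_eq_abs, abs_of_nonneg (by positivity)]
          exact pow_le_one₀ hρ hρ1)
    unfold nodeDiam
    rw [integral_finsetSum _ fun j _ => hmj j]
    refine (Finset.sum_le_sum (g := fun _ => (1 - 4 / 5 * ω * (π / d)) ^ H) fun j _ => ?_).trans
      (by simp)
    have := hR.integral_path_pow_le hπ (hD.genPos hf) (H := H) (fun ξ v hv =>
      hH.isInternal hω hω1 (hR.goodTree hD (t := (f, ξ)) hf) hv.le) u j hρ hρ1 hr le_rfl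
    rw [sub_sub_cancel] at this
    exact this
  calc _ ≤ ∫ _f, d * (1 - 4 / 5 * ω * (π / d)) ^ H
        ∂(uniformOn {f : Fin a ⊕ Fin b → Fin n | Function.Injective f}) := by
        refine integral_mono_ae hint.integral_prod_left (integrable_const _) ?_
        have : ∀ᵐ f ∂(uniformOn {f : Fin a ⊕ Fin b → Fin n | Function.Injective f}),
            Function.Injective f := by
          rw [ae_iff]
          exact (uniformOn_eq_zero_iff (Set.toFinite _)).2 (Set.inter_compl_self _)
        filter_upwards [this] with f hf using hinner f hf
    _ = _ := by simp

theorem measurableSet_sampleGenPos :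
    MeasurableSet {D : Sample d p n | SampleGenPos D} := by
  have h : {D : Sample d p n | SampleGenPos D} =
      ⋂ j : Fin d, ⋂ i : Fin n, ⋂ i' : Fin n, {D | (D i).1 j = (D i').1 j → i = i'} := by
    ext D; simp [SampleGenPos, Function.Injective]
  rw [h]
  refine MeasurableSet.iInter fun j => MeasurableSet.iInter fun i => MeasurableSet.iInter fun i' => ?_
  by_cases hii : i = i'
  · simp [hii]
  · simp only [hii, imp_false]
    refine (measurableSet_eq_fun ?_ ?_).compl <;>
    exact (measurable_pi_apply j).comp (measurable_fst.comp (measurable_pi_apply _))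

/-- Uniform control of the sizes of the nodes of depth `H`. -/
theorem DepthBound.measure_avg_nodeDiam_le {ω π K : ℝ} {H : ℕ} (hH : DepthBound d k ω b H K)
    (hω : 0 ≤ ω) (hω1 : ω ≤ 1) (hπ : 0 ≤ π) (hπ1 : π ≤ 1) (hab : a + b ≤ n) (hB : 0 < B)
    {R : TreeRule d p a b} (hR : R.IsRegular k ω π)
    (P : Measure (Sample d p n)) [IsProbabilityMeasure P] {e : ℝ} (he : 0 < e)
    (hle : d * (1 - 4 / 5 * ω * (π / d)) ^ H ≤ e) :
    (P.prod (forestSeedLaw B n a b)) {x | SampleGenPos x.1 ∧ ∃ I,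
      2 * e ≤ (1 / (B : ℝ)) * ∑ c, nodeDiam R H (1 - 4 / 5 * ω) x.1 (x.2 c) (gridPoint x.1 I)} ≤
      ENNReal.ofReal ((n : ℝ) ^ d * (d ^ 2 / (B * e ^ 2))) := by
  have hprob := isProbabilityMeasure_treeSeedLaw hab
  have hρ : 0 ≤ 1 - 4 / 5 * ω := by linarith
  have hρ1 : 1 - 4 / 5 * ω ≤ 1 := by linarith
  have hgrid : ∀ I, Measurable fun D : Sample d p n => gridPoint D I := fun I =>
    measurable_pi_iff.2 fun j =>
      (measurable_pi_apply j).comp (measurable_fst.comp (measurable_pi_apply (I j)))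
  have hmeas : MeasurableSet {x : Sample d p n × (Fin B → TreeSeed n a b) |
      SampleGenPos x.1 ∧ ∃ I, 2 * e ≤ (1 / (B : ℝ)) *
        ∑ c, nodeDiam R H (1 - 4 / 5 * ω) x.1 (x.2 c) (gridPoint x.1 I)} := by
    refine MeasurableSet.inter (measurable_fst measurableSet_sampleGenPos) ?_
    change MeasurableSet {x : Sample d p n × (Fin B → TreeSeed n a b) |
      ∃ I, 2 * e ≤ (1 / (B : ℝ)) *
        ∑ c, nodeDiam R H (1 - 4 / 5 * ω) x.1 (x.2 c) (gridPoint x.1 I)}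
    rw [Set.ofPred_exists]
    refine MeasurableSet.iUnion fun I => measurableSet_le measurable_const ?_
    refine (Finset.measurable_sum _ fun c _ => ?_).const_mul _
    exact measurable_nodeDiam R H _ measurable_fst ((measurable_pi_apply c).comp measurable_snd)
      ((hgrid I).comp measurable_fst)
  unfold forestSeedLaw
  rw [Measure.prod_apply hmeas]
  calc _ ≤ ∫⁻ _D, ENNReal.ofReal ((n : ℝ) ^ d * (d ^ 2 / (B * e ^ 2))) ∂P := by
        refine lintegral_mono fun D => ?_
        by_cases hD : SampleGenPos D
        · have hsub : Prod.mk D ⁻¹' {x : Sample d p n × (Fin B → TreeSeed n a b) |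
              SampleGenPos x.1 ∧ ∃ I, 2 * e ≤ (1 / (B : ℝ)) *
              ∑ c, nodeDiam R H (1 - 4 / 5 * ω) x.1 (x.2 c) (gridPoint x.1 I)} ⊆
              ⋃ I, {t | e ≤ |(1 / (B : ℝ)) * ∑ c, nodeDiam R H (1 - 4 / 5 * ω) D (t c)
                (gridPoint D I) - ∫ t, nodeDiam R H (1 - 4 / 5 * ω) D t (gridPoint D I)
                ∂treeSeedLaw n a b|} := by
            rintro t ⟨-, I, hI⟩
            refine Set.mem_iUnion.2 ⟨I, ?_⟩
            -- The mean over the seed is at most `e` for every sample in general position, so an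
            -- average of `2 * e` deviates from it by at least `e`.
            have := hH.integral_nodeDiam_le hω hω1 hπ hπ1 hab hR hD (gridPoint D I)
            simp only [Set.mem_ofPred_eq] at hI ⊢
            exact le_trans (by linarith) (le_abs_self _)
          refine (measure_mono hsub).trans ((measure_iUnion_le _).trans ?_)
          rw [tsum_fintype]
          calc _ ≤ ∑ _I : Fin d → Fin n, ENNReal.ofReal (d ^ 2 / (B * e ^ 2)) := by
                refine Finset.sum_le_sum fun I _ => ?_
                refine pi_mean_deviation_le (treeSeedLaw n a b)
                  (measurable_nodeDiam R H _ measurable_const measurable_id measurable_const)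
                  (fun t => ?_) hB he
                simp only [id]
                rw [abs_of_nonneg (nodeDiam_nonneg R H hρ D t _)]
                exact nodeDiam_le R H hρ hρ1 D t _
            _ = _ := by
                rw [Finset.sum_const, Finset.card_univ, nsmul_eq_mul, ← ENNReal.ofReal_natCast,
                  ← ENNReal.ofReal_mul (by positivity)]
                simp
        · have : Prod.mk D ⁻¹' {x : Sample d p n × (Fin B → TreeSeed n a b) |
              SampleGenPos x.1 ∧ ∃ I, 2 * e ≤ (1 / (B : ℝ)) *
              ∑ c, nodeDiam R H (1 - 4 / 5 * ω) x.1 (x.2 c) (gridPoint x.1 I)} = ∅ := by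
            ext t
            simp [hD]
          rw [this]
          simp
    _ = _ := by simp

end Bias

/-! ### The law of the covariates -/

section CovariateLaw

variable {d p n a b B : ℕ}

theorem map_covariate_sample (κ : Kernel (Cube d) (Fin p → ℝ)) [IsMarkovKernel κ] {g : Fin b → Fin n}
    (hg : Function.Injective g) :
    Measure.map (fun (D : Sample d p n) (i : Fin b) => (D (g i)).1)
      (Measure.pi fun _ : Fin n => (volume : Measure (Cube d)) ⊗ₘ κ) = volume := by
  have hm : ∀ i : Fin n, Measurable fun D : Sample d p n => (D i).1 := fun i =>
    measurable_fst.comp (measurable_pi_apply i)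
  have hind : iIndepFun (fun (i : Fin n) (D : Sample d p n) => (D i).1)
      (Measure.pi fun _ : Fin n => (volume : Measure (Cube d)) ⊗ₘ κ) :=
    iIndepFun_pi (X := fun (_ : Fin n) (z : Cube d × (Fin p → ℝ)) => z.1)
      fun _ => measurable_fst.aemeasurable
  have hind2 := hind.precomp hg
  rw [(iIndepFun_iff_map_fun_eq_pi_map fun i => (hm (g i)).aemeasurable).1 hind2]
  suffices h : (fun i : Fin b => Measure.map (fun D : Sample d p n => (D (g i)).1)
      (Measure.pi fun _ : Fin n => (volume : Measure (Cube d)) ⊗ₘ κ)) =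
      fun _ => (volume : Measure (Cube d)) by
    rw [h]
    rfl
  funext i
  have h1 : (fun D : Sample d p n => (D (g i)).1) = Prod.fst ∘ Function.eval (g i) := rfl
  rw [h1, ← Measure.map_map measurable_fst (measurable_pi_apply _),
    (measurePreserving_eval (fun _ : Fin n => (volume : Measure (Cube d)) ⊗ₘ κ) (g i)).map_eq]
  exact Measure.fst_compProd _ _

theorem measure_not_sampleGenPos (κ : Kernel (Cube d) (Fin p → ℝ)) [IsMarkovKernel κ] :
    (Measure.pi fun _ : Fin n => (volume : Measure (Cube d)) ⊗ₘ κ)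
      {D : Sample d p n | ¬ SampleGenPos D} = 0 := by
  have hsub : {D : Sample d p n | ¬ SampleGenPos D} ⊆
      ⋃ j : Fin d, ⋃ i : Fin n, ⋃ i' : Fin n, {D | (D i).1 j = (D i').1 j ∧ i ≠ i'} := by
    intro D hD
    simp only [SampleGenPos, Function.Injective, not_forall, Set.mem_ofPred_eq] at hD
    obtain ⟨j, i, i', h1, h2⟩ := hD
    simp only [Set.mem_iUnion]
    exact ⟨j, i, i', h1, h2⟩
  refine measure_mono_null hsub ?_
  refine measure_iUnion_null fun j => measure_iUnion_null fun i => measure_iUnion_null fun i' => ?_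
  by_cases hii : i = i'
  · simp [hii]
  have hg : Function.Injective ![i, i'] := by
    intro x y hxy
    fin_cases x <;> fin_cases y <;> simp_all
  have hmap := map_covariate_sample (p := p) κ hg
  have hm2 : Measurable fun (D : Sample d p n) (l : Fin 2) => (D (![i, i'] l)).1 :=
    measurable_pi_iff.2 fun l => measurable_fst.comp (measurable_pi_apply _)
  have hind : iIndepFun (fun (l : Fin 2) (x : Fin 2 → Cube d) => x l j) volume := by
    rw [volume_pi]
    exact iIndepFun_pi (X := fun (_ : Fin 2) (z : Cube d) => z j)
      fun _ => (measurable_pi_apply j).aemeasurable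
  have hI : IndepFun (fun x : Fin 2 → Cube d => x 0 j) (fun x : Fin 2 → Cube d => x 1 j) volume :=
    hind.indepFun (i := 0) (j := 1) (by simp)
  have hmj : ∀ l : Fin 2, Measurable fun x : Fin 2 → Cube d => x l j := fun l =>
    (measurable_pi_apply j).comp (measurable_pi_apply l)
  have hlaw : ∀ l : Fin 2, Measure.map (fun x : Fin 2 → Cube d => x l j) volume = volume := by
    intro l
    have h1 : (fun x : Fin 2 → Cube d => x l j) =
        (fun y : Cube d => y j) ∘ (fun x : Fin 2 → Cube d => x l) := rfl
    rw [h1, ← Measure.map_map (measurable_pi_apply _) (measurable_pi_apply _),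
      show Measure.map (fun x : Fin 2 → Cube d => x l) volume = volume from
        (measurePreserving_eval (fun _ : Fin 2 => (volume : Measure (Cube d))) l).map_eq]
    exact (measurePreserving_eval (fun _ : Fin d => (volume : Measure unitInterval)) j).map_eq
  have hprod := (indepFun_iff_map_prod_eq_prod_map_map (hmj 0).aemeasurable
    (hmj 1).aemeasurable).1 hI
  rw [hlaw, hlaw] at hprod
  have hdiag : MeasurableSet {z : unitInterval × unitInterval | z.1 = z.2} :=
    measurableSet_eq_fun measurable_fst measurable_snd
  have hnull : ((volume : Measure unitInterval).prod volume)
      {z : unitInterval × unitInterval | z.1 = z.2} = 0 := by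
    rw [Measure.measure_prod_null hdiag]
    refine Eventually.of_forall fun x => ?_
    have : Prod.mk x ⁻¹' {z : unitInterval × unitInterval | z.1 = z.2} = Set.Icc x x := by
      ext y; simp [eq_comm]
    show volume (Prod.mk x ⁻¹' {z : unitInterval × unitInterval | z.1 = z.2}) = 0
    rw [this, unitInterval.volume_Icc]
    simp
  rw [← hprod, Measure.map_apply ((hmj 0).prodMk (hmj 1)) hdiag, ← hmap,
    Measure.map_apply hm2 (((hmj 0).prodMk (hmj 1)) hdiag)] at hnull
  refine measure_mono_null ?_ hnull
  rintro D ⟨h1, -⟩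
  simpa using h1

theorem measurableSet_goodDesign (K : ℝ) : MeasurableSet {x : Fin b → Cube d | GoodDesign K x} := by
  have hpc : ∀ lo hi : Fin d → Fin (b + 2), Measurable fun x : Fin b → Cube d =>
      (pointCount x (gridBox d b (fun j => lo j) fun j => hi j) : ℝ) := fun lo hi =>
    measurable_pointCount (measurableSet_gridBox _ _)
  unfold GoodDesign
  rw [Set.ofPred_forall]
  refine MeasurableSet.iInter fun lo => ?_
  rw [Set.ofPred_forall]
  refine MeasurableSet.iInter fun hi => MeasurableSet.inter ?_ ?_
  · exact MeasurableSet.imp (measurableSet_le measurable_const (hpc lo hi))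
      (measurableSet_lt (hpc lo hi) measurable_const)
  · exact MeasurableSet.imp (MeasurableSet.const _) (measurableSet_lt measurable_const (hpc lo hi))

/-- The covariates of a single estimation sample are i.i.d. uniform, so each tree is bad with small
probability and Markov's inequality applies to the average. A union bound over the trees, whose
number is unlimited, is not possible. -/
theorem measure_avg_badDesign_le (κ : Kernel (Cube d) (Fin p → ℝ)) [IsMarkovKernel κ] (hab : a + b ≤ n)
    (hB : 0 < B) (K : ℝ) {y : ℝ} (hy : 0 < y) :
    ((Measure.pi fun _ : Fin n => (volume : Measure (Cube d)) ⊗ₘ κ).prod (forestSeedLaw B n a b))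
      {x | y ≤ (1 / (B : ℝ)) * ∑ c, badDesign K x.1 (x.2 c)} ≤
      ENNReal.ofReal (2 * ((b : ℝ) + 2) ^ (2 * d) * Real.exp (-(K / 1800)) / y) := by
  classical
  have hprob := isProbabilityMeasure_treeSeedLaw hab
  have hB' : (0 : ℝ) < B := by exact_mod_cast hB
  set P := Measure.pi fun _ : Fin n => (volume : Measure (Cube d)) ⊗ₘ κ with hP
  set q : ℝ := 2 * ((b : ℝ) + 2) ^ (2 * d) * Real.exp (-(K / 1800)) with hq
  have hcovm : ∀ c, Measurable fun x : Sample d p n × (Fin B → TreeSeed n a b) =>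
      treeCov x.1 (x.2 c).1 := fun c => measurable_treeCov measurable_fst
    (measurable_fst.comp ((measurable_pi_apply c).comp measurable_snd))
  have hbadset : ∀ c, MeasurableSet {x : Sample d p n × (Fin B → TreeSeed n a b) |
      GoodDesign K (treeCov x.1 (x.2 c).1)} := fun c => hcovm c (measurableSet_goodDesign K)
  have hbm : ∀ c, Measurable fun x : Sample d p n × (Fin B → TreeSeed n a b) =>
      badDesign K x.1 (x.2 c) := fun c =>
    Measurable.ite (hbadset c) measurable_const measurable_const
  have hb0 : ∀ c (x : Sample d p n × (Fin B → TreeSeed n a b)), 0 ≤ badDesign K x.1 (x.2 c) :=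
    fun c x => by unfold badDesign; split_ifs <;> simp
  have hone : ∀ c, ∫⁻ x, ENNReal.ofReal (badDesign K x.1 (x.2 c)) ∂(P.prod (forestSeedLaw B n a b)) ≤
      ENNReal.ofReal q := by
    intro c
    have h1 : ∀ x : Sample d p n × (Fin B → TreeSeed n a b),
        ENNReal.ofReal (badDesign K x.1 (x.2 c)) =
        {x : Sample d p n × (Fin B → TreeSeed n a b) |
          GoodDesign K (treeCov x.1 (x.2 c).1)}ᶜ.indicator 1 x := by
      intro x
      unfold badDesign
      by_cases h : GoodDesign K (treeCov x.1 (x.2 c).1) <;> simp [h]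
    rw [lintegral_congr h1, lintegral_indicator_one (hbadset c).compl]
    unfold forestSeedLaw
    rw [Measure.prod_apply_symm (hbadset c).compl]
    have hinj : ∀ᵐ t ∂(Measure.pi fun _ : Fin B => treeSeedLaw n a b),
        Function.Injective (t c).1 := by
      rw [ae_iff]
      exact (measurePreserving_eval (fun _ : Fin B => treeSeedLaw n a b) c).quasiMeasurePreserving
        |>.preimage_null treeSeedLaw_not_injective
    calc _ ≤ ∫⁻ _t, ENNReal.ofReal q ∂(Measure.pi fun _ : Fin B => treeSeedLaw n a b) := by
          refine lintegral_mono_ae ?_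
          filter_upwards [hinj] with t ht
          have hg : Function.Injective fun i : Fin b => (t c).1 (Sum.inr i) :=
            ht.comp Sum.inr_injective
          have hmap := map_covariate_sample (p := p) κ hg
          refine le_trans (le_of_eq ?_) (measure_not_goodDesign_le (d := d) (b := b) K)
          rw [← hmap, Measure.map_apply]
          · rfl
          · exact measurable_pi_iff.2 fun i => measurable_fst.comp (measurable_pi_apply _)
          · exact (measurableSet_goodDesign K).compl
      _ = _ := by simp
  have h2 := meas_ge_le_lintegral_div (μ := P.prod (forestSeedLaw B n a b))
    (f := fun x => ∑ c, ENNReal.ofReal (badDesign K x.1 (x.2 c)))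
    (Finset.measurable_sum _ fun c _ => (hbm c).ennreal_ofReal).aemeasurable
    (ε := ENNReal.ofReal (B * y)) (ENNReal.ofReal_pos.2 (by positivity)).ne' ENNReal.ofReal_ne_top
  refine (measure_mono fun x hx => ?_).trans (h2.trans ?_)
  · simp only [Set.mem_ofPred_eq] at hx ⊢
    rw [← ENNReal.ofReal_sum_of_nonneg fun c _ => hb0 c x]
    refine ENNReal.ofReal_le_ofReal ?_
    calc B * y ≤ B * ((1 / (B : ℝ)) * ∑ c, badDesign K x.1 (x.2 c)) := by gcongr
      _ = _ := by field_simp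
  · rw [lintegral_finsetSum _ fun c _ => (hbm c).ennreal_ofReal]
    calc _ ≤ (∑ _c : Fin B, ENNReal.ofReal q) / ENNReal.ofReal (B * y) := by
          gcongr with c
          exact hone c
      _ = ENNReal.ofReal (q / y) := by
          rw [Finset.sum_const, Finset.card_univ, Fintype.card_fin, nsmul_eq_mul,
            ← ENNReal.ofReal_natCast, ← ENNReal.ofReal_mul hB'.le,
            ← ENNReal.ofReal_div_of_pos (by positivity)]
          congr 1
          field_simp

end CovariateLaw

/-! ### The uniform deviation of a forest -/

section Deviation

variable {d p n a b k B N : ℕ} {ι : Type} [Fintype ι]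

/-- The deviation of a statistic from its conditional mean. -/
def residual (κ : Kernel (Cube d) (Fin p → ℝ)) (Φ : (Fin p → ℝ) → ℝ) (z : Cube d × (Fin p → ℝ)) :
    ℝ := Φ z.2 - ∫ y, Φ y ∂κ z.1

theorem measurable_residual (κ : Kernel (Cube d) (Fin p → ℝ)) [IsMarkovKernel κ]
    {Φ : (Fin p → ℝ) → ℝ} (hΦ : Measurable Φ) : Measurable (residual κ Φ) :=
  (hΦ.comp measurable_snd).sub
    ((hΦ.stronglyMeasurable.integral_kernel (κ := κ)).measurable.comp measurable_fst)

theorem measure_residual_gt_le (κ : Kernel (Cube d) (Fin p → ℝ)) [IsMarkovKernel κ]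
    {Φ : (Fin p → ℝ) → ℝ} (hΦ : Measurable Φ) {σ m : ℝ} (hB : ∀ u, Bernstein σ m (κ u) Φ)
    {K : ℝ} (hK : 0 < K) :
    ((volume : Measure (Cube d)) ⊗ₘ κ) {z | K < |residual κ Φ z|} ≤ ENNReal.ofReal (σ ^ 2 / K ^ 2) := by
  have hm := measurable_residual κ hΦ
  rw [Measure.compProd_apply (measurableSet_lt measurable_const hm.abs)]
  calc _ ≤ ∫⁻ _u : Cube d, ENNReal.ofReal (σ ^ 2 / K ^ 2) := by
        refine lintegral_mono fun u => ?_
        have hsq := (hB u).2 2 le_rfl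
        have hmu : Measurable fun y => (Φ y - ∫ y', Φ y' ∂κ u) ^ 2 := (hΦ.sub_const _).pow_const _
        have h1 : ∫⁻ y, ENNReal.ofReal ((Φ y - ∫ y', Φ y' ∂κ u) ^ 2) ∂κ u ≤ ENNReal.ofReal (σ ^ 2) := by
          rw [← ofReal_integral_eq_lintegral_ofReal hsq.1 (Eventually.of_forall fun y => sq_nonneg _)]
          refine ENNReal.ofReal_le_ofReal ((le_abs_self _).trans (hsq.2.trans (le_of_eq ?_)))
          simp
        have h2 := meas_ge_le_lintegral_div (μ := κ u) hmu.ennreal_ofReal.aemeasurable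
          (ε := ENNReal.ofReal (K ^ 2)) (ENNReal.ofReal_pos.2 (by positivity)).ne'
          ENNReal.ofReal_ne_top
        refine (measure_mono fun y hy => ?_).trans (h2.trans ?_)
        · have hy' : K < |Φ y - ∫ y', Φ y' ∂κ u| := hy
          refine ENNReal.ofReal_le_ofReal ?_
          rw [← sq_abs (Φ y - _)]
          gcongr
        · rw [ENNReal.ofReal_div_of_pos (by positivity)]
          gcongr
    _ = _ := by simp

/-- Chebyshev's inequality with the variance from Bernstein's condition, and a union bound. The
truncation level only enters multiplied by the tiny mixture error `δ`, so this crude bound suffices.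
-/
theorem measure_exists_residual_gt_le (κ : Kernel (Cube d) (Fin p → ℝ)) [IsMarkovKernel κ]
    {Φ : ι → (Fin p → ℝ) → ℝ} (hΦ : ∀ i, Measurable (Φ i)) {σ m : ℝ}
    (hB : ∀ i u, Bernstein σ m (κ u) (Φ i)) {K : ℝ} (hK : 0 < K) {Ω : Type*} [MeasurableSpace Ω]
    (ν : Measure Ω) [IsProbabilityMeasure ν] :
    ((Measure.pi fun _ : Fin n => (volume : Measure (Cube d)) ⊗ₘ κ).prod ν)
      {x | ∃ i j, K < |residual κ (Φ i) (x.1 j)|} ≤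
      ENNReal.ofReal (Fintype.card ι * n * (σ ^ 2 / K ^ 2)) := by
  have hsub : {x : Sample d p n × Ω | ∃ i j, K < |residual κ (Φ i) (x.1 j)|} =
      ⋃ i, ⋃ j, (fun x : Sample d p n × Ω => x.1 j) ⁻¹' {z | K < |residual κ (Φ i) z|} := by
    ext x; simp
  rw [hsub]
  have hmp : ∀ j : Fin n, MeasurePreserving (fun x : Sample d p n × Ω => x.1 j)
      ((Measure.pi fun _ : Fin n => (volume : Measure (Cube d)) ⊗ₘ κ).prod ν)
      ((volume : Measure (Cube d)) ⊗ₘ κ) := fun j =>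
    (measurePreserving_eval (fun _ : Fin n => (volume : Measure (Cube d)) ⊗ₘ κ) j).comp
      measurePreserving_fst
  refine (measure_iUnion_le _).trans ?_
  rw [tsum_fintype]
  calc _ ≤ ∑ _i : ι, ∑ _j : Fin n, ENNReal.ofReal (σ ^ 2 / K ^ 2) := by
        refine Finset.sum_le_sum fun i _ => (measure_iUnion_le _).trans ?_
        rw [tsum_fintype]
        refine Finset.sum_le_sum fun j _ => ?_
        rw [(hmp j).measure_preimage (measurableSet_lt measurable_const
          (measurable_residual κ (hΦ i)).abs).nullMeasurableSet]
        exact measure_residual_gt_le κ (hΦ i) (hB i) hK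
    _ = _ := by
        simp only [Finset.sum_const, Finset.card_univ, Fintype.card_fin, nsmul_eq_mul]
        rw [ENNReal.ofReal_mul (by positivity), ENNReal.ofReal_mul (by positivity),
          ENNReal.ofReal_natCast, ENNReal.ofReal_natCast, mul_assoc]

/-- Five exceptional events make up the bound, in this order: unbalanced labels, a large residual,
large noise, large nodes at some grid point, too many irregular designs. Away from them and from
ties among covariate coordinates, noise and bias are bounded separately. -/
theorem DepthBound.measure_forest_deviation_le {ω π K : ℝ} {H : ℕ} (hH : DepthBound d k ω b H K)
    (hd : 1 ≤ d) (hk : 1 ≤ k) (hkb : k ≤ b) (hω : 0 < ω) (hω1 : ω ≤ 1) (hπ : 0 ≤ π) (hπ1 : π ≤ 1)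
    (hB : 0 < B) (hN : 0 < N) (hn : N * (a + b) ≤ n) (hn0 : 0 < n)
    {R : TreeRule d p a b} (hR : R.IsRegular k ω π)
    (κ : Kernel (Cube d) (Fin p → ℝ)) [IsMarkovKernel κ]
    {Φ : ι → (Fin p → ℝ) → ℝ} (hΦ : ∀ i, Measurable (Φ i)) {σ m L : ℝ}
    (hBern : ∀ i u, Bernstein σ m (κ u) (Φ i)) (hL : 0 ≤ L)
    (hLip : ∀ i u u', |∫ y, Φ i y ∂κ u - ∫ y, Φ i y ∂κ u'| ≤ L * dist u u')
    {e : ℝ} (he : 0 < e) (hle : d * (1 - 4 / 5 * ω * (π / d)) ^ H ≤ e)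
    {δ : ℝ} (hδ0 : 0 < δ) (hδ : δ ≤ 1) {Kη : ℝ} (hKη : 0 < Kη)
    {c : ℝ} (hc0 : 0 ≤ c) (hc : c ≤ N * (1 / (2 * (|m| + 1)))) (y : ℝ) {z : ℝ} (hz : 0 < z) :
    ((Measure.pi fun _ : Fin n => (volume : Measure (Cube d)) ⊗ₘ κ).prod (forestSeedLaw B n a b))
      {x | ∃ u i, y + δ * Kη + L * (2 ^ d * (2 * e) + z) <
        |∑ j, forestWeight R k x.1 x.2 u j * Φ i (x.1 j).2 - ∫ y, Φ i y ∂κ u|} ≤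
      ENNReal.ofReal ((Nat.card ((Fin a ⊕ Fin b) ↪ Fin n) : ℝ) ^ 3 / (B * δ ^ 2)) +
      ENNReal.ofReal (Fintype.card ι * n * (σ ^ 2 / Kη ^ 2)) +
      (2 * Fintype.card ι * (N * (b * b) + 1) ^ d : ℕ) *
        ENNReal.ofReal (Real.exp (σ ^ 2 * (c ^ 2 / N) - c * y)) +
      ENNReal.ofReal ((n : ℝ) ^ d * (d ^ 2 / (B * e ^ 2))) +
      ENNReal.ofReal (2 * ((b : ℝ) + 2) ^ (2 * d) * Real.exp (-(K / 1800)) / z) := by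
  have hab : a + b ≤ n := le_trans (Nat.le_mul_of_pos_left _ hN) hn
  have hprobt := isProbabilityMeasure_treeSeedLaw hab
  have hprob : IsProbabilityMeasure (forestSeedLaw B n a b) := by
    unfold forestSeedLaw; infer_instance
  have hρ : 0 ≤ 1 - 4 / 5 * ω := by linarith
  set P := Measure.pi fun _ : Fin n => (volume : Measure (Cube d)) ⊗ₘ κ with hP
  set ν := forestSeedLaw B n a b with hν
  let G : Set (Sample d p n × (Fin B → TreeSeed n a b)) := {x | ¬ SampleGenPos x.1}
  let E₁ : Set (Sample d p n × (Fin B → TreeSeed n a b)) :=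
    {x | ¬ Balanced δ fun c => (x.2 c).1}
  let E₂ : Set (Sample d p n × (Fin B → TreeSeed n a b)) :=
    {x | ∃ i j, Kη < |residual κ (Φ i) (x.1 j)|}
  let E₃ : Set (Sample d p n × (Fin B → TreeSeed n a b)) :=
    {x | SampleGenPos x.1 ∧ Balanced δ (fun e => (x.2 e).1) ∧
        (∀ i j, |residual κ (Φ i) (x.1 j)| ≤ Kη) ∧
        ∃ u i, y + δ * Kη < |∑ j, forestWeight R k x.1 x.2 u j * residual κ (Φ i) (x.1 j)|}
  let E₄ : Set (Sample d p n × (Fin B → TreeSeed n a b)) := {x | SampleGenPos x.1 ∧ ∃ I,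
      2 * e ≤ (1 / (B : ℝ)) * ∑ c, nodeDiam R H (1 - 4 / 5 * ω) x.1 (x.2 c) (gridPoint x.1 I)}
  let E₅ : Set (Sample d p n × (Fin B → TreeSeed n a b)) :=
    {x | z ≤ (1 / (B : ℝ)) * ∑ c, badDesign K x.1 (x.2 c)}
  have hG : (P.prod ν) G = 0 := by
    have h1 : G = Prod.fst ⁻¹' {D : Sample d p n | SampleGenPos D}ᶜ := rfl
    rw [h1, measurePreserving_fst.measure_preimage
      measurableSet_sampleGenPos.compl.nullMeasurableSet]
    exact measure_not_sampleGenPos κ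
  have h₁ : (P.prod ν) E₁ ≤
      ENNReal.ofReal ((Nat.card ((Fin a ⊕ Fin b) ↪ Fin n) : ℝ) ^ 3 / (B * δ ^ 2)) := by
    refine le_trans (Measure.le_map_apply measurable_snd.aemeasurable
      {t : Fin B → TreeSeed n a b | ¬ Balanced δ fun c => (t c).1}) ?_
    rw [(measurePreserving_snd (μ := P) (ν := ν)).map_eq]
    exact forestSeedLaw_not_balanced_le hab hB hδ0
  have h₂ : (P.prod ν) E₂ ≤ ENNReal.ofReal (Fintype.card ι * n * (σ ^ 2 / Kη ^ 2)) :=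
    measure_exists_residual_gt_le κ hΦ hBern hKη ν
  have h₃ : (P.prod ν) E₃ ≤ (2 * Fintype.card ι * (N * (b * b) + 1) ^ d : ℕ) *
        ENNReal.ofReal (Real.exp (σ ^ 2 * (c ^ 2 / N) - c * y)) := by
    refine forest_noise_le (T := 1 / (2 * (|m| + 1))) hk hR hδ hN hn κ
      (fun i => measurable_residual κ (hΦ i))
      (sq_nonneg σ) (fun i u t ht => ?_) ν hc0 hc hKη.le y
    refine (hBern i u).lintegral_exp_le ?_
    have h1 : |t| * |m| ≤ 1 / (2 * (|m| + 1)) * |m| := by gcongr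
    refine h1.trans ?_
    rw [div_mul_eq_mul_div, one_mul, div_le_div_iff₀ (by positivity) (by norm_num)]
    linarith
  have h₄ := hH.measure_avg_nodeDiam_le hω.le hω1 hπ hπ1 hab hB hR P he hle
  have h₅ := measure_avg_badDesign_le κ hab hB K hz
  have hsub : {x : Sample d p n × (Fin B → TreeSeed n a b) |
      ∃ u i, y + δ * Kη + L * (2 ^ d * (2 * e) + z) <
        |∑ j, forestWeight R k x.1 x.2 u j * Φ i (x.1 j).2 - ∫ y, Φ i y ∂κ u|} ⊆
      G ∪ (E₁ ∪ E₂ ∪ E₃ ∪ E₄ ∪ E₅) := by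
    rintro ⟨D, t⟩ ⟨u, i, hx⟩
    by_contra hcon
    simp only [Set.mem_union, not_or] at hcon
    obtain ⟨hg, ⟨⟨⟨he1, he2⟩, he3⟩, he4⟩, he5⟩ := hcon
    have hD : SampleGenPos D := not_not.1 hg
    have hbal : Balanced δ fun c => (t c).1 := not_not.1 he1
    have hres : ∀ i j, |residual κ (Φ i) (D j)| ≤ Kη := fun i j =>
      not_lt.1 fun h => he2 ⟨i, j, h⟩
    have hnoise : |∑ j, forestWeight R k D t u j * residual κ (Φ i) (D j)| ≤ y + δ * Kη :=
      not_lt.1 fun h => he3 ⟨hD, hbal, hres, u, i, h⟩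
    have hgrid : ∀ I, (1 / (B : ℝ)) * ∑ c, nodeDiam R H (1 - 4 / 5 * ω) D (t c) (gridPoint D I) ≤
        2 * e := fun I => not_lt.1 fun h => he4 ⟨hD, I, h.le⟩
    have hbad : (1 / (B : ℝ)) * ∑ c, badDesign K D (t c) < z := not_le.1 he5
    have hT : ∀ c, GoodTree k ω (treeCov D (t c).1) (treeLabels R D (t c)) := fun c =>
      hR.goodTree hD (hbal.1 c)
    have hdiam := avg_nodeDiam_le hn0 hρ (fun c u => by
      have := hH.isInternal hω.le hω1 (hT c) (v := path (treeLabels R D (t c)) u H) (by simp)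
      exact lt_of_lt_of_le (by omega) this) hgrid u
    have hbias := hH.abs_forest_bias_le hd hk hkb hω.le hω1 hB hR hD hbal.1 hL (hLip i) u
    have hsplit : ∑ j, forestWeight R k D t u j * Φ i (D j).2 - ∫ y, Φ i y ∂κ u =
        ∑ j, forestWeight R k D t u j * residual κ (Φ i) (D j) +
        (∑ j, forestWeight R k D t u j * (∫ y, Φ i y ∂κ (D j).1) - ∫ y, Φ i y ∂κ u) := by
      simp only [residual, mul_sub, Finset.sum_sub_distrib]
      ring
    have hx' : y + δ * Kη + L * (2 ^ d * (2 * e) + z) <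
        |∑ j, forestWeight R k D t u j * Φ i (D j).2 - ∫ y, Φ i y ∂κ u| := hx
    rw [hsplit] at hx'
    have h6 : L * ((1 / (B : ℝ)) * ∑ c, nodeDiam R H (1 - 4 / 5 * ω) D (t c) u +
        (1 / (B : ℝ)) * ∑ c, badDesign K D (t c)) ≤ L * (2 ^ d * (2 * e) + z) := by
      gcongr
    linarith [abs_add_le (∑ j, forestWeight R k D t u j * residual κ (Φ i) (D j))
      (∑ j, forestWeight R k D t u j * (∫ y, Φ i y ∂κ (D j).1) - ∫ y, Φ i y ∂κ u)]
  refine (measure_mono hsub).trans ((measure_union_le _ _).trans ?_)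
  rw [hG, zero_add]
  refine (measure_union_le _ _).trans (add_le_add ?_ h₅)
  refine (measure_union_le _ _).trans (add_le_add ?_ h₄)
  refine (measure_union_le _ _).trans (add_le_add ?_ h₃)
  exact (measure_union_le _ _).trans (add_le_add h₁ h₂)

end Deviation

/-! ### Asymptotics of the deviation -/

/-- The exponent of the bias of a forest. -/
def biasExponent (d : ℕ) (ω π : ℝ) : ℝ :=
  1 / 2 * (Real.log (1 - ω) / Real.log ω) * (π / d)

theorem rate_eq (d : ℕ) (ω π : ℝ) (n p s : ℕ) : rate d ω π n p s =
    Real.sqrt ((s : ℝ) * (Real.log n + Real.log p) / n) + (s : ℝ) ^ (-biasExponent d ω π) := by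
  unfold rate biasExponent
  congr 2
  ring

/-! ### The exponent of the bias and the choice of depth -/

section Exponent

variable {d : ℕ} {ω π : ℝ}

/-- The left side is at most ω/(1 - ω), and 1/(1 - ω) ≤ 5/4 is where ω ≤ 1/5 enters. -/
theorem neg_log_one_sub_le (hω : 0 < ω) (hω' : ω ≤ 1 / 5) : -Real.log (1 - ω) ≤ 5 / 4 * ω := by
  have h1 : 0 < 1 - ω := by linarith
  have h2 := Real.one_sub_inv_le_log_of_pos h1
  have h3 : (1 - ω)⁻¹ - 1 ≤ 5 / 4 * ω := by
    rw [inv_eq_one_div, div_sub_one h1.ne', div_le_iff₀ h1]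
    nlinarith
  linarith

theorem biasExponent_nonneg (hω : 0 < ω) (hω' : ω ≤ 1 / 5) (hπ : 0 ≤ π) :
    0 ≤ biasExponent d ω π := by
  have h1 : Real.log (1 - ω) ≤ 0 := Real.log_nonpos (by linarith) (by linarith)
  have h2 : Real.log ω ≤ 0 := Real.log_nonpos hω.le (by linarith)
  have h3 := div_nonneg_of_nonpos h1 h2
  unfold biasExponent
  positivity

theorem div_dim_le_one (hd : 1 ≤ d) (hπ' : π ≤ 1) : π / d ≤ 1 := by
  have h5 : (1 : ℝ) ≤ d := by exact_mod_cast hd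
  rw [div_le_one (by linarith)]
  linarith

theorem biasExponent_le_one (hd : 1 ≤ d) (hω : 0 < ω) (hω' : ω ≤ 1 / 5) (hπ : 0 ≤ π)
    (hπ' : π ≤ 1) : biasExponent d ω π ≤ 1 := by
  have h1 : Real.log (1 - ω) ≤ 0 := Real.log_nonpos (by linarith) (by linarith)
  have h2 : Real.log ω < 0 := Real.log_neg hω (by linarith)
  have h3 := div_nonneg_of_nonpos h1 h2.le
  have h4 : Real.log (1 - ω) / Real.log ω ≤ 1 := by
    rw [div_le_one_of_neg h2]
    exact Real.log_le_log hω (by linarith)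
  have h7 : 0 ≤ π / d := by positivity
  unfold biasExponent
  nlinarith [div_dim_le_one hd hπ', mul_le_one₀ h4 h7 (div_dim_le_one hd hπ')]

/-- The left side is at most 1/2 · 5/4 = 5/8 times ω(π/d)/(-log ω), and 5/8 < 16/25 = (4/5)². One
factor 4/5 is given up in the shortening of the sides, the other in the depth. -/
theorem biasExponent_le (hω : 0 < ω) (hω' : ω ≤ 1 / 5) (hπ : 0 ≤ π) :
    biasExponent d ω π ≤ 4 / 5 * ω * (π / d) * (4 / 5 / (-Real.log ω)) := by
  have h2 : 0 < -Real.log ω := neg_pos.2 (Real.log_neg hω (by linarith))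
  have h7 : 0 ≤ π / d := by positivity
  have h8 : Real.log (1 - ω) / Real.log ω ≤ 5 / 4 * ω / (-Real.log ω) := by
    rw [← neg_div_neg_eq]
    gcongr
    exact neg_log_one_sub_le hω hω'
  have h9 : 0 ≤ ω / (-Real.log ω) := by positivity
  calc biasExponent d ω π ≤ 1 / 2 * (5 / 4 * ω / (-Real.log ω)) * (π / d) := by
        unfold biasExponent
        gcongr
    _ = 5 / 8 * (ω / (-Real.log ω) * (π / d)) := by ring
    _ ≤ 16 / 25 * (ω / (-Real.log ω) * (π / d)) :=
        mul_le_mul_of_nonneg_right (by norm_num) (by positivity)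
    _ = _ := by ring

/-- The depth up to which the nodes are analysed. -/
def analysisDepth (ω : ℝ) (b : ℕ) : ℕ := ⌊4 / 5 * Real.log b / (-Real.log ω)⌋₊

/-- The depth is chosen so that ω^H ≥ b^(-4/5): all nodes considered keep a positive power of `b`
points. -/
theorem rpow_le_pow_analysisDepth_mul (hω : 0 < ω) (hω' : ω ≤ 1 / 5) {b : ℕ} (hb : 1 ≤ b) :
    (b : ℝ) ^ (1 / 5 : ℝ) ≤ ω ^ analysisDepth ω b * b := by
  have hb' : (1 : ℝ) ≤ b := by exact_mod_cast hb
  have hb0 : (0 : ℝ) < b := by linarith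
  have h2 : 0 < -Real.log ω := neg_pos.2 (Real.log_neg hω (by linarith))
  have hx : (0 : ℝ) ≤ 4 / 5 * Real.log b / (-Real.log ω) := by
    have := Real.log_nonneg hb'
    positivity
  have h3 : (analysisDepth ω b : ℝ) * (-Real.log ω) ≤ 4 / 5 * Real.log b := by
    rw [← le_div_iff₀ h2]
    exact Nat.floor_le hx
  rw [← Real.rpow_natCast, Real.rpow_def_of_pos hb0, Real.rpow_def_of_pos hω]
  nth_rewrite 2 [← Real.exp_log hb0]
  rw [← Real.exp_add]
  gcongr
  linarith

/-- After 1 - z ≤ e^(-z), rounding the depth down costs a factor e^z with z ≤ 1, hence at most e <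
3. -/
theorem pow_analysisDepth_le (hd : 1 ≤ d) (hω : 0 < ω) (hω' : ω ≤ 1 / 5) (hπ : 0 ≤ π)
    (hπ' : π ≤ 1) {b : ℕ} (hb : 1 ≤ b) :
    (1 - 4 / 5 * ω * (π / d)) ^ analysisDepth ω b ≤ 3 * (b : ℝ) ^ (-biasExponent d ω π) := by
  have hb' : (1 : ℝ) ≤ b := by exact_mod_cast hb
  have hb0 : (0 : ℝ) < b := by linarith
  have h2 : 0 < -Real.log ω := neg_pos.2 (Real.log_neg hω (by linarith))
  have h7 : 0 ≤ π / d := by positivity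
  have h8 := div_dim_le_one hd hπ'
  have hlog := Real.log_nonneg hb'
  set z := 4 / 5 * ω * (π / d) with hz
  have hz0 : 0 ≤ z := by positivity
  have hz1 : z ≤ 1 := by
    have : ω * (π / d) ≤ 1 := mul_le_one₀ (by linarith) h7 h8
    rw [hz]; nlinarith
  have h3 : 4 / 5 * Real.log b / (-Real.log ω) - 1 ≤ analysisDepth ω b :=
    (Nat.sub_one_lt_floor _).le
  have h4 : biasExponent d ω π * Real.log b ≤ z * (4 / 5 * Real.log b / (-Real.log ω)) := by
    have := mul_le_mul_of_nonneg_right (biasExponent_le (d := d) hω hω' hπ) hlog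
    rw [← hz] at this
    refine this.trans (le_of_eq ?_)
    ring
  calc (1 - z) ^ analysisDepth ω b ≤ (Real.exp (-z)) ^ analysisDepth ω b :=
        pow_le_pow_left₀ (by linarith) (Real.one_sub_le_exp_neg z) _
    _ = Real.exp (analysisDepth ω b * (-z)) := by rw [← Real.exp_nat_mul]
    _ ≤ Real.exp (1 + Real.log b * (-biasExponent d ω π)) := by
        gcongr
        nlinarith [mul_le_mul_of_nonneg_left h3 hz0]
    _ = Real.exp 1 * (b : ℝ) ^ (-biasExponent d ω π) := by
        rw [Real.exp_add, ← Real.rpow_def_of_pos hb0]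
    _ ≤ _ := by
        gcongr
        linarith [Real.exp_one_lt_d9]

/-- For s ≥ 2 the estimation half has at least s/3 points, and the exponent is at most 1. -/
theorem rpow_half_le (hd : 1 ≤ d) (hω : 0 < ω) (hω' : ω ≤ 1 / 5) (hπ : 0 ≤ π)
    (hπ' : π ≤ 1) {s : ℕ} (hs : 2 ≤ s) :
    ((s / 2 : ℕ) : ℝ) ^ (-biasExponent d ω π) ≤ 3 * (s : ℝ) ^ (-biasExponent d ω π) := by
  have h0 := biasExponent_nonneg (d := d) hω hω' hπ
  have h1 := biasExponent_le_one hd hω hω' hπ hπ'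
  have hs0 : (0 : ℝ) < s := by exact_mod_cast (by omega : 0 < s)
  have h3 : (s : ℝ) / 3 ≤ (s / 2 : ℕ) := by
    rw [div_le_iff₀ (by norm_num)]
    exact_mod_cast (by omega : s ≤ s / 2 * 3)
  calc ((s / 2 : ℕ) : ℝ) ^ (-biasExponent d ω π) ≤ ((s : ℝ) / 3) ^ (-biasExponent d ω π) :=
        Real.rpow_le_rpow_of_nonpos (by positivity) h3 (by linarith)
    _ = (3 : ℝ) ^ biasExponent d ω π * (s : ℝ) ^ (-biasExponent d ω π) := by
        rw [Real.div_rpow hs0.le (by norm_num), Real.rpow_neg (by norm_num : (0 : ℝ) ≤ 3), div_inv_eq_mul,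
          mul_comm]
    _ ≤ _ := by
        gcongr
        nth_rewrite 2 [← Real.rpow_one 3]
        exact Real.rpow_le_rpow_of_exponent_le (by norm_num) h1

theorem depthBound_analysisDepth (hω : 0 < ω) (hω' : ω ≤ 1 / 5) (d k : ℕ) :
    ∀ᶠ b : ℕ in atTop, DepthBound d k ω b (analysisDepth ω b) ((b : ℝ) ^ (1 / 5 : ℝ)) := by
  have h1 : Tendsto (fun b : ℕ => (b : ℝ) ^ (1 / 5 : ℝ)) atTop atTop :=
    (tendsto_rpow_atTop (by norm_num)).comp tendsto_natCast_atTop_atTop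
  filter_upwards [h1.eventually_ge_atTop (100 * (d : ℝ)), h1.eventually_ge_atTop (2 * (k : ℝ)),
    eventually_ge_atTop 1] with b h2 h3 h4
  exact ⟨h2, h3, rpow_le_pow_analysisDepth_mul hω hω' h4⟩

theorem tendsto_badDesign_bound (e : ℕ) :
    Tendsto (fun b : ℕ => 6 * ((b : ℝ) + 2) ^ e * Real.exp (-((b : ℝ) ^ (1 / 5 : ℝ) / 1800)))
      atTop (𝓝 0) := by
  have h1 : Tendsto (fun b : ℕ => (b : ℝ) ^ (1 / 5 : ℝ) / 1800) atTop atTop :=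
    ((tendsto_rpow_atTop (by norm_num)).comp tendsto_natCast_atTop_atTop).atTop_div_const
      (by norm_num)
  have h2 := ((Real.tendsto_pow_mul_exp_neg_atTop_nhds_zero (5 * e)).comp h1).const_mul
    (6 * 3 ^ e * 1800 ^ (5 * e))
  rw [mul_zero] at h2
  refine squeeze_zero' (Eventually.of_forall fun b => by positivity) ?_ h2
  filter_upwards [eventually_ge_atTop 1] with b hb
  have hb' : (1 : ℝ) ≤ b := by exact_mod_cast hb
  have h3 : ((b : ℝ) ^ (1 / 5 : ℝ)) ^ (5 * e) = (b : ℝ) ^ e := by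
    rw [pow_mul, ← Real.rpow_natCast _ 5, ← Real.rpow_mul (by positivity)]
    norm_num
  have h4 : ((b : ℝ) + 2) ^ e ≤ (3 * b) ^ e := by
    gcongr
    linarith
  simp only [Function.comp]
  rw [div_pow, h3]
  have h5 : 6 * 3 ^ e * 1800 ^ (5 * e) * ((b : ℝ) ^ e / 1800 ^ (5 * e) *
      Real.exp (-((b : ℝ) ^ (1 / 5 : ℝ) / 1800))) =
      6 * (3 * b) ^ e * Real.exp (-((b : ℝ) ^ (1 / 5 : ℝ) / 1800)) := by
    rw [mul_pow]
    field_simp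
  rw [h5]
  gcongr

end Exponent

/-! ### Noise against the number of representatives -/

section NoiseExponent

/-- The exponential bound beats the number of nodes. -/
theorem noise_bound_le {d n p s N b c : ℕ} {σ T K A : ℝ} (hn : 3 ≤ n) (hp : 1 ≤ p) (hs : 2 ≤ s)
    (hsn : s ≤ n) (hN : N = n / s) (hb : b = s / 2) (hc : c ≤ p ^ 2) (hT : 0 < T)
    (hA : A = 2 * d + 3) (hK : K = σ ^ 2 * T + 2 * A / T) :
    (2 * c * (N * (b * b) + 1) ^ d : ℕ) * Real.exp (σ ^ 2 *
      ((N * T * Real.sqrt ((s : ℝ) * (Real.log n + Real.log p) / n)) ^ 2 / N) -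
      (N * T * Real.sqrt ((s : ℝ) * (Real.log n + Real.log p) / n)) *
        (K * Real.sqrt ((s : ℝ) * (Real.log n + Real.log p) / n))) ≤ 2 / n := by
  have hn' : (3 : ℝ) ≤ n := by exact_mod_cast hn
  have hp' : (1 : ℝ) ≤ p := by exact_mod_cast hp
  have hs' : (2 : ℝ) ≤ s := by exact_mod_cast hs
  have hNpos : 1 ≤ N := by
    rw [hN, Nat.le_div_iff_mul_le (by omega)]
    omega
  have hN' : (1 : ℝ) ≤ N := by exact_mod_cast hNpos
  -- Rounding n/s down loses at most a factor 2, since the quotient is at least 1.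
  have hNn : (n : ℝ) ≤ 2 * (N * s) := by
    have h1 : n < s * N + s := by rw [hN]; exact Nat.lt_mul_div_succ n (by omega)
    have h2 : s * 1 ≤ s * N := by gcongr
    have : n ≤ 2 * (N * s) := by rw [mul_comm N s]; omega
    exact_mod_cast this
  have hlog : 0 ≤ Real.log n + Real.log p :=
    add_nonneg (Real.log_nonneg (by linarith)) (Real.log_nonneg hp')
  set L := Real.log n + Real.log p with hL
  set r := Real.sqrt ((s : ℝ) * L / n) with hr
  have hr2 : r ^ 2 = (s : ℝ) * L / n := Real.sq_sqrt (by positivity)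
  have hA0 : 0 < A := by rw [hA]; positivity
  have hNr : L ≤ 2 * (N * r ^ 2) := by
    rw [hr2]
    have h1 : 2 * (N * ((s : ℝ) * L / n)) = 2 * (N * s) * L / n := by ring
    rw [h1, le_div_iff₀ (by linarith), mul_comm]
    gcongr
  -- By the choice of `K` the exponent equals -2A N r², and N r² ≥ L/2. The resulting (np)^(-A) with
  -- A = 2d + 3 beats the count 2p²n^(2d) and leaves 2/n.
  have hexp : σ ^ 2 * ((N * T * r) ^ 2 / N) - (N * T * r) * (K * r) ≤ -(A * L) := by
    have h1 : σ ^ 2 * ((N * T * r) ^ 2 / N) - (N * T * r) * (K * r) = -(A * (2 * (N * r ^ 2))) := by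
      rw [hK]
      field_simp
      ring
    rw [h1]
    nlinarith
  have hcount : 2 * c * (N * (b * b) + 1) ^ d ≤ 2 * p ^ 2 * (n ^ 2) ^ d := by
    have h1 : N * s ≤ n := by rw [hN]; exact Nat.div_mul_le_self n s
    have h2 : N * (b * b) + 1 ≤ n ^ 2 := by
      have h3 : b * 2 ≤ s := by rw [hb]; exact Nat.div_mul_le_self s 2
      have h4 : N * ((b * 2) * (b * 2)) ≤ N * (s * s) := by gcongr
      have h5 : (N * s) * s ≤ n * n := by gcongr
      nlinarith
    gcongr
  have hL' : Real.exp (-(A * L)) = ((n : ℝ) * p) ^ (-A) := by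
    rw [Real.rpow_def_of_pos (by positivity), Real.log_mul (by positivity) (by positivity)]
    congr 1
    rw [← hL]
    ring
  calc _ ≤ ((2 * p ^ 2 * (n ^ 2) ^ d : ℕ) : ℝ) * Real.exp (-(A * L)) := by
        gcongr
    _ ≤ 2 / n := by
        have h6 : ((n : ℝ) * p) ^ (-A) = 1 / ((n : ℝ) * p) ^ (2 * d + 3) := by
          rw [Real.rpow_neg (by positivity), one_div, hA, ← Real.rpow_natCast]
          push_cast
          rfl
        rw [hL', h6, mul_one_div, div_le_div_iff₀ (by positivity) (by positivity)]
        push_cast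
        have h7 : ((n : ℝ) ^ 2) ^ d * n ≤ (n : ℝ) ^ (2 * d + 3) := by
          rw [← pow_mul, ← pow_succ]
          exact pow_le_pow_right₀ (by linarith) (by omega)
        have h8 : (p : ℝ) ^ 2 ≤ (p : ℝ) ^ (2 * d + 3) := pow_le_pow_right₀ hp' (by omega)
        rw [mul_pow]
        calc 2 * (p : ℝ) ^ 2 * ((n : ℝ) ^ 2) ^ d * n = 2 * ((((n : ℝ) ^ 2) ^ d * n) * (p : ℝ) ^ 2) := by
              ring
          _ ≤ _ := by gcongr

/-- Absorbs the mixture error, which will be 1/n, into the rate. -/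
theorem inv_le_sqrt_rate {n p s : ℕ} (hn : 3 ≤ n) (hp : 1 ≤ p) (hs : 1 ≤ s) :
    1 / (n : ℝ) ≤ Real.sqrt ((s : ℝ) * (Real.log n + Real.log p) / n) := by
  have hn' : (3 : ℝ) ≤ n := by exact_mod_cast hn
  have hp' : (1 : ℝ) ≤ p := by exact_mod_cast hp
  have hs' : (1 : ℝ) ≤ s := by exact_mod_cast hs
  have h1 : 1 ≤ Real.log n := by
    rw [Real.le_log_iff_exp_le (by linarith)]
    linarith [Real.exp_one_lt_d9]
  have h2 := Real.log_nonneg hp'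
  refine Real.le_sqrt_of_sq_le ?_
  calc (1 / (n : ℝ)) ^ 2 = 1 / n / n := by ring
    _ ≤ (s : ℝ) * (Real.log n + Real.log p) / n := by
        gcongr
        calc 1 / (n : ℝ) ≤ 1 := by rw [div_le_one (by linarith)]; linarith
          _ ≤ 1 * (1 + 0) := by norm_num
          _ ≤ _ := by gcongr

end NoiseExponent

/-- A number of trees from which on the forest is close to its limit. -/
def enoughTrees (d n p a b : ℕ) (e : ℝ) : ℕ :=
  ⌈(n : ℝ) * ((Nat.card ((Fin a ⊕ Fin b) ↪ Fin n) : ℝ) ^ 3 / (1 / ((n : ℝ) ^ 2 * p)) ^ 2 +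
    (n : ℝ) ^ d * (d ^ 2 / e ^ 2))⌉₊ + 1

theorem div_natCast_le_of_mul_le {X : ℝ} {n B : ℕ} (hn : 0 < n) (hB : 0 < B)
    (h : (n : ℝ) * X ≤ B) : X / B ≤ 1 / n := by
  have hn' : (0 : ℝ) < n := by exact_mod_cast hn
  have hB' : (0 : ℝ) < B := by exact_mod_cast hB
  rw [div_le_div_iff₀ hB' hn']
  linarith

/-- A forest estimates the conditional means of finitely many statistics uniformly. -/
theorem exists_forest_deviation {d k : ℕ} (hd : 1 ≤ d) (hk : 1 ≤ k) {ω π : ℝ} (hω : 0 < ω)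
    (hω' : ω ≤ 1 / 5) (hπ : 0 ≤ π) (hπ' : π ≤ 1) (CL σ m : ℝ) :
    ∃ C : ℝ, 0 < C ∧ ∀ (p s : ℕ → ℕ), (∀ n, 0 < p n) → Tendsto s atTop atTop →
      Tendsto (fun n : ℕ => (s n : ℝ) / n) atTop (𝓝 0) →
      ∃ (B₀ : ℕ → ℕ) (err : ℕ → ℝ), Tendsto err atTop (𝓝 0) ∧
        ∀ᶠ n in atTop, rate d ω π n (p n) (s n) ≤ 1 → ∀ B, B₀ n ≤ B →
        ∀ R : TreeRule d (p n) (s n - s n / 2) (s n / 2), R.IsRegular k ω π →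
        ∀ κ : Kernel (Cube d) (Fin (p n) → ℝ), IsMarkovKernel κ →
        ∀ (ι : Type) [Fintype ι], Fintype.card ι ≤ p n ^ 2 →
        ∀ Φ : ι → (Fin (p n) → ℝ) → ℝ, (∀ i, Measurable (Φ i)) →
        (∀ i u, Bernstein σ m (κ u) (Φ i)) →
        (∀ i u u', |∫ y, Φ i y ∂κ u - ∫ y, Φ i y ∂κ u'| ≤ CL * dist u u') →
        ((Measure.pi fun _ : Fin n => (volume : Measure (Cube d)) ⊗ₘ κ).prod
          (forestSeedLaw B n (s n - s n / 2) (s n / 2)))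
          {x | ∃ u i, C * rate d ω π n (p n) (s n) <
            |∑ j, forestWeight R k x.1 x.2 u j * Φ i (x.1 j).2 - ∫ y, Φ i y ∂κ u|} ≤
          ENNReal.ofReal (err n) := by
  -- Exponents up to `T` satisfy |t||m| ≤ 1/2, also when `m = 0`.
  set T : ℝ := 1 / (2 * (|m| + 1)) with hT
  have hT0 : 0 < T := by positivity
  set A : ℝ := 2 * d + 3 with hA
  set K' : ℝ := σ ^ 2 * T + 2 * A / T with hK'
  have hK'0 : 0 ≤ K' := by positivity
  -- `K'` pays for the noise, 1 for the mixture error 1/n, and the last term for the bias: 18d is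
  -- twice the bound 9d for the mean node size, and the final 1 is the share of irregular designs.
  refine ⟨K' + 1 + |CL| * (2 ^ d * (18 * d) + 1), by positivity, ?_⟩
  intro p s hp hs hsn
  set S : ℕ → ℝ := fun n => (s n : ℝ) ^ (-biasExponent d ω π) with hS
  refine ⟨fun n => enoughTrees d n (p n) (s n - s n / 2) (s n / 2) (9 * d * S n),
    fun n => 1 / n + σ ^ 2 / n + 2 / n + 1 / n +
      6 * (((s n / 2 : ℕ) : ℝ) + 2) ^ (2 * d + 1) *
        Real.exp (-(((s n / 2 : ℕ) : ℝ) ^ (1 / 5 : ℝ) / 1800)), ?_, ?_⟩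
  · have hb : Tendsto (fun n => s n / 2) atTop atTop := by
      refine tendsto_atTop.2 fun x => ?_
      filter_upwards [hs.eventually_ge_atTop (2 * x)] with n hn
      omega
    have h1 := (tendsto_badDesign_bound (2 * d + 1)).comp hb
    have h2 := fun c : ℝ => tendsto_const_div_atTop_nhds_zero_nat c
    simpa using ((((h2 1).add (h2 (σ ^ 2))).add (h2 2)).add (h2 1)).add h1
  have hb : Tendsto (fun n => s n / 2) atTop atTop := by
    refine tendsto_atTop.2 fun x => ?_
    filter_upwards [hs.eventually_ge_atTop (2 * x)] with n hn
    omega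
  filter_upwards [eventually_ge_atTop 3, hs.eventually_ge_atTop 2,
    hsn.eventually_le_const (zero_lt_one' ℝ), hb.eventually (depthBound_analysisDepth hω hω' d k),
    hb.eventually_ge_atTop k] with n hn hs2 hsn1 hH hkb hrate B hB R hR κ hκ ι _ hι Φ hΦ hBern hLip
  have hn' : (3 : ℝ) ≤ n := by exact_mod_cast hn
  have hp1 : 1 ≤ p n := hp n
  have hp' : (1 : ℝ) ≤ p n := by exact_mod_cast hp1
  have hs' : (2 : ℝ) ≤ s n := by exact_mod_cast hs2
  have hd' : (1 : ℝ) ≤ d := by exact_mod_cast hd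
  have hsle : s n ≤ n := by
    rw [div_le_one (by linarith)] at hsn1
    exact_mod_cast hsn1
  have hab : s n - s n / 2 + s n / 2 = s n := by omega
  set b := s n / 2 with hbdef
  set a := s n - b with hadef
  have hN : 0 < n / s n := Nat.div_pos hsle (by omega)
  have hNn : n / s n * (a + b) ≤ n := by rw [hab]; exact Nat.div_mul_le_self n _
  have hSpos : 0 < S n := Real.rpow_pos_of_pos (by linarith) _
  -- The bias term decays no faster than 1/s, so dividing the probability of bad designs by `S n`
  -- costs only one more factor of order `b`.
  have hS1 : (s n : ℝ) * S n ≥ 1 := by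
    rw [hS]
    nth_rewrite 1 [← Real.rpow_one (s n : ℝ)]
    rw [← Real.rpow_add (by linarith)]
    exact Real.one_le_rpow (by linarith) (by linarith [biasExponent_le_one hd hω hω' hπ hπ'])
  have hratee := rate_eq d ω π n (p n) (s n)
  set r := Real.sqrt ((s n : ℝ) * (Real.log n + Real.log (p n)) / n) with hr
  have hr0 : 0 ≤ r := Real.sqrt_nonneg _
  change rate d ω π n (p n) (s n) = r + S n at hratee
  have hr1 : r ≤ 1 := by linarith
  have hnr : 1 / (n : ℝ) ≤ r := inv_le_sqrt_rate hn hp1 (by omega)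
  have he : 0 < 9 * d * S n := by positivity
  have hle : d * (1 - 4 / 5 * ω * (π / d)) ^ analysisDepth ω b ≤ 9 * d * S n := by
    have h1 := pow_analysisDepth_le hd hω hω' hπ hπ' (b := b) (by omega)
    have h2 := rpow_half_le hd hω hω' hπ hπ' hs2
    calc _ ≤ d * (3 * (3 * S n)) := by
          gcongr
          exact h1.trans (by gcongr)
      _ = _ := by ring
  have hB0 : 0 < B := lt_of_lt_of_le (Nat.succ_pos _) hB
  have hB' : (0 : ℝ) < B := by exact_mod_cast hB0
  have hBle : (n : ℝ) * ((Nat.card ((Fin a ⊕ Fin b) ↪ Fin n) : ℝ) ^ 3 /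
      (1 / ((n : ℝ) ^ 2 * p n)) ^ 2 + (n : ℝ) ^ d * (d ^ 2 / (9 * d * S n) ^ 2)) ≤ B := by
    refine (Nat.le_ceil _).trans ?_
    exact_mod_cast (Nat.le_succ _).trans hB
  have hδ0 : (0 : ℝ) < 1 / ((n : ℝ) ^ 2 * p n) := by positivity
  have hδ1 : 1 / ((n : ℝ) ^ 2 * p n) ≤ 1 := by
    rw [div_le_one (by positivity)]
    nlinarith [one_le_pow₀ (n := 2) (by linarith : (1 : ℝ) ≤ n)]
  -- The residual level np has exceedance probability at most σ²/n, and δ = 1/(n²p) reduces it to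
  -- the mixture error 1/n. The exponent N T r is admissible because r ≤ 1, and the tolerated share
  -- of bad designs is the bias rate itself.
  have key := hH.measure_forest_deviation_le hd hk hkb hω (by linarith) hπ hπ' hB0 hN hNn
    (by omega) hR κ hΦ hBern (abs_nonneg CL)
    (fun i u u' => (hLip i u u').trans
      (mul_le_mul_of_nonneg_right (le_abs_self _) dist_nonneg)) he hle hδ0 hδ1
    (Kη := n * p n) (by positivity) (c := (n / s n : ℕ) * T * r) (by positivity)
    (by rw [mul_assoc]; gcongr; exact mul_le_of_le_one_right hT0.le hr1) (K' * r) hSpos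
  refine (measure_mono ?_).trans (key.trans ?_)
  · rintro x ⟨u, i, hx⟩
    refine ⟨u, i, lt_of_le_of_lt ?_ hx⟩
    rw [hratee]
    have h1 : 1 / ((n : ℝ) ^ 2 * p n) * (n * p n) = 1 / n := by field_simp
    have h2 : |CL| * (2 ^ d * (2 * (9 * d * S n)) + S n) = |CL| * (2 ^ d * (18 * d) + 1) * S n := by
      ring
    rw [h1, h2]
    have h3 : 0 ≤ |CL| * (2 ^ d * (18 * d) + 1) := by positivity
    nlinarith [mul_nonneg h3 hr0, mul_nonneg hK'0 hSpos.le]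
  · have e1 : (Nat.card ((Fin a ⊕ Fin b) ↪ Fin n) : ℝ) ^ 3 /
        (B * (1 / ((n : ℝ) ^ 2 * p n)) ^ 2) ≤ 1 / n := by
      rw [mul_comm (B : ℝ), ← div_div]
      refine div_natCast_le_of_mul_le (by omega) hB0 (le_trans ?_ hBle)
      gcongr
      exact le_add_of_nonneg_right (by positivity)
    have e4 : (n : ℝ) ^ d * (d ^ 2 / (B * (9 * d * S n) ^ 2)) ≤ 1 / n := by
      rw [mul_comm (B : ℝ), ← div_div, ← mul_div_assoc]
      refine div_natCast_le_of_mul_le (by omega) hB0 (le_trans ?_ hBle)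
      gcongr
      exact le_add_of_nonneg_left (by positivity)
    have e2 : (Fintype.card ι * n * (σ ^ 2 / (n * p n) ^ 2) : ℝ) ≤ σ ^ 2 / n := by
      have : (Fintype.card ι : ℝ) ≤ (p n : ℝ) ^ 2 := by exact_mod_cast hι
      calc (Fintype.card ι * n * (σ ^ 2 / (n * p n) ^ 2) : ℝ)
          ≤ (p n : ℝ) ^ 2 * n * (σ ^ 2 / (n * p n) ^ 2) := by gcongr
        _ = _ := by field_simp
    have e3 := noise_bound_le (d := d) (σ := σ) hn hp1 hs2 hsle rfl hbdef hι hT0 hA hK'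
    have e5 : 2 * ((b : ℝ) + 2) ^ (2 * d) * Real.exp (-((b : ℝ) ^ (1 / 5 : ℝ) / 1800)) / S n ≤
        6 * ((b : ℝ) + 2) ^ (2 * d + 1) * Real.exp (-((b : ℝ) ^ (1 / 5 : ℝ) / 1800)) := by
      have h1 : (s n : ℝ) ≤ 3 * (b + 2) := by exact_mod_cast (by omega : s n ≤ 3 * (b + 2))
      rw [div_le_iff₀ hSpos]
      have h2 : 1 ≤ 3 * ((b : ℝ) + 2) * S n := hS1.le.trans (by gcongr)
      calc 2 * ((b : ℝ) + 2) ^ (2 * d) * Real.exp (-((b : ℝ) ^ (1 / 5 : ℝ) / 1800))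
          = 2 * ((b : ℝ) + 2) ^ (2 * d) * Real.exp (-((b : ℝ) ^ (1 / 5 : ℝ) / 1800)) * 1 := by ring
        _ ≤ 2 * ((b : ℝ) + 2) ^ (2 * d) * Real.exp (-((b : ℝ) ^ (1 / 5 : ℝ) / 1800)) *
            (3 * ((b : ℝ) + 2) * S n) := by gcongr
        _ = _ := by ring
    rw [ENNReal.ofReal_add (by positivity) (by positivity),
      ENNReal.ofReal_add (by positivity) (by positivity),
      ENNReal.ofReal_add (by positivity) (by positivity),
      ENNReal.ofReal_add (by positivity) (by positivity)]
    refine add_le_add (add_le_add (add_le_add (add_le_add (ENNReal.ofReal_le_ofReal e1)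
      (ENNReal.ofReal_le_ofReal e2)) ?_) (ENNReal.ofReal_le_ofReal e4)) (ENNReal.ofReal_le_ofReal e5)
    rw [← ENNReal.ofReal_natCast, ← ENNReal.ofReal_mul (Nat.cast_nonneg _)]
    exact ENNReal.ofReal_le_ofReal e3

/-! ### Thresholding and inverting matrices -/

section Matrix

variable {p : ℕ}

theorem norm_toEuclideanCLM_sq (A : Matrix (Fin p) (Fin p) ℝ) (x : EuclideanSpace ℝ (Fin p)) :
    ‖Matrix.toEuclideanCLM (n := Fin p) (𝕜 := ℝ) A x‖ ^ 2 = ∑ j, (∑ r, A j r * x r) ^ 2 := by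
  rw [EuclideanSpace.real_norm_sq_eq]
  rfl

/-- Schur's test. -/
theorem specNorm_le_of_sum_le {A : Matrix (Fin p) (Fin p) ℝ} {R : ℝ} (hR : 0 ≤ R)
    (hrow : ∀ j, ∑ r, |A j r| ≤ R) (hcol : ∀ r, ∑ j, |A j r| ≤ R) : specNorm A ≤ R := by
  refine ContinuousLinearMap.opNorm_le_bound _ hR fun x => ?_
  refine abs_le_of_sq_le_sq' ?_ (by positivity) |>.2
  rw [norm_toEuclideanCLM_sq, mul_pow, EuclideanSpace.real_norm_sq_eq]
  calc ∑ j, (∑ r, A j r * x r) ^ 2 ≤ ∑ j, R * ∑ r, |A j r| * x r ^ 2 := by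
        refine Finset.sum_le_sum fun j _ => ?_
        have h1 : (∑ r, A j r * x r) ^ 2 ≤ (∑ r, |A j r|) * ∑ r, |A j r| * x r ^ 2 := by
          refine Finset.sum_sq_le_sum_mul_sum_of_sq_le_mul _ (fun r _ => abs_nonneg _)
            (fun r _ => by positivity) fun r _ => le_of_eq ?_
          rw [mul_pow, ← mul_assoc, ← sq, sq_abs]
        refine h1.trans (mul_le_mul_of_nonneg_right (hrow j) ?_)
        exact Finset.sum_nonneg fun r _ => by positivity
    _ = R * ∑ r, (∑ j, |A j r|) * x r ^ 2 := by
        rw [← Finset.mul_sum, Finset.sum_comm]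
        simp only [Finset.sum_mul]
    _ ≤ R * ∑ r, R * x r ^ 2 := by
        gcongr with r
        exact hcol r
    _ = _ := by rw [← Finset.mul_sum]; ring

/-- The quadratic form of `A` is at least `ε ‖x‖²`. -/
def Coercive (ε : ℝ) (A : Matrix (Fin p) (Fin p) ℝ) : Prop :=
  ∀ x : EuclideanSpace ℝ (Fin p),
    ε * ‖x‖ ^ 2 ≤ inner ℝ x (Matrix.toEuclideanCLM (n := Fin p) (𝕜 := ℝ) A x)

theorem Coercive.of_eigenvalues {A : Matrix (Fin p) (Fin p) ℝ} (h : A.IsHermitian) {ε : ℝ}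
    (he : ∀ i, ε ≤ h.eigenvalues i) : Coercive ε A := by
  intro x
  set T := Matrix.toEuclideanCLM (n := Fin p) (𝕜 := ℝ) A with hT
  set v := h.eigenvectorBasis with hv
  have hTv : ∀ i, T (v i) = h.eigenvalues i • v i := by
    intro i
    have := h.mulVec_eigenvectorBasis i
    ext j
    exact congrFun this j
  have hsym : ∀ y z, inner ℝ (T y) z = inner ℝ y (T z) := by
    have h1 : IsSelfAdjoint T := by
      rw [IsSelfAdjoint, hT, ← map_star]
      congr 1
    have h2 := (ContinuousLinearMap.isSelfAdjoint_iff_isSymmetric.1 h1)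
    exact fun y z => h2 y z
  have h1 : inner ℝ x (T x) = ∑ i, h.eigenvalues i * inner ℝ (v i) x ^ 2 := by
    rw [← v.sum_inner_mul_inner x (T x)]
    refine Finset.sum_congr rfl fun i _ => ?_
    rw [← hsym, hTv, inner_smul_left, real_inner_comm]
    simp
    ring
  rw [h1, ← v.sum_sq_norm_inner_right x, Finset.mul_sum]
  refine Finset.sum_le_sum fun i _ => ?_
  rw [Real.norm_eq_abs, sq_abs]
  exact mul_le_mul_of_nonneg_right (he i) (sq_nonneg _)

theorem Coercive.le_diag {A : Matrix (Fin p) (Fin p) ℝ} {ε : ℝ} (h : Coercive ε A) (j : Fin p) :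
    ε ≤ A j j := by
  have := h (EuclideanSpace.single j 1)
  rw [PiLp.norm_single, EuclideanSpace.inner_single_left] at this
  have h2 : Matrix.toEuclideanCLM (n := Fin p) (𝕜 := ℝ) A (EuclideanSpace.single j 1) j = A j j := by
    change ∑ r, A j r * (EuclideanSpace.single j (1 : ℝ) : EuclideanSpace ℝ (Fin p)) r = A j j
    simp
  simpa [h2] using this

theorem Coercive.norm_le {A : Matrix (Fin p) (Fin p) ℝ} {ε : ℝ} (h : Coercive ε A)
    (x : EuclideanSpace ℝ (Fin p)) :
    ε * ‖x‖ ≤ ‖Matrix.toEuclideanCLM (n := Fin p) (𝕜 := ℝ) A x‖ := by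
  rcases (norm_nonneg x).eq_or_lt with h0 | h0
  · rw [← h0, mul_zero]; positivity
  · have h1 := (h x).trans (real_inner_le_norm _ _)
    nlinarith

theorem Coercive.isUnit {A : Matrix (Fin p) (Fin p) ℝ} {ε : ℝ} (hε : 0 < ε) (h : Coercive ε A) :
    IsUnit A := by
  rw [← Matrix.mulVec_injective_iff_isUnit]
  intro y z hyz
  have h1 := h.norm_le (WithLp.toLp 2 (y - z))
  have h2 : Matrix.toEuclideanCLM (n := Fin p) (𝕜 := ℝ) A (WithLp.toLp 2 (y - z)) = 0 := by
    ext j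
    change (A.mulVec (y - z)) j = 0
    rw [Matrix.mulVec_sub, hyz, sub_self]
    rfl
  rw [h2, norm_zero] at h1
  have h3 : ‖WithLp.toLp 2 (y - z)‖ = 0 := le_antisymm (by nlinarith) (norm_nonneg _)
  have h4 := norm_eq_zero.1 h3
  have h5 : y - z = 0 := congrArg WithLp.ofLp h4
  exact sub_eq_zero.1 h5

theorem Coercive.specNorm_inv_le {A : Matrix (Fin p) (Fin p) ℝ} {ε : ℝ} (hε : 0 < ε)
    (h : Coercive ε A) : specNorm A⁻¹ ≤ 1 / ε := by
  refine ContinuousLinearMap.opNorm_le_bound _ (by positivity) fun y => ?_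
  have h1 := h.norm_le (Matrix.toEuclideanCLM (n := Fin p) (𝕜 := ℝ) A⁻¹ y)
  have h2 : Matrix.toEuclideanCLM (n := Fin p) (𝕜 := ℝ) A
      (Matrix.toEuclideanCLM (n := Fin p) (𝕜 := ℝ) A⁻¹ y) = y := by
    rw [← mul_apply_eq_comp, ← map_mul, Matrix.mul_nonsing_inv _
      ((Matrix.isUnit_iff_isUnit_det _).1 (h.isUnit hε)), map_one]
    rfl
  rw [h2] at h1
  rw [div_mul_eq_mul_div, one_mul, le_div_iff₀ hε]
  linarith

theorem Coercive.add_of_specNorm_le {A E : Matrix (Fin p) (Fin p) ℝ} {ε δ : ℝ} (h : Coercive ε A)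
    (hE : specNorm E ≤ δ) : Coercive (ε - δ) (A + E) := by
  intro x
  rw [map_add, add_apply, inner_add_right]
  have h1 := h x
  have h2 := abs_real_inner_le_norm x (Matrix.toEuclideanCLM (n := Fin p) (𝕜 := ℝ) E x)
  have h3 : ‖Matrix.toEuclideanCLM (n := Fin p) (𝕜 := ℝ) E x‖ ≤ δ * ‖x‖ :=
    ContinuousLinearMap.le_of_opNorm_le _ hE x
  have h4 := mul_le_mul_of_nonneg_left h3 (norm_nonneg x)
  have h5 := neg_abs_le (inner ℝ x (Matrix.toEuclideanCLM (n := Fin p) (𝕜 := ℝ) E x))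
  nlinarith

theorem specNorm_mul_le (A E : Matrix (Fin p) (Fin p) ℝ) :
    specNorm (A * E) ≤ specNorm A * specNorm E := by
  unfold specNorm
  rw [map_mul]
  exact norm_mul_le _ _

theorem specNorm_neg (A : Matrix (Fin p) (Fin p) ℝ) : specNorm (-A) = specNorm A := by
  unfold specNorm
  rw [map_neg, norm_neg]

theorem specNorm_nonneg (A : Matrix (Fin p) (Fin p) ℝ) : 0 ≤ specNorm A := norm_nonneg _

theorem frobSq_mul_le (A E : Matrix (Fin p) (Fin p) ℝ) :
    frobSq (A * E) ≤ specNorm A ^ 2 * frobSq E := by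
  unfold frobSq
  rw [Finset.sum_comm, Finset.sum_comm (f := fun j r => E j r ^ 2), Finset.mul_sum]
  refine Finset.sum_le_sum fun r _ => ?_
  have h1 := (Matrix.toEuclideanCLM (n := Fin p) (𝕜 := ℝ) A).le_opNorm
    (WithLp.toLp 2 fun j => E j r)
  have h2 := pow_le_pow_left₀ (norm_nonneg _) h1 2
  rw [norm_toEuclideanCLM_sq, mul_pow, EuclideanSpace.real_norm_sq_eq] at h2
  exact h2

theorem frobSq_transpose (A : Matrix (Fin p) (Fin p) ℝ) : frobSq A.transpose = frobSq A :=
  Finset.sum_comm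

theorem inv_sub_inv_eq {A E : Matrix (Fin p) (Fin p) ℝ} (hA : IsUnit A) (hE : IsUnit E) :
    A⁻¹ - E⁻¹ = -(A⁻¹ * (A - E) * E⁻¹) := by
  rw [Matrix.mul_sub, Matrix.sub_mul, Matrix.nonsing_inv_mul _
    ((Matrix.isUnit_iff_isUnit_det _).1 hA), Matrix.one_mul, Matrix.mul_assoc,
    Matrix.mul_nonsing_inv _ ((Matrix.isUnit_iff_isUnit_det _).1 hE), Matrix.mul_one, neg_sub]

theorem frobSq_neg (A : Matrix (Fin p) (Fin p) ℝ) : frobSq (-A) = frobSq A := by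
  simp [frobSq]

/-- Perturbation of the inverse. -/
theorem Coercive.inv_bounds {A E : Matrix (Fin p) (Fin p) ℝ} {ε : ℝ} (hε : 0 < ε)
    (hA : A.IsHermitian) (h : Coercive ε A) (hE : specNorm (E - A) ≤ ε / 2) :
    IsUnit E ∧ specNorm (E⁻¹ - A⁻¹) ≤ 2 / ε ^ 2 * specNorm (E - A) ∧
      frobSq (E⁻¹ - A⁻¹) ≤ 4 / ε ^ 4 * frobSq (E - A) := by
  have h2 : Coercive (ε / 2) E := by
    have := h.add_of_specNorm_le hE
    rwa [add_sub_cancel, sub_half] at this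
  have hu := h2.isUnit (half_pos hε)
  have h3 := h2.specNorm_inv_le (half_pos hε)
  have h4 := h.specNorm_inv_le hε
  have hsym : (A⁻¹).transpose = A⁻¹ := by
    have h5 : A.transpose = A := by
      ext i j
      simpa using hA.apply i j
    rw [Matrix.transpose_nonsing_inv, h5]
  rw [inv_sub_inv_eq hu (h.isUnit hε), specNorm_neg, frobSq_neg]
  refine ⟨hu, ?_, ?_⟩
  · calc specNorm (E⁻¹ * (E - A) * A⁻¹) ≤ specNorm E⁻¹ * specNorm (E - A) * specNorm A⁻¹ :=
          (specNorm_mul_le _ _).trans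
            (mul_le_mul_of_nonneg_right (specNorm_mul_le _ _) (specNorm_nonneg _))
      _ ≤ 1 / (ε / 2) * specNorm (E - A) * (1 / ε) := by
          have := specNorm_nonneg (E - A)
          have := specNorm_nonneg A⁻¹
          gcongr
      _ = _ := by field_simp
  -- A right factor is moved to the left by transposing, since `A⁻¹` is symmetric.
  · have h6 : frobSq ((E - A) * A⁻¹) ≤ specNorm A⁻¹ ^ 2 * frobSq (E - A) := by
      rw [← frobSq_transpose, Matrix.transpose_mul, hsym, ← frobSq_transpose (E - A)]
      exact frobSq_mul_le _ _
    have h7 : 0 ≤ frobSq (E - A) := Finset.sum_nonneg fun _ _ => Finset.sum_nonneg fun _ _ =>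
      sq_nonneg _
    rw [Matrix.mul_assoc]
    calc _ ≤ specNorm E⁻¹ ^ 2 * (specNorm A⁻¹ ^ 2 * frobSq (E - A)) :=
          (frobSq_mul_le _ _).trans (mul_le_mul_of_nonneg_left h6 (sq_nonneg _))
      _ ≤ (1 / (ε / 2)) ^ 2 * ((1 / ε) ^ 2 * frobSq (E - A)) := by
          have := specNorm_nonneg E⁻¹
          have := specNorm_nonneg A⁻¹
          gcongr
      _ = _ := by field_simp; ring

/-- `|z|^q`, with the convention `0^0 = 0`. -/
def sparsity (q z : ℝ) : ℝ := if z = 0 then 0 else |z| ^ q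

theorem sparsity_nonneg (q z : ℝ) : 0 ≤ sparsity q z := by
  unfold sparsity
  split_ifs
  · exact le_rfl
  · positivity

/-! ### Thresholding a single entry -/

section Entry

variable {q lam z σ : ℝ}

/-- A target of size at least λ/2 satisfies λ^q ≤ 2|σ|^q, so an error of order λ = λ^(1-q) λ^q is
paid for by the sparsity of the target. -/
theorem le_sparsity_of_half_le (hq : 0 ≤ q) (hq' : q < 1) (hl : 0 < lam) (h : lam / 2 ≤ |σ|) :
    3 / 2 * lam ≤ 4 * lam ^ (1 - q) * sparsity q σ := by
  have hσ : σ ≠ 0 := by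
    rintro rfl
    simp at h
    linarith
  have h1 : lam ^ q ≤ 2 * |σ| ^ q := by
    calc lam ^ q ≤ (2 * |σ|) ^ q := Real.rpow_le_rpow hl.le (by linarith) hq
      _ = 2 ^ q * |σ| ^ q := Real.mul_rpow (by norm_num) (abs_nonneg _)
      _ ≤ 2 ^ (1 : ℝ) * |σ| ^ q := by
          gcongr
          norm_num
      _ = _ := by rw [Real.rpow_one]
  have h2 : lam = lam ^ (1 - q) * lam ^ q := by
    rw [← Real.rpow_add hl]; simp
  have h3 : 0 ≤ lam ^ (1 - q) := by positivity
  rw [sparsity, if_neg hσ]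
  nth_rewrite 1 [h2]
  nlinarith [mul_le_mul_of_nonneg_left h1 h3, Real.rpow_nonneg (abs_nonneg σ) q,
    mul_nonneg h3 (Real.rpow_nonneg (abs_nonneg σ) q)]

/-- A small entry may be lost altogether: |σ| = |σ|^(1-q) |σ|^q, and the first factor is bounded by
the threshold. -/
theorem abs_le_sparsity (hq' : q < 1) (h : |σ| ≤ 3 / 2 * lam) (hl : 0 < lam) (hq : 0 ≤ q) :
    |σ| ≤ 4 * lam ^ (1 - q) * sparsity q σ := by
  unfold sparsity
  split_ifs with hσ
  · simp [hσ]
  · have h0 : 0 < |σ| := abs_pos.2 hσ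
    have h2 : |σ| = |σ| ^ (1 - q) * |σ| ^ q := by
      rw [← Real.rpow_add h0]; simp
    nth_rewrite 1 [h2]
    gcongr
    calc |σ| ^ (1 - q) ≤ (3 / 2 * lam) ^ (1 - q) :=
          Real.rpow_le_rpow h0.le h (by linarith)
      _ = (3 / 2) ^ (1 - q) * lam ^ (1 - q) := Real.mul_rpow (by norm_num) hl.le
      _ ≤ (3 / 2) ^ (1 : ℝ) * lam ^ (1 - q) := by
          gcongr
          · norm_num
          · linarith
      _ ≤ _ := by
          rw [Real.rpow_one]
          gcongr
          norm_num

/-- If `|z| ≤ lam` the entry is set to zero and the error is |σ|, at most 3λ/2. Otherwise |σ| > λ/2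
and the error is at most λ + λ/2. One of the two preceding bounds applies in each case. -/
theorem IsShrinkage.abs_sub_le_sparsity {S : ℝ → ℝ → ℝ} (hS : IsShrinkage S) (hq : 0 ≤ q)
    (hq' : q < 1) (hl : 0 < lam) (h : |z - σ| ≤ lam / 2) :
    |S lam z - σ| ≤ 2 * lam ∧ |S lam z - σ| ≤ 4 * lam ^ (1 - q) * sparsity q σ := by
  by_cases hz : |z| ≤ lam
  · rw [hS.eq_zero lam hl z hz, zero_sub, abs_neg]
    have h1 : |σ| ≤ 3 / 2 * lam := by
      have := abs_sub_abs_le_abs_sub σ z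
      rw [abs_sub_comm] at this
      linarith
    exact ⟨by linarith, abs_le_sparsity hq' h1 hl hq⟩
  · have h1 : |S lam z - σ| ≤ 3 / 2 * lam := by
      have := _root_.abs_sub_le (S lam z) z σ
      linarith [hS.abs_sub_le lam hl z]
    refine ⟨by linarith, h1.trans (le_sparsity_of_half_le hq hq' hl ?_)⟩
    have := abs_sub_abs_le_abs_sub z σ
    linarith [not_le.1 hz]

end Entry

/-- The entrywise bounds add up along rows and, by symmetry of the target, along columns, as Schur's
test requires; the Frobenius norm uses the largest entry times the row sum. The diagonal is not
thresholded, but its targets are at least ε ≥ Λ/2, so its error obeys the same bound. `Lam`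
dominates the thresholds at all points, which makes the result uniform. -/
theorem shrinkMatrix_bounds (hp : 0 < p) {Sig Est : Matrix (Fin p) (Fin p) ℝ} {S : ℝ → ℝ → ℝ}
    (hS : IsShrinkage S) {q lam Lam c ε : ℝ} (hq : 0 ≤ q) (hq' : q < 1) (hl : 0 < lam)
    (hlL : lam ≤ Lam) (hest : ∀ j r, |Est j r - Sig j r| ≤ lam / 2) (hε : 0 < ε)
    (hLε : Lam ≤ 2 * ε) (hherm : Sig.IsHermitian) (hco : Coercive ε Sig)
    (hsp : ∀ j, ∑ r, sparsity q (Sig j r) ≤ c) (hsmall : 4 * Lam ^ (1 - q) * c ≤ ε / 2) :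
    IsUnit (shrinkMatrix S lam Est) ∧
      specNorm ((shrinkMatrix S lam Est)⁻¹ - Sig⁻¹) ≤ 2 / ε ^ 2 * (4 * Lam ^ (1 - q) * c) ∧
      frobSq ((shrinkMatrix S lam Est)⁻¹ - Sig⁻¹) ≤
        4 / ε ^ 4 * (p * (2 * Lam * (4 * Lam ^ (1 - q) * c))) := by
  have hsym : ∀ j r, Sig j r = Sig r j := fun j r => by
    have := congrFun (congrFun hherm r) j
    simpa using this
  have hL0 : 0 < Lam := hl.trans_le hlL
  have hentry : ∀ j r, |(shrinkMatrix S lam Est - Sig) j r| ≤ 2 * Lam ∧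
      |(shrinkMatrix S lam Est - Sig) j r| ≤ 4 * Lam ^ (1 - q) * sparsity q (Sig j r) := by
    intro j r
    have hmono : 4 * lam ^ (1 - q) * sparsity q (Sig j r) ≤
        4 * Lam ^ (1 - q) * sparsity q (Sig j r) := by
      have := sparsity_nonneg q (Sig j r)
      have : 0 ≤ 1 - q := by linarith
      gcongr
    rw [Matrix.sub_apply, shrinkMatrix, Matrix.of_apply]
    split_ifs with hjr
    · subst hjr
      have h1 := hest j j
      have h2 := hco.le_diag j
      refine ⟨by linarith, le_trans ?_ hmono⟩
      refine le_trans (by linarith) (le_sparsity_of_half_le hq hq' hl ?_)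
      exact le_trans (by linarith) (le_abs_self _)
    · have h1 := hS.abs_sub_le_sparsity hq hq' hl (hest j r)
      exact ⟨by linarith [h1.1], h1.2.trans hmono⟩
  have hL1 : 0 ≤ 4 * Lam ^ (1 - q) := by positivity
  have hrow : ∀ j, ∑ r, |(shrinkMatrix S lam Est - Sig) j r| ≤ 4 * Lam ^ (1 - q) * c := by
    intro j
    refine (Finset.sum_le_sum fun r _ => (hentry j r).2).trans ?_
    rw [← Finset.mul_sum]
    exact mul_le_mul_of_nonneg_left (hsp j) hL1
  have hcol : ∀ r, ∑ j, |(shrinkMatrix S lam Est - Sig) j r| ≤ 4 * Lam ^ (1 - q) * c := by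
    intro r
    refine (Finset.sum_le_sum fun j _ => (hentry j r).2).trans ?_
    rw [← Finset.mul_sum]
    simp only [hsym _ r]
    exact mul_le_mul_of_nonneg_left (hsp r) hL1
  have hc : 0 ≤ 4 * Lam ^ (1 - q) * c :=
    (Finset.sum_nonneg fun r _ => abs_nonneg _).trans (hrow ⟨0, hp⟩)
  have hspec := specNorm_le_of_sum_le hc hrow hcol
  obtain ⟨h1, h2, h3⟩ := hco.inv_bounds hε hherm (hspec.trans hsmall)
  refine ⟨h1, h2.trans (by gcongr), h3.trans ?_⟩
  gcongr
  calc frobSq (shrinkMatrix S lam Est - Sig)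
      ≤ ∑ _j : Fin p, 2 * Lam * (4 * Lam ^ (1 - q) * c) := by
        refine Finset.sum_le_sum fun j _ => ?_
        calc ∑ r, (shrinkMatrix S lam Est - Sig) j r ^ 2
            ≤ ∑ r, 2 * Lam * |(shrinkMatrix S lam Est - Sig) j r| := by
              refine Finset.sum_le_sum fun r _ => ?_
              rw [← sq_abs, sq]
              exact mul_le_mul_of_nonneg_right (hentry j r).1 (abs_nonneg _)
          _ ≤ _ := by
              rw [← Finset.mul_sum]
              exact mul_le_mul_of_nonneg_left (hrow j) (by positivity)
    _ = _ := by simp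

end Matrix

/-! ### The estimated covariance matrix -/

section MeanBound

variable {E : Type*} [MeasurableSpace E] {μ : Measure E} [IsProbabilityMeasure μ] {f : E → ℝ}
  {σ m ε : ℝ}

/-- Bernstein's conditions for `f` and `f²` bound the mean of `f` if its variance is not small. -/
theorem Bernstein.sq_mean_le (hf : Bernstein σ m μ f) (hff : Bernstein σ m μ fun y => f y * f y)
    (hε : 0 < ε) (hvar : ε ≤ ∫ y, f y * f y ∂μ - (∫ y, f y ∂μ) * ∫ y, f y ∂μ) :
    (∫ y, f y ∂μ) ^ 2 ≤ σ ^ 2 * (1 + 12 * m ^ 2) / (2 * ε) := by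
  set c := ∫ y, f y ∂μ with hc
  set w := ∫ y, f y * f y ∂μ with hw
  obtain ⟨i2, -⟩ := hf.2 2 le_rfl
  obtain ⟨i4, h4⟩ := hf.2 4 (by norm_num)
  obtain ⟨j2, k2⟩ := hff.2 2 le_rfl
  rw [← hc] at i2 i4 h4
  rw [← hw] at j2 k2
  have hv : ∫ y, (f y - c) ^ 2 ∂μ = w - c * c := by
    have h1 : ∀ y, (f y - c) ^ 2 = f y * f y - (2 * c * f y - c * c) := fun y => by ring
    have h2 : Integrable (fun y => 2 * c * f y) μ := hf.1.const_mul _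
    have h3 : Integrable (fun y => 2 * c * f y - c * c) μ := h2.sub (integrable_const _)
    rw [integral_congr_ae (Eventually.of_forall h1), integral_sub hff.1 h3,
      integral_sub h2 (integrable_const _), integral_const_mul, ← hc, ← hw]
    simp
    ring
  set v := w - c * c with hvdef
  -- From 2c(f - c) = (f² - w) - ((f - c)² - v): a large mean c together with a non-negligible
  -- variance v would make f² vary more than its own Bernstein bound allows. The second bracket is
  -- controlled by the fourth moment of f.
  have hpt : ∀ y, 4 * c ^ 2 * (f y - c) ^ 2 ≤
      2 * (f y * f y - w) ^ 2 + (2 * (f y - c) ^ 4 - 4 * v * (f y - c) ^ 2 + 2 * v ^ 2) := by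
    intro y
    have h1 : 2 * c * (f y - c) = (f y * f y - w) - ((f y - c) ^ 2 - v) := by
      rw [hvdef]; ring
    have h2 : 4 * c ^ 2 * (f y - c) ^ 2 = (2 * c * (f y - c)) ^ 2 := by ring
    rw [h2, h1]
    nlinarith [sq_nonneg ((f y * f y - w) + ((f y - c) ^ 2 - v))]
  have l1 : Integrable (fun y => 2 * (f y * f y - w) ^ 2) μ := j2.const_mul 2
  have l2 : Integrable (fun y => 2 * (f y - c) ^ 4) μ := i4.const_mul 2
  have l3 : Integrable (fun y => 4 * v * (f y - c) ^ 2) μ := i2.const_mul (4 * v)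
  have l4 : Integrable (fun y => 2 * (f y - c) ^ 4 - 4 * v * (f y - c) ^ 2) μ := l2.sub l3
  have l5 : Integrable (fun y => 2 * (f y - c) ^ 4 - 4 * v * (f y - c) ^ 2 + 2 * v ^ 2) μ :=
    l4.add (integrable_const _)
  have hI := integral_mono (i2.const_mul (4 * c ^ 2)) (l1.add l5) hpt
  rw [integral_const_mul, hv] at hI
  have hI2 : ∫ y, (2 * (f y * f y - w) ^ 2 +
      (2 * (f y - c) ^ 4 - 4 * v * (f y - c) ^ 2 + 2 * v ^ 2)) ∂μ =
      2 * ∫ y, (f y * f y - w) ^ 2 ∂μ + (2 * ∫ y, (f y - c) ^ 4 ∂μ - 4 * v * v + 2 * v ^ 2) := by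
    rw [integral_add l1 l5, integral_add l4 (integrable_const _), integral_sub l2 l3,
      integral_const_mul, integral_const_mul, integral_const_mul, hv]
    simp
  have hI3 : 4 * c ^ 2 * v ≤ 2 * ∫ y, (f y * f y - w) ^ 2 ∂μ +
      (2 * ∫ y, (f y - c) ^ 4 ∂μ - 4 * v * v + 2 * v ^ 2) := by
    rw [← hI2]
    exact hI
  have h5 : ∫ y, (f y - c) ^ 4 ∂μ ≤ 12 * σ ^ 2 * m ^ 2 := by
    refine (le_abs_self _).trans (h4.trans (le_of_eq ?_))
    norm_num [Nat.factorial]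
  have h6 : ∫ y, (f y * f y - w) ^ 2 ∂μ ≤ σ ^ 2 := by
    refine (le_abs_self _).trans (k2.trans (le_of_eq ?_))
    simp
  rw [le_div_iff₀ (by positivity)]
  nlinarith [mul_le_mul_of_nonneg_left hvar (sq_nonneg c), sq_nonneg v]

end MeanBound

theorem abs_mul_sub_mul_le {a₁ a₂ b₁ b₂ e W : ℝ} (h₁ : |a₁ - b₁| ≤ e) (h₂ : |a₂ - b₂| ≤ e)
    (hb₁ : |b₁| ≤ W) (hb₂ : |b₂| ≤ W) : |a₁ * a₂ - b₁ * b₂| ≤ e * (e + 2 * W) := by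
  have h3 : a₁ * a₂ - b₁ * b₂ = (a₁ - b₁) * (a₂ - b₂) + ((a₁ - b₁) * b₂ + b₁ * (a₂ - b₂)) := by ring
  have he : 0 ≤ e := (abs_nonneg _).trans h₁
  rw [h3]
  calc _ ≤ |(a₁ - b₁) * (a₂ - b₂)| + (|(a₁ - b₁) * b₂| + |b₁ * (a₂ - b₂)|) :=
        (abs_add_le _ _).trans (add_le_add le_rfl (abs_add_le _ _))
    _ ≤ e * e + (e * W + W * e) := by
        simp only [abs_mul]
        have := (abs_nonneg _).trans hb₁
        gcongr
    _ = _ := by ring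

/-- No measurability of the set is assumed: events over all points of the cube are handled through
outer measure. -/
theorem measure_preimage_le_of_measurePreserving {α β : Type*} [MeasurableSpace α]
    [MeasurableSpace β] {f : α → β} {μ : Measure α} {ν : Measure β} (h : MeasurePreserving f μ ν)
    (s : Set β) : μ (f ⁻¹' s) ≤ ν s := by
  rw [← h.map_eq]
  exact Measure.le_map_apply h.measurable.aemeasurable s

/-! ### Consequences of the conditions on the law -/

section Law

variable {d p n a b k B : ℕ} {κ : Kernel (Cube d) (Fin p → ℝ)}

theorem SparsePDClass.coercive {Sig : Cube d → Matrix (Fin p) (Fin p) ℝ} {q c M₁ ε : ℝ}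
    (h : SparsePDClass Sig q c M₁ ε) (u : Cube d) : Coercive ε (Sig u) := by
  obtain ⟨h1, h2⟩ := h.eigenvalues_ge u
  exact Coercive.of_eigenvalues h1 h2

/-- A diagonal entry is at least ε and is a term of its own row sum. This keeps the sparsity bound
away from zero. -/
theorem SparsePDClass.rpow_le {Sig : Cube d → Matrix (Fin p) (Fin p) ℝ} {q c M₁ ε : ℝ}
    (h : SparsePDClass Sig q c M₁ ε) (hp : 0 < p) (hε : 0 < ε) (hq : 0 ≤ q) : ε ^ q ≤ c := by
  have u : Cube d := fun _ => 0
  have h1 := (h.coercive u).le_diag ⟨0, hp⟩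
  have h3 : sparsity q (Sig u ⟨0, hp⟩ ⟨0, hp⟩) ≤ c :=
    (Finset.single_le_sum (f := fun r => sparsity q (Sig u ⟨0, hp⟩ r))
      (fun r _ => sparsity_nonneg _ _) (Finset.mem_univ _)).trans (h.sparse u ⟨0, hp⟩)
  refine le_trans ?_ h3
  rw [sparsity, if_neg (by linarith : 0 < Sig u ⟨0, hp⟩ ⟨0, hp⟩).ne']
  exact Real.rpow_le_rpow hε.le (h1.trans (le_abs_self _)) hq

/-- The bound of the conditional means. -/
def meanBound (σ m ε : ℝ) : ℝ := Real.sqrt (σ ^ 2 * (1 + 12 * m ^ 2) / (2 * ε))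

theorem RegularLaw.abs_condMean_le [IsMarkovKernel κ] {CL σ m q c M₁ ε : ℝ}
    (h : RegularLaw κ CL σ m) (hs : SparsePDClass (condCov κ) q c M₁ ε) (hε : 0 < ε) (u : Cube d)
    (j : Fin p) : |condMean κ u j| ≤ meanBound σ m ε := by
  refine Real.abs_le_sqrt ?_
  exact (h.bernstein_mean u j).sq_mean_le (h.bernstein_moment u j j) hε
    ((hs.coercive u).le_diag j)

/-- The two forests enter through a union bound, so only the marginal laws of their seeds matter and
`ρ` may couple them arbitrarily. -/
theorem SeedsLaw.measurePreserving_fst {ρ : Measure ((Fin B → TreeSeed n a b) ×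
    (Fin B → TreeSeed n a b))} (h : SeedsLaw ρ) [IsMarkovKernel κ] :
    MeasurePreserving (fun x : Sample d p n × (Fin B → TreeSeed n a b) × (Fin B → TreeSeed n a b) =>
      (x.1, x.2.1)) (jointLaw n B κ ρ)
      ((Measure.pi fun _ : Fin n => (volume : Measure (Cube d)) ⊗ₘ κ).prod
        (forestSeedLaw B n a b)) := by
  have := h.isProb
  have hp : IsProbabilityMeasure (forestSeedLaw B n a b) := by
    rw [← h.fst_law]
    exact Measure.isProbabilityMeasure_map measurable_fst.aemeasurable
  exact (MeasurePreserving.id _).prod ⟨measurable_fst, h.fst_law⟩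

theorem SeedsLaw.measurePreserving_snd {ρ : Measure ((Fin B → TreeSeed n a b) ×
    (Fin B → TreeSeed n a b))} (h : SeedsLaw ρ) [IsMarkovKernel κ] :
    MeasurePreserving (fun x : Sample d p n × (Fin B → TreeSeed n a b) × (Fin B → TreeSeed n a b) =>
      (x.1, x.2.2)) (jointLaw n B κ ρ)
      ((Measure.pi fun _ : Fin n => (volume : Measure (Cube d)) ⊗ₘ κ).prod
        (forestSeedLaw B n a b)) := by
  have := h.isProb
  have hp : IsProbabilityMeasure (forestSeedLaw B n a b) := by
    rw [← h.snd_law]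
    exact Measure.isProbabilityMeasure_map measurable_snd.aemeasurable
  exact (MeasurePreserving.id _).prod ⟨measurable_snd, h.snd_law⟩

end Law

/-- The estimator of the covariance matrix is uniformly consistent in the maximum norm. -/
theorem exists_covEstimator_deviation {d k : ℕ} (hd : 1 ≤ d) (hk : 1 ≤ k) {ω π : ℝ} (hω : 0 < ω)
    (hω' : ω ≤ 1 / 5) (hπ : 0 ≤ π) (hπ' : π ≤ 1) (CL σ m M₁ : ℝ) {ε : ℝ} (hε : 0 < ε) (q : ℝ) :
    ∃ C : ℝ, 0 < C ∧ ∀ (p s : ℕ → ℕ), (∀ n, 0 < p n) → Tendsto s atTop atTop →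
      Tendsto (fun n : ℕ => (s n : ℝ) / n) atTop (𝓝 0) →
      ∃ (B₀ : ℕ → ℕ) (err : ℕ → ℝ), Tendsto err atTop (𝓝 0) ∧
        ∀ᶠ n in atTop, rate d ω π n (p n) (s n) ≤ 1 → ∀ B, B₀ n ≤ B →
        ∀ Rβ Rα : TreeRule d (p n) (s n - s n / 2) (s n / 2), Rβ.IsRegular k ω π →
        Rα.IsRegular k ω π → ∀ (c : ℝ) (κ : Kernel (Cube d) (Fin (p n) → ℝ))
          (ρ : Measure ((Fin B → TreeSeed n (s n - s n / 2) (s n / 2)) ×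
            (Fin B → TreeSeed n (s n - s n / 2) (s n / 2)))),
          Admissible Rβ Rα k κ ρ CL σ m q c M₁ ε →
          jointLaw n B κ ρ {x | ∃ u j r, C * rate d ω π n (p n) (s n) <
            |covEstimator Rβ Rα k x.1 x.2.1 x.2.2 u j r - condCov κ u j r|} ≤
          ENNReal.ofReal (err n) := by
  obtain ⟨C, hC, hforest⟩ := exists_forest_deviation hd hk hω hω' hπ hπ' CL σ m
  have hW : 0 ≤ meanBound σ m ε := Real.sqrt_nonneg _
  -- The first `C` is for the second moments; the rest is for the product of two means, each with
  -- error at most C r ≤ C and bounded target.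
  refine ⟨C + C * (C + 2 * meanBound σ m ε), by positivity, fun p s hp hs hsn => ?_⟩
  obtain ⟨B₀, err, herr, hev⟩ := hforest p s hp hs hsn
  -- One error for each forest, made nonnegative so that `ENNReal.ofReal` is additive on them.
  refine ⟨B₀, fun n => max (err n) 0 + max (err n) 0, by
    simpa using (herr.max (tendsto_const_nhds (x := (0 : ℝ)))).add
      (herr.max (tendsto_const_nhds (x := (0 : ℝ)))), ?_⟩
  filter_upwards [hev] with n hn hrate B hB Rβ Rα hRβ hRα c κ ρ hadm
  have hκ := hadm.markov
  have hreg := hadm.regular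
  set r := rate d ω π n (p n) (s n) with hr
  have hr0 : 0 ≤ r := by rw [hr, rate_eq]; positivity
  have h1 := hn hrate B hB Rβ hRβ κ hκ (Fin (p n) × Fin (p n)) (by simp [sq])
    (fun i y => y i.1 * y i.2)
    (fun i => (measurable_pi_apply _).mul (measurable_pi_apply _))
    (fun i u => hreg.bernstein_moment u i.1 i.2)
    (fun i u u' => hreg.lipschitz_moment u u' i.1 i.2)
  have h2 := hn hrate B hB Rα hRα κ hκ (Fin (p n)) (by
      rw [Fintype.card_fin]; exact Nat.le_self_pow two_ne_zero _) (fun i y => y i)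
    (fun i => measurable_pi_apply _) (fun i u => hreg.bernstein_mean u i)
    (fun i u u' => hreg.lipschitz_mean u u' i)
  rw [ENNReal.ofReal_add (le_max_right _ _) (le_max_right _ _)]
  have hfst := hadm.seeds.measurePreserving_fst (κ := κ)
  have hsnd := hadm.seeds.measurePreserving_snd (κ := κ)
  have k1 := (measure_preimage_le_of_measurePreserving hfst _).trans
    (h1.trans (ENNReal.ofReal_le_ofReal (le_max_left _ (0 : ℝ))))
  have k2 := (measure_preimage_le_of_measurePreserving hsnd _).trans
    (h2.trans (ENNReal.ofReal_le_ofReal (le_max_left _ (0 : ℝ))))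
  refine (measure_mono ?_).trans ((measure_union_le _ _).trans (add_le_add k1 k2))
  rintro x ⟨u, j, l, hx⟩
  by_contra hcon
  simp only [Set.mem_union, Set.mem_preimage, Set.mem_ofPred_eq, not_or, not_exists,
    not_lt] at hcon
  obtain ⟨g1, g2⟩ := hcon
  refine absurd hx (not_lt.2 ?_)
  have e1 := g1 u (j, l)
  have e2 := abs_mul_sub_mul_le (g2 u j) (g2 u l) (hreg.abs_condMean_le hadm.sparse hε u j)
    (hreg.abs_condMean_le hadm.sparse hε u l)
  have e3 : covEstimator Rβ Rα k x.1 x.2.1 x.2.2 u j l - condCov κ u j l =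
      (∑ i, forestWeight Rβ k x.1 x.2.1 u i * ((x.1 i).2 j * (x.1 i).2 l) -
        ∫ y, y j * y l ∂κ u) -
      ((∑ i, forestWeight Rα k x.1 x.2.2 u i * (x.1 i).2 j) *
        (∑ i, forestWeight Rα k x.1 x.2.2 u i * (x.1 i).2 l) -
        condMean κ u j * condMean κ u l) := by
    simp only [covEstimator, condCov, condMoment, Matrix.of_apply]
    ring
  rw [e3]
  refine (abs_sub _ _).trans ?_
  have e4 : C * r * (C * r + 2 * meanBound σ m ε) ≤ C * r * (C * 1 + 2 * meanBound σ m ε) := by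
    gcongr
  calc _ ≤ C * r + C * r * (C * r + 2 * meanBound σ m ε) := add_le_add e1 e2
    _ ≤ C * r + C * r * (C * 1 + 2 * meanBound σ m ε) := by gcongr
    _ = _ := by ring

/-! ### Consistency of the inverse -/

theorem rate_pos {s : ℕ} (hs : 0 < s) (d : ℕ) (ω π : ℝ) (n p : ℕ) : 0 < rate d ω π n p s := by
  have : (0 : ℝ) < s := by exact_mod_cast hs
  unfold rate
  positivity

/-- A sparsity bound that beats a small power of the rate keeps the rate small. -/
theorem lt_of_mul_rpow_lt {c r ρ ε q : ℝ} (hε : 0 < ε) (hq' : q < 1) (hc : ε ^ q ≤ c)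
    (hρ : 0 < ρ) (h : c * r ^ (1 - q) < ε ^ q * ρ ^ (1 - q)) : r < ρ := by
  by_contra hcon
  refine absurd h (not_lt.2 ?_)
  have h1 : 0 ≤ 1 - q := by linarith
  have h2 : 0 < ε ^ q := Real.rpow_pos_of_pos hε q
  have h3 : ρ ^ (1 - q) ≤ r ^ (1 - q) := Real.rpow_le_rpow hρ.le (not_lt.1 hcon) h1
  exact mul_le_mul hc h3 (by positivity) (h2.le.trans hc)

/-- With high probability all the inverses exist and are close to their targets. -/
theorem exists_threshEstimator_bounds {d k : ℕ} (hd : 1 ≤ d) (hk : 1 ≤ k) {ω π : ℝ} (hω : 0 < ω)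
    (hω' : ω ≤ 1 / 5) (hπ : 0 ≤ π) (hπ' : π ≤ 1) {q : ℝ} (hq : 0 ≤ q) (hq' : q < 1)
    (CL σ m M₁ : ℝ) {ε : ℝ} (hε : 0 < ε) :
    ∃ M₀ : ℝ, 0 < M₀ ∧
      ∀ (p s : ℕ → ℕ) (c₀ : ℕ → ℝ)
        (Rβ Rα : ∀ n, TreeRule d (p n) (s n - s n / 2) (s n / 2)) (S : ℝ → ℝ → ℝ),
        (∀ n, 0 < p n) →
        (∀ n, (Rβ n).IsRegular k ω π) → (∀ n, (Rα n).IsRegular k ω π) →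
        IsShrinkage S →
        Tendsto s atTop atTop →
        Tendsto (fun n : ℕ => (s n : ℝ) / n) atTop (𝓝 0) →
        Tendsto (fun n : ℕ => c₀ (p n) * rate d ω π n (p n) (s n) ^ (1 - q)) atTop (𝓝 0) →
        ∃ (B₀ : ℕ → ℕ) (err : ℕ → ℝ), Tendsto err atTop (𝓝 0) ∧
          ∀ B : ℕ → ℕ, (∀ n, B₀ n ≤ B n) →
          ∀ M : Cube d → ℝ, (∀ u, M₀ ≤ M u) → BddAbove (Set.range M) →
            ∃ K₁ K₂ : ℝ, ∀ᶠ n in atTop,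
              ∀ (κ : Kernel (Cube d) (Fin (p n) → ℝ))
                (ρ : Measure ((Fin (B n) → TreeSeed n (s n - s n / 2) (s n / 2)) ×
                  (Fin (B n) → TreeSeed n (s n - s n / 2) (s n / 2)))),
                Admissible (Rβ n) (Rα n) k κ ρ CL σ m q (c₀ (p n)) M₁ ε →
                jointLaw n (B n) κ ρ {x | ¬ ∀ u : Cube d,
                    IsUnit (threshEstimator S M (rate d ω π n (p n) (s n))
                      (Rβ n) (Rα n) k x u) ∧
                    specNorm ((threshEstimator S M (rate d ω π n (p n) (s n))
                        (Rβ n) (Rα n) k x u)⁻¹ - (condCov κ u)⁻¹) ≤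
                      K₁ * (c₀ (p n) * rate d ω π n (p n) (s n) ^ (1 - q)) ∧
                    (1 / (p n : ℝ)) * frobSq ((threshEstimator S M (rate d ω π n (p n) (s n))
                          (Rβ n) (Rα n) k x u)⁻¹ - (condCov κ u)⁻¹) ≤
                      K₂ * (c₀ (p n) * rate d ω π n (p n) (s n) ^ (2 - q))} ≤
                  ENNReal.ofReal (err n) := by
  obtain ⟨C, hC, hdev⟩ := exists_covEstimator_deviation hd hk hω hω' hπ hπ' CL σ m M₁ hε q
  -- The entrywise error C r is then at most half of the threshold M(u) r.
  refine ⟨2 * C, by positivity, ?_⟩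
  intro p s c₀ Rβ Rα S hp hRβ hRα hS hs hsn hc₀
  obtain ⟨B₀, err, herr, hev⟩ := hdev p s hp hs hsn
  refine ⟨B₀, err, herr, fun B hB M hM hMb => ?_⟩
  obtain ⟨Λ, hΛ⟩ := hMb
  have hMΛ : ∀ u, M u ≤ Λ := fun u => hΛ ⟨u, rfl⟩
  have hΛ0 : 0 < Λ := lt_of_lt_of_le (by linarith [hM fun _ => 0]) (hMΛ fun _ => 0)
  refine ⟨2 / ε ^ 2 * (4 * Λ ^ (1 - q)), 4 / ε ^ 4 * (8 * (Λ * Λ ^ (1 - q))), ?_⟩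
  -- A rate below 1 is needed for the deviation bound, one below 2ε/Λ for the diagonal entries.
  have hρ : 0 < min 1 (2 * ε / Λ) := lt_min one_pos (by positivity)
  -- The first level forces the rate below the value just named; the second makes the spectral error
  -- at most ε/2.
  have hη : 0 < min (ε ^ q * min 1 (2 * ε / Λ) ^ (1 - q)) (ε / (8 * Λ ^ (1 - q))) := by
    have := Real.rpow_pos_of_pos hρ (1 - q)
    refine lt_min ?_ ?_ <;> positivity
  filter_upwards [hev, hs.eventually_gt_atTop 0, hc₀.eventually_lt_const hη] with n hn hsn0 hsmall
    κ ρ hadm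
  rw [lt_min_iff] at hsmall
  have hr0 := rate_pos hsn0 d ω π n (p n)
  set r := rate d ω π n (p n) (s n) with hr
  -- That the rate is small is deduced here from the existence of an admissible law, through c₀ ≥
  -- ε^q.
  have hrρ := lt_of_mul_rpow_lt hε hq' (hadm.sparse.rpow_le (hp n) hε hq) hρ hsmall.1
  rw [lt_min_iff, lt_div_iff₀ hΛ0] at hrρ
  refine (measure_mono ?_).trans
    (hn hrρ.1.le (B n) (hB n) (Rβ n) (Rα n) (hRβ n) (hRα n) (c₀ (p n)) κ ρ hadm)
  intro x hx
  by_contra hcon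
  refine hx fun u => ?_
  have hlam : 0 < M u * r := mul_pos (lt_of_lt_of_le (by positivity) (hM u)) hr0
  have hΛr : (Λ * r) ^ (1 - q) = Λ ^ (1 - q) * r ^ (1 - q) := Real.mul_rpow hΛ0.le hr0.le
  have hrr : r * r ^ (1 - q) = r ^ (2 - q) := by
    nth_rewrite 1 [← Real.rpow_one r]
    rw [← Real.rpow_add hr0]
    ring_nf
  have hest : ∀ j l, |covEstimator (Rβ n) (Rα n) k x.1 x.2.1 x.2.2 u j l - condCov κ u j l| ≤
      M u * r / 2 := by
    intro j l
    refine (not_lt.1 fun h => hcon ⟨u, j, l, h⟩).trans ?_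
    nlinarith [mul_le_mul_of_nonneg_right (hM u) hr0.le]
  have hpos : 0 < Λ ^ (1 - q) := Real.rpow_pos_of_pos hΛ0 _
  have hbound : 4 * (Λ * r) ^ (1 - q) * c₀ (p n) ≤ ε / 2 := by
    have h1 := hsmall.2.le
    rw [le_div_iff₀ (by positivity)] at h1
    rw [hΛr]
    linarith
  obtain ⟨g1, g2, g3⟩ := shrinkMatrix_bounds (hp n) hS hq hq' hlam
    (mul_le_mul_of_nonneg_right (hMΛ u) hr0.le) hest hε (by linarith [hrρ.2])
    (hadm.sparse.eigenvalues_ge u).1 (hadm.sparse.coercive u) (hadm.sparse.sparse u) hbound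
  refine ⟨g1, g2.trans (le_of_eq ?_), ?_⟩
  · rw [hΛr]
    ring
  · have hp' : (0 : ℝ) < p n := by exact_mod_cast hp n
    refine (mul_le_mul_of_nonneg_left g3 (by positivity)).trans (le_of_eq ?_)
    rw [hΛr, ← hrr]
    field_simp
    ring

end

end ForestCov

/-! ### The theorem -/

open ForestCov in
theorem theorem3
    (d k : ℕ) (hd : 1 ≤ d) (hk : 1 ≤ k)
    (ω π : ℝ) (hω : 0 < ω) (hω' : ω ≤ 1 / 5) (hπ : 0 < π) (hπ' : π ≤ 1)
    (q : ℝ) (hq : 0 ≤ q) (hq' : q < 1)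
    (CL σB m M₁ ε : ℝ) (hε : 0 < ε) :
    ∃ M₀ : ℝ, 0 < M₀ ∧
      ∀ (p s : ℕ → ℕ) (c₀ : ℕ → ℝ)
        (Rβ Rα : ∀ n, TreeRule d (p n) (s n - s n / 2) (s n / 2)) (S : ℝ → ℝ → ℝ),
        (∀ n, 0 < p n) →
        (∀ n, (Rβ n).IsRegular k ω π) → (∀ n, (Rα n).IsRegular k ω π) →
        IsShrinkage S →
        Tendsto s atTop atTop →
        Tendsto (fun n : ℕ => (s n : ℝ) / n) atTop (𝓝 0) →
        Tendsto (fun n : ℕ => (s n : ℝ) * Real.log (p n) / n) atTop (𝓝 0) →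
        Tendsto (fun n : ℕ => c₀ (p n) * rate d ω π n (p n) (s n) ^ (1 - q)) atTop (𝓝 0) →
        ∃ B₀ : ℕ → ℕ, ∀ B : ℕ → ℕ, (∀ n, B₀ n ≤ B n) →
          ∀ M : Cube d → ℝ, (∀ u, M₀ ≤ M u) → BddAbove (Set.range M) →
            (∀ δ : ℝ, 0 < δ → ∃ K : ℝ, ∀ᶠ n in atTop,
              ∀ (κ : Kernel (Cube d) (Fin (p n) → ℝ))
                (ρ : Measure ((Fin (B n) → TreeSeed n (s n - s n / 2) (s n / 2)) ×
                  (Fin (B n) → TreeSeed n (s n - s n / 2) (s n / 2)))),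
                Admissible (Rβ n) (Rα n) k κ ρ CL σB m q (c₀ (p n)) M₁ ε →
                jointLaw n (B n) κ ρ {x | ∃ u : Cube d,
                    ¬ IsUnit (threshEstimator S M (rate d ω π n (p n) (s n))
                      (Rβ n) (Rα n) k x u) ∨
                    K * (c₀ (p n) * rate d ω π n (p n) (s n) ^ (1 - q)) <
                      specNorm ((threshEstimator S M (rate d ω π n (p n) (s n))
                        (Rβ n) (Rα n) k x u)⁻¹ - (condCov κ u)⁻¹)} ≤ ENNReal.ofReal δ) ∧
            (∀ δ : ℝ, 0 < δ → ∃ K : ℝ, ∀ᶠ n in atTop,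
              ∀ (κ : Kernel (Cube d) (Fin (p n) → ℝ))
                (ρ : Measure ((Fin (B n) → TreeSeed n (s n - s n / 2) (s n / 2)) ×
                  (Fin (B n) → TreeSeed n (s n - s n / 2) (s n / 2)))),
                Admissible (Rβ n) (Rα n) k κ ρ CL σB m q (c₀ (p n)) M₁ ε →
                jointLaw n (B n) κ ρ {x | ∃ u : Cube d,
                    ¬ IsUnit (threshEstimator S M (rate d ω π n (p n) (s n))
                      (Rβ n) (Rα n) k x u) ∨
                    K * (c₀ (p n) * rate d ω π n (p n) (s n) ^ (2 - q)) <
                      (1 / (p n : ℝ)) *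
                        frobSq ((threshEstimator S M (rate d ω π n (p n) (s n))
                          (Rβ n) (Rα n) k x u)⁻¹ - (condCov κ u)⁻¹)} ≤ ENNReal.ofReal δ) := by
  obtain ⟨M₀, hM₀, h⟩ := exists_threshEstimator_bounds hd hk hω hω' hπ.le hπ' hq hq' CL σB m M₁ hε
  refine ⟨M₀, hM₀, fun p s c₀ Rβ Rα S hp hRβ hRα hS hs hsn _ hc₀ => ?_⟩
  obtain ⟨B₀, err, herr, hB₀⟩ := h p s c₀ Rβ Rα S hp hRβ hRα hS hs hsn hc₀
  refine ⟨B₀, fun B hB M hM hMb => ?_⟩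
  obtain ⟨K₁, K₂, hK⟩ := hB₀ B hB M hM hMb
  -- The same constants serve every δ, as the exceptional probability tends to zero; only the
  -- required size of `n` depends on δ.
  refine ⟨fun δ hδ => ⟨K₁, ?_⟩, fun δ hδ => ⟨K₂, ?_⟩⟩ <;>
  · filter_upwards [hK, herr.eventually_le_const hδ] with n hn hle κ ρ hadm
    refine (measure_mono ?_).trans ((hn κ ρ hadm).trans (ENNReal.ofReal_le_ofReal hle))
    rintro x ⟨u, hu⟩ hall
    obtain ⟨g1, g2, g3⟩ := hall u
    rcases hu with hu | hu
    · exact hu g1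
    · linarith
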